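/- Let $n,m\ge 1$ and let $(B^n,g_B)$ and $(F^m,g_F)$ be connected smooth Riemannian manifolds (Hausdorff, second countable, without boundary), and let $f:B\to\mathbb R$ be a nonconstant positive smooth function. Let $M=B\times_f F$ be the warped product, i.e. the manifold $B\times F$ with the Riemannian metric $g=\pi^*g_B+(f\circ\pi)^2\,\eta^*g_F$, where $\pi:M\to B$ and $\eta:M\to F$ are the projections. Suppose that $(M,g,h,\rho)$ is a nontrivial Yamabe gradient soliton: $h:M\to\mathbb R$ is a nonconstant smooth function, $\rho\in\mathbb R$ is a constant, and $$\nabla^2 h=(R-\rho)\,g\quad\text{on } M,$$ where $\nabla^2h$ is the Hessian of $h$ and $R$ the scalar curvature of $g$. Assume that $(B,g_B)$ is complete. Then $h$ has no critical point on $M$, and $(M,g)$ is isometric to a doubly warped product $$\bigl(\mathbb R\times_{|\nabla h|}N^{n-1}\times_f F^m,\; dr^2+|\nabla h|^2 g_N+f^2 g_F\bigr)$$ with $(N^{n-1},g_N)$ a complete connected Riemannian manifold. Precisely: there are such an $(N,g_N)$, a positive smooth function $w:\mathbb R\to\mathbb R$ and a diffeomorphism $\Phi:\mathbb R\times N\to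 B$ such that $|\nabla h|(\Phi(r,y),z)=w(r)$ for all $r\in\mathbb R$, $y\in N$, $z\in F$, and $\Phi\times\mathrm{id}_F:(\mathbb R\times N)\times F\to B\times F$ is an isometry from $dr^2+w(r)^2g_N+f(\Phi(r,y))^2g_F$ onto $g$. -/

import Mathlib

open Set Filter Topology Manifold
open scoped ContDiff ENNReal

set_option maxSynthPendingDepth 3

universe u v

noncomputable section

/-! ### Riemannian metrics and pullbacks -/

/-- A smooth Riemannian metric on the manifold `M`. -/
abbrev SmoothMetric {E : Type*} [NormedAddCommGroup E] [NormedSpace ℝ E]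
    {H : Type*} [TopologicalSpace H] (I : ModelWithCorners ℝ E H)
    (M : Type*) [TopologicalSpace M] [ChartedSpace H M] [IsManifold I ∞ M] : Type _ :=
  Bundle.ContMDiffRiemannianMetric I ∞ E (fun x : M => TangentSpace I x)

section Metrics

open Bundle

variable {E : Type*} [NormedAddCommGroup E] [NormedSpace ℝ E]
  {H : Type*} [TopologicalSpace H] {I : ModelWithCorners ℝ E H}
  {M : Type*} [TopologicalSpace M] [ChartedSpace H M]
  {E' : Type*} [NormedAddCommGroup E'] [NormedSpace ℝ E']
  {H' : Type*} [TopologicalSpace H'] {I' : ModelWithCorners ℝ E' H'}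
  {M' : Type*} [TopologicalSpace M'] [ChartedSpace H' M']

/-- The pullback `φ^* g` of a field `g` of bilinear forms on tangent spaces. -/
def pullbackForm (g : ∀ y : M', TangentSpace I' y →L[ℝ] TangentSpace I' y →L[ℝ] ℝ)
    (φ : M → M') (x : M) : TangentSpace I x →L[ℝ] TangentSpace I x →L[ℝ] ℝ :=
  (ContinuousLinearMap.precomp ℝ (mfderiv I I' φ x)).comp ((g (φ x)).comp (mfderiv I I' φ x))

theorem pullbackForm_apply (g : ∀ y : M', TangentSpace I' y →L[ℝ] TangentSpace I' y →L[ℝ] ℝ)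
    (φ : M → M') (x : M) (v w : TangentSpace I x) :
    pullbackForm (I := I) g φ x v w =
      g (φ x) (mfderiv I I' φ x v) (mfderiv I I' φ x w) := rfl

/-- Smoothness of a field of bilinear forms at `x₀`, read in the trivialization of the tangent
bundle at `x₀`. -/
theorem contMDiffAt_form_iff [IsManifold I ∞ M]
    (g : ∀ y : M, TangentSpace I y →L[ℝ] TangentSpace I y →L[ℝ] ℝ) (x₀ : M) :
    ContMDiffAt I (I.prod 𝓘(ℝ, E →L[ℝ] E →L[ℝ] ℝ)) ∞
      (fun b ↦ TotalSpace.mk' (E →L[ℝ] E →L[ℝ] ℝ)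
        (E := fun b : M => TangentSpace I b →L[ℝ] TangentSpace I b →L[ℝ] ℝ) b (g b)) x₀ ↔
    ContMDiffAt I 𝓘(ℝ, E →L[ℝ] E →L[ℝ] ℝ) ∞ (fun x =>
      (ContinuousLinearMap.precomp ℝ
        ((trivializationAt E (TangentSpace I) x₀).symmL ℝ x)).comp
       ((g x).comp ((trivializationAt E (TangentSpace I) x₀).symmL ℝ x))) x₀ := by
  rw [contMDiffAt_hom_bundle, and_iff_right (by exact contMDiffAt_id)]
  apply Filter.EventuallyEq.contMDiffAt_iff
  filter_upwards [(trivializationAt E (TangentSpace I) x₀).open_baseSet.mem_nhds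
    (mem_baseSet_trivializationAt E (TangentSpace I) x₀)] with x hx
  ext v w
  erw [inCoordinates_apply_eq₂ hx hx (by simp)]
  simp only [Bundle.Trivial.fiberBundle_trivializationAt',
    Bundle.Trivial.linearMapAt_trivialization, LinearMap.id_coe, id_eq]
  change _ = g x ((trivializationAt E (TangentSpace I) x₀).symmL ℝ x v)
    ((trivializationAt E (TangentSpace I) x₀).symmL ℝ x w)
  rw [Trivialization.symmL_apply _ hx, Trivialization.symmL_apply _ hx]

theorem contMDiff_pullbackForm [IsManifold I ∞ M] [IsManifold I' ∞ M']
    {g : ∀ y : M', TangentSpace I' y →L[ℝ] TangentSpace I' y →L[ℝ] ℝ}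
    (hg : ContMDiff I' (I'.prod 𝓘(ℝ, E' →L[ℝ] E' →L[ℝ] ℝ)) ∞
      (fun b ↦ TotalSpace.mk' (E' →L[ℝ] E' →L[ℝ] ℝ)
        (E := fun b : M' => TangentSpace I' b →L[ℝ] TangentSpace I' b →L[ℝ] ℝ) b (g b)))
    {φ : M → M'} (hφ : ContMDiff I I' ∞ φ) :
    ContMDiff I (I.prod 𝓘(ℝ, E →L[ℝ] E →L[ℝ] ℝ)) ∞
      (fun b ↦ TotalSpace.mk' (E →L[ℝ] E →L[ℝ] ℝ)
        (E := fun b : M => TangentSpace I b →L[ℝ] TangentSpace I b →L[ℝ] ℝ) b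
        (pullbackForm (I := I) g φ b)) := by
  intro x₀
  rw [contMDiffAt_form_iff]
  have h1 := ((contMDiffAt_form_iff g (φ x₀)).1 (hg (φ x₀))).comp x₀ (hφ x₀)
  have h2 : ContMDiffAt I 𝓘(ℝ, E →L[ℝ] E') ∞
      (inTangentCoordinates I I' id φ (mfderiv I I' φ) x₀) x₀ :=
    (hφ x₀).mfderiv_const (by simp)
  have h3 := h2.clm_precomp (F₃ := ℝ)
  refine (h3.clm_comp (h1.clm_comp h2)).congr_of_eventuallyEq ?_
  filter_upwards [(hφ x₀).continuousAt.preimage_mem_nhds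
    ((trivializationAt E' (TangentSpace I') (φ x₀)).open_baseSet.mem_nhds
    (mem_baseSet_trivializationAt E' (TangentSpace I') (φ x₀)))] with x hx
  have key : ∀ v : E, (trivializationAt E' (TangentSpace I') (φ x₀)).symmL ℝ (φ x)
      (inTangentCoordinates I I' id φ (mfderiv I I' φ) x₀ x v) =
      mfderiv I I' φ x ((trivializationAt E (TangentSpace I) x₀).symmL ℝ x v) := by
    intro v
    exact Trivialization.symmL_continuousLinearMapAt _ hx _
  ext v w
  change g (φ x) (mfderiv I I' φ x ((trivializationAt E (TangentSpace I) x₀).symmL ℝ x v))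
      (mfderiv I I' φ x ((trivializationAt E (TangentSpace I) x₀).symmL ℝ x w)) =
    g (φ x) ((trivializationAt E' (TangentSpace I') (φ x₀)).symmL ℝ (φ x)
      (inTangentCoordinates I I' id φ (mfderiv I I' φ) x₀ x v))
      ((trivializationAt E' (TangentSpace I') (φ x₀)).symmL ℝ (φ x)
      (inTangentCoordinates I I' id φ (mfderiv I I' φ) x₀ x w))
  rw [key, key]

variable [IsManifold I ∞ M] [IsManifold I' ∞ M']

theorem SmoothMetric.inner_self_nonneg (g : SmoothMetric I M) (x : M) (v : TangentSpace I x) :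
    0 ≤ g.inner x v v := by
  by_cases h : v = 0
  · rw [h, map_zero]
  · exact (g.pos x v h).le

theorem SmoothMetric.inner_zero_left (g : SmoothMetric I M) (x : M) (w : TangentSpace I x) :
    g.inner x 0 w = 0 := by
  rw [map_zero]; simp

theorem SmoothMetric.inner_smul_self (g : SmoothMetric I M) (x : M) (c : ℝ)
    (v : TangentSpace I x) : g.inner x (c • v) (c • v) = c ^ 2 * g.inner x v v := by
  simp only [map_smul, smul_apply, smul_eq_mul]
  ring

/-- The warped product metric `π^* g_B + (f ∘ π)² η^* g_F` on `B × F`, where `π` and `η` are the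
two projections and the warping function `f : B → ℝ` is smooth and positive. -/
def warpedProduct (gB : SmoothMetric I M) (gF : SmoothMetric I' M') (f : M → ℝ)
    (hf : ContMDiff I 𝓘(ℝ, ℝ) ∞ f) (hpos : ∀ x, 0 < f x) :
    SmoothMetric (I.prod I') (M × M') where
  inner p := pullbackForm (I := I.prod I') gB.inner Prod.fst p +
    (f p.1) ^ 2 • pullbackForm (I := I.prod I') gF.inner Prod.snd p
  symm p v w := by
    simp only [add_apply, smul_apply, pullbackForm_apply]
    rw [gB.symm, gF.symm]
  pos p v hv := by
    simp only [add_apply, smul_apply, pullbackForm_apply, mfderiv_fst, mfderiv_snd, smul_eq_mul]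
    change 0 < gB.inner p.1 v.1 v.1 + f p.1 ^ 2 * gF.inner p.2 v.2 v.2
    have hf2 : 0 < f p.1 ^ 2 := pow_pos (hpos p.1) 2
    have h3 : 0 ≤ gF.inner p.2 v.2 v.2 := SmoothMetric.inner_self_nonneg gF p.2 v.2
    have h4 : 0 ≤ gB.inner p.1 v.1 v.1 := SmoothMetric.inner_self_nonneg gB p.1 v.1
    by_cases h1 : v.1 = 0
    · have h2 : v.2 ≠ 0 := fun h2 => hv (Prod.ext h1 h2)
      have := gF.pos p.2 v.2 h2
      positivity
    · have := gB.pos p.1 v.1 h1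
      positivity
  isVonNBounded p := by
    have hf2 : 0 < f p.1 ^ 2 := pow_pos (hpos p.1) 2
    have hB : Bornology.IsBounded {v : E | gB.inner p.1 v v < 1} :=
      (NormedSpace.isVonNBounded_iff ℝ).1 (gB.isVonNBounded p.1)
    have hF : Bornology.IsBounded {v : E' | gF.inner p.2 v v < 1} :=
      (NormedSpace.isVonNBounded_iff ℝ).1 (gF.isVonNBounded p.2)
    have hF' := hF.smul₀ (f p.1)⁻¹
    refine (NormedSpace.isVonNBounded_iff ℝ (E := E × E')).2 ((hB.prod hF').subset ?_)
    rintro ⟨v, w⟩ hvw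
    simp only [add_apply, smul_apply, pullbackForm_apply, mfderiv_fst, mfderiv_snd,
      smul_eq_mul] at hvw
    change gB.inner p.1 v v + f p.1 ^ 2 * gF.inner p.2 w w < 1 at hvw
    have a1 := SmoothMetric.inner_self_nonneg gB p.1 v
    have a2 := SmoothMetric.inner_self_nonneg gF p.2 w
    refine ⟨?_, f p.1 • w, ?_, ?_⟩
    · change gB.inner p.1 v v < 1
      nlinarith
    · refine lt_of_eq_of_lt (SmoothMetric.inner_smul_self gF p.2 (f p.1) w) ?_
      nlinarith
    · simp [smul_smul, (hpos p.1).ne']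
  contMDiff := by
    have h1 := contMDiff_pullbackForm gB.contMDiff
      (contMDiff_fst (I := I) (J := I') (M := M) (N := M') (n := ∞))
    have h2 := contMDiff_pullbackForm gF.contMDiff
      (contMDiff_snd (I := I) (J := I') (M := M) (N := M') (n := ∞))
    intro p
    have h1' := (contMDiffAt_form_iff _ p).1 (h1 p)
    have h2' := (contMDiffAt_form_iff _ p).1 (h2 p)
    rw [contMDiffAt_form_iff]
    have h3 : ContMDiffAt (I.prod I') 𝓘(ℝ, ℝ) ∞ (fun p : M × M' => (f p.1) ^ 2) p :=
      ((hf.comp contMDiff_fst).pow 2) p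
    exact h1'.add (h3.smul h2')

theorem warpedProduct_inner_apply (gB : SmoothMetric I M) (gF : SmoothMetric I' M') (f : M → ℝ)
    (hf : ContMDiff I 𝓘(ℝ, ℝ) ∞ f) (hpos : ∀ x, 0 < f x) (p : M × M')
    (v w : TangentSpace (I.prod I') p) :
    (warpedProduct gB gF f hf hpos).inner p v w =
      gB.inner p.1 v.1 w.1 + f p.1 ^ 2 * gF.inner p.2 v.2 w.2 := by
  simp only [warpedProduct, add_apply, smul_apply, pullbackForm_apply, mfderiv_fst, mfderiv_snd,
    smul_eq_mul]
  rfl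

/-- The standard metric `dr²` on the real line. -/
def realLineMetric : SmoothMetric 𝓘(ℝ, ℝ) ℝ where
  inner := (riemannianMetricVectorSpace ℝ).inner
  symm := (riemannianMetricVectorSpace ℝ).symm
  pos := (riemannianMetricVectorSpace ℝ).pos
  isVonNBounded := (riemannianMetricVectorSpace ℝ).isVonNBounded
  contMDiff := (riemannianMetricVectorSpace ℝ).contMDiff.of_le le_top

/-- Completeness of `(M, g)`: every sequence which is Cauchy for the Riemannian distance of `g`
(the infimum of the lengths of `C^1` paths) converges in `M`. -/
def IsCompleteMetric (g : SmoothMetric I M) : Prop :=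
  letI : RiemannianBundle (fun x : M => TangentSpace I x) := ⟨g.toRiemannianMetric⟩
  ∀ s : ℕ → M,
    (∀ ε : ℝ≥0∞, 0 < ε → ∃ K : ℕ, ∀ i ≥ K, ∀ j ≥ K, riemannianEDist I (s i) (s j) < ε) →
    ∃ x : M, Tendsto s atTop (𝓝 x)

/-- The diffeomorphism `Ψ : (M, g) → (M', g')` is an isometry, i.e. `Ψ^* g' = g`. -/
def IsRiemannianIsometry (g : SmoothMetric I M) (g' : SmoothMetric I' M')
    (Ψ : M ≃ₘ⟮I, I'⟯ M') : Prop :=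
  ∀ x : M, pullbackForm (I := I) g'.inner Ψ x = g.inner x

/-- The gradient of `h`: the vector with `g (∇h, v) = dh v` for all `v`. -/
def metricGradient (g : SmoothMetric I M) (h : M → ℝ) (p : M) : TangentSpace I p :=
  (g.inner p).inverse (mfderiv I 𝓘(ℝ, ℝ) h p : TangentSpace I p →L[ℝ] ℝ)

/-- `|∇h|`. -/
def gradientNorm (g : SmoothMetric I M) (h : M → ℝ) (p : M) : ℝ :=
  Real.sqrt (g.inner p (metricGradient g h p) (metricGradient g h p))

end Metrics

/-! ### Connection and curvature of a metric `G` on a vector space, seen as a coordinate domain -/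

section Coordinates

variable {E : Type*} [NormedAddCommGroup E] [NormedSpace ℝ E]

/-- Christoffel symbols of the first kind, see `christoffelFirst_apply`. -/
def christoffelFirst (G : E → E →L[ℝ] E →L[ℝ] ℝ) (x : E) : E →L[ℝ] E →L[ℝ] E →L[ℝ] ℝ :=
  let D : E →L[ℝ] E →L[ℝ] E →L[ℝ] ℝ := fderiv ℝ G x
  let S : (E →L[ℝ] E →L[ℝ] ℝ) →L[ℝ] (E →L[ℝ] E →L[ℝ] ℝ) :=
    ((ContinuousLinearMap.flipₗᵢ ℝ E E ℝ).toContinuousLinearEquiv).toContinuousLinearMap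
  (1 / 2 : ℝ) • (D + D.flip - S.comp D.flip)

theorem christoffelFirst_apply (G : E → E →L[ℝ] E →L[ℝ] ℝ) (x u v w : E) :
    christoffelFirst G x u v w =
      1 / 2 * (fderiv ℝ G x u v w + fderiv ℝ G x v u w - fderiv ℝ G x w u v) := by
  simp [christoffelFirst]

/-- Christoffel symbols of the second kind, `Γ(u, v) = ∇_u v` for constant vector fields `u, v`:
the vector with `G (Γ(u, v), w) = christoffelFirst G (u, v, w)` for all `w`. -/
def christoffel (G : E → E →L[ℝ] E →L[ℝ] ℝ) (x : E) : E →L[ℝ] E →L[ℝ] E :=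
  (ContinuousLinearMap.compL ℝ E (E →L[ℝ] ℝ) E (G x).inverse).comp (christoffelFirst G x)

theorem christoffel_apply (G : E → E →L[ℝ] E →L[ℝ] ℝ) (x u v : E) :
    christoffel G x u v = (G x).inverse (christoffelFirst G x u v) := rfl

/-- The Hessian `∇²k (u, v) = ∂_u ∂_v k - dk (Γ(u, v))`. -/
def coordHessian (G : E → E →L[ℝ] E →L[ℝ] ℝ) (k : E → ℝ) (x u v : E) : ℝ :=
  fderiv ℝ (fderiv ℝ k) x u v - fderiv ℝ k x (christoffel G x u v)

/-- The Riemann curvature tensor `R(u, v) w = ∇_u ∇_v w - ∇_v ∇_u w` for constant vector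
fields. -/
def coordRiemann (G : E → E →L[ℝ] E →L[ℝ] ℝ) (x u v w : E) : E :=
  fderiv ℝ (christoffel G) x u v w - fderiv ℝ (christoffel G) x v u w
    + christoffel G x u (christoffel G x v w) - christoffel G x v (christoffel G x u w)

/-- The endomorphism `u ↦ R(u, v) w`. -/
def coordRiemannEnd (G : E → E →L[ℝ] E →L[ℝ] ℝ) (x v w : E) : E →ₗ[ℝ] E where
  toFun u := coordRiemann G x u v w
  map_add' a b := by simp only [coordRiemann, map_add, add_apply]; abel
  map_smul' c a := by
    simp only [coordRiemann, map_smul, smul_apply, RingHom.id_apply, smul_sub, smul_add]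

/-- The Ricci tensor `Ric (v, w) = tr (u ↦ R(u, v) w)`. -/
def coordRicci (G : E → E →L[ℝ] E →L[ℝ] ℝ) (x : E) : E →ₗ[ℝ] E →ₗ[ℝ] ℝ :=
  LinearMap.mk₂ ℝ (fun v w => LinearMap.trace ℝ E (coordRiemannEnd G x v w))
    (fun a b w => by
      rw [← map_add]; congr 1; ext u
      simp only [coordRiemannEnd, coordRiemann, LinearMap.coe_mk, AddHom.coe_mk,
        LinearMap.add_apply, map_add, add_apply]
      abel)
    (fun c a w => by
      rw [← map_smul]; congr 1; ext u
      simp only [coordRiemannEnd, coordRiemann, LinearMap.coe_mk, AddHom.coe_mk,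
        LinearMap.smul_apply, map_smul, smul_apply, smul_sub, smul_add])
    (fun v a b => by
      rw [← map_add]; congr 1; ext u
      simp only [coordRiemannEnd, coordRiemann, LinearMap.coe_mk, AddHom.coe_mk,
        LinearMap.add_apply, map_add]
      abel)
    (fun c v a => by
      rw [← map_smul]; congr 1; ext u
      simp only [coordRiemannEnd, coordRiemann, LinearMap.coe_mk, AddHom.coe_mk,
        LinearMap.smul_apply, map_smul, smul_sub, smul_add])

/-- The scalar curvature, i.e. the trace of the Ricci tensor with respect to `G`. -/
def coordScalarCurvature [FiniteDimensional ℝ E] (G : E → E →L[ℝ] E →L[ℝ] ℝ) (x : E) : ℝ :=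
  LinearMap.trace ℝ E
    (((G x).inverse : (E →L[ℝ] ℝ) →ₗ[ℝ] E) ∘ₗ
      (LinearMap.toContinuousLinearMap : (E →ₗ[ℝ] ℝ) ≃ₗ[ℝ] (E →L[ℝ] ℝ)).toLinearMap ∘ₗ
        coordRicci G x)

end Coordinates

/-! ### Hessian and scalar curvature on a manifold without boundary -/

section Curvature

variable {E : Type*} [NormedAddCommGroup E] [NormedSpace ℝ E]
  {H : Type*} [TopologicalSpace H] {I : ModelWithCorners ℝ E H}
  {M : Type*} [TopologicalSpace M] [ChartedSpace H M] [IsManifold I ∞ M]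

/-- The metric `g` in the preferred chart at `p`. -/
def chartMetric (g : SmoothMetric I M) (p : M) (x : E) : E →L[ℝ] E →L[ℝ] ℝ :=
  pullbackForm (I := 𝓘(ℝ, E)) g.inner (extChartAt I p).symm x

/-- The Hessian of `h` with respect to the Levi-Civita connection of `g`, computed in the
preferred chart at `p`. -/
def hessian (g : SmoothMetric I M) (h : M → ℝ) (p : M) (a b : TangentSpace I p) : ℝ :=
  coordHessian (chartMetric g p) (h ∘ (extChartAt I p).symm) (extChartAt I p p)
    (mfderiv I 𝓘(ℝ, E) (extChartAt I p) p a) (mfderiv I 𝓘(ℝ, E) (extChartAt I p) p b)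

/-- The scalar curvature of `g`, computed in the preferred chart at `p`. -/
def scalarCurvature [FiniteDimensional ℝ E] (g : SmoothMetric I M) (p : M) : ℝ :=
  coordScalarCurvature (chartMetric g p) (extChartAt I p p)

/-- `(M, g, h, ρ)` is a Yamabe gradient soliton: `h` is smooth and `∇²h = (R - ρ) g`. -/
structure IsYamabeGradientSoliton [FiniteDimensional ℝ E] (g : SmoothMetric I M) (h : M → ℝ)
    (ρ : ℝ) : Prop where
  contMDiff : ContMDiff I 𝓘(ℝ, ℝ) ∞ h
  hessian_eq : ∀ (p : M) (a b : TangentSpace I p),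
    hessian g h p a b = (scalarCurvature g p - ρ) * g.inner p a b

/-- `p` is a critical point of `h`. -/
def IsCriticalPoint (I : ModelWithCorners ℝ E H) (h : M → ℝ) (p : M) : Prop :=
  mfderiv I 𝓘(ℝ, ℝ) h p = 0

end Curvature

end

noncomputable section
set_option linter.unusedSectionVars false

section Nemytskii

/-- Pointwise application of a continuous family of continuous linear maps to a continuous family
of vectors. -/
noncomputable def pointwiseApply (K : Type*) [TopologicalSpace K] [CompactSpace K]
    (E G : Type*) [NormedAddCommGroup E] [NormedSpace ℝ E]
    [NormedAddCommGroup G] [NormedSpace ℝ G] : C(K, E →L[ℝ] G) →L[ℝ] C(K, E) →L[ℝ] C(K, G) :=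
  LinearMap.mkContinuous₂
    (LinearMap.mk₂ ℝ (fun (A : C(K, E →L[ℝ] G)) (h : C(K, E)) =>
        (⟨fun t => A t (h t), A.continuous.clm_apply h.continuous⟩ : C(K, G)))
      (fun A B h => by ext; simp) (fun c A h => by ext; simp)
      (fun A h k => by ext; simp) (fun c A h => by ext; simp)) 1
    (fun A h => by
      refine (ContinuousMap.norm_le _ (by positivity)).2 fun t => ?_
      rw [one_mul]
      exact ((A t).le_opNorm (h t)).trans (by
          gcongr
          exacts [A.norm_coe_le_norm t, h.norm_coe_le_norm t]))

variable {K : Type*} [TopologicalSpace K] [CompactSpace K]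
  {E G : Type*} [NormedAddCommGroup E] [NormedSpace ℝ E] [NormedAddCommGroup G] [NormedSpace ℝ G]

@[simp] theorem pointwiseApply_apply (A : C(K, E →L[ℝ] G)) (h : C(K, E)) (t : K) :
    pointwiseApply K E G A h t = A t (h t) := rfl

theorem hasFDerivAt_postcomp {g : E → G} {g' : E → E →L[ℝ] G} (hg : ∀ x, HasFDerivAt g (g' x) x)
    (hc : Continuous g) (hc' : Continuous g') (γ : C(K, E)) :
    HasFDerivAt (fun γ : C(K, E) => (ContinuousMap.mk g hc).comp γ)
      (pointwiseApply K E G ((ContinuousMap.mk g' hc').comp γ)) γ := by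
  rw [hasFDerivAt_iff_isLittleO, Asymptotics.isLittleO_iff]
  intro ε hε
  have hK : IsCompact (range γ) := isCompact_range γ.continuous
  have hu := hK.uniformContinuousAt_of_continuousAt g' (fun x _ => hc'.continuousAt)
    (Metric.dist_mem_uniformity hε)
  obtain ⟨δ, hδ, hδ'⟩ := Metric.mem_uniformity_dist.1 hu
  filter_upwards [Metric.ball_mem_nhds γ hδ] with η hη
  refine (ContinuousMap.norm_le _ (by positivity)).2 fun t => ?_
  have h1 : ∀ x ∈ Metric.ball (γ t) δ, ‖g' x - g' (γ t)‖ ≤ ε := by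
    intro x hx
    have := hδ' (a := γ t) (b := x) (by rw [dist_comm]; exact hx) (mem_range_self t)
    rw [← dist_eq_norm, dist_comm]
    exact le_of_lt this
  have h2 : η t ∈ Metric.ball (γ t) δ := (ContinuousMap.dist_apply_le_dist t).trans_lt hη
  have h3 := (convex_ball (γ t) δ).norm_image_sub_le_of_norm_hasFDerivWithin_le' (f := g)
    (f' := g') (φ := g' (γ t)) (C := ε) (fun x _ => (hg x).hasFDerivWithinAt) h1
    (Metric.mem_ball_self hδ) h2
  refine (le_of_eq ?_).trans (h3.trans (mul_le_mul_of_nonneg_left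
    ((η - γ).norm_coe_le_norm t) hε.le))
  simp

end Nemytskii

theorem contDiff_postcomp_nat {K : Type*} [TopologicalSpace K] [CompactSpace K]
    {E : Type u} [NormedAddCommGroup E] [NormedSpace ℝ E] (n : ℕ) :
    ∀ {G : Type u} [NormedAddCommGroup G] [NormedSpace ℝ G] {g : E → G} (hg : ContDiff ℝ n g),
    ContDiff ℝ n (fun γ : C(K, E) => (ContinuousMap.mk g hg.continuous).comp γ) := by
  induction n with
  | zero =>
    intro G _ _ g hg
    exact contDiff_zero.2 (ContinuousMap.continuous_postcomp _)
  | succ n ih =>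
    intro G _ _ g hg
    have hg' : ContDiff ℝ n (fderiv ℝ g) := hg.fderiv_right (by norm_cast)
    have h1 := contDiff_succ_iff_hasFDerivAt (𝕜 := ℝ) (n := n)
      (f := fun γ : C(K, E) => (ContinuousMap.mk g hg.continuous).comp γ)
    push_cast
    rw [h1]
    refine ⟨_, ?_, fun γ => hasFDerivAt_postcomp
      (fun x => (hg.differentiable (by simp) x).hasFDerivAt) _ hg'.continuous γ⟩
    exact (pointwiseApply K E G).contDiff.comp (ih hg')

theorem contDiff_postcomp {K : Type*} [TopologicalSpace K] [CompactSpace K]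
    {E G : Type u} [NormedAddCommGroup E] [NormedSpace ℝ E] [NormedAddCommGroup G]
    [NormedSpace ℝ G] {g : E → G} (hg : ContDiff ℝ ∞ g) :
    ContDiff ℝ ∞ (fun γ : C(K, E) => (ContinuousMap.mk g hg.continuous).comp γ) :=
  contDiff_infty.2 fun n => contDiff_postcomp_nat n (hg.of_le (by exact_mod_cast le_top))

theorem ContinuousMap.contDiff_const {E : Type*} [NormedAddCommGroup E]
    [NormedSpace ℝ E] : ContDiff ℝ ∞
    (fun x : E => (ContinuousMap.const (Icc (-2 : ℝ) 2) x)) := by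
  have : IsBoundedLinearMap ℝ (fun x : E => (ContinuousMap.const (Icc (-2 : ℝ) 2) x)) :=
    { map_add := fun _ _ => rfl
      map_smul := fun _ _ => rfl
      bound := ⟨1, one_pos, fun x => (ContinuousMap.norm_le _ (by positivity)).2
        fun t => by simp⟩ }
  exact this.contDiff

section LocalFlow

variable {E : Type u} [NormedAddCommGroup E] [NormedSpace ℝ E] [CompleteSpace E]

/-- The operator `γ ↦ (t ↦ ∫₀ᵗ γ)` on continuous curves parametrized by `[-2, 2]`. -/
noncomputable def integralFromZero (E : Type u) [NormedAddCommGroup E] [NormedSpace ℝ E]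
    [CompleteSpace E] : C(Icc (-2 : ℝ) 2, E) →L[ℝ] C(Icc (-2 : ℝ) 2, E) :=
  LinearMap.mkContinuous
    { toFun := fun γ => ⟨fun t => ∫ τ in (0 : ℝ)..t, γ (projIcc (-2) 2 (by norm_num) τ), by
        have h : Continuous fun τ : ℝ => γ (projIcc (-2) 2 (by norm_num) τ) :=
          γ.continuous.comp continuous_projIcc
        exact (intervalIntegral.continuous_primitive
          (fun a b => h.intervalIntegrable a b) 0).comp continuous_subtype_val⟩
      map_add' := fun γ η => by
        ext t
        have h : ∀ γ : C(Icc (-2 : ℝ) 2, E), Continuous fun τ : ℝ =>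
            γ (projIcc (-2) 2 (by norm_num) τ) := fun γ => γ.continuous.comp continuous_projIcc
        exact intervalIntegral.integral_add ((h γ).intervalIntegrable _ _)
          ((h η).intervalIntegrable _ _)
      map_smul' := fun c γ => by
        ext t
        exact intervalIntegral.integral_smul c _ } 2
    (fun γ => by
      refine (ContinuousMap.norm_le _ (by positivity)).2 fun t => ?_
      have h1 := intervalIntegral.norm_integral_le_of_norm_le_const (a := 0) (b := (t : ℝ))
        (f := fun τ => γ (projIcc (-2) 2 (by norm_num) τ)) (C := ‖γ‖)
        (fun τ _ => γ.norm_coe_le_norm _)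
      refine h1.trans ?_
      rw [mul_comm]
      refine mul_le_mul_of_nonneg_right ?_ (norm_nonneg _)
      rw [sub_zero]
      exact abs_le.2 t.2)

/-- Solutions of `y' = s v(y)`, `y(0) = x` on the time interval `(-2, 2)` for `(s, x)` close to
`(0, x₀)`; their value at time `1` depends smoothly on `(s, x)`. -/
theorem exists_smooth_solution_family {v : E → E} (hv : ContDiff ℝ ∞ v) (x₀ : E) :
    ∃ Y : ℝ × E → ℝ → E, (∀ᶠ p in 𝓝 ((0 : ℝ), x₀), Y p 0 = p.2 ∧
      ∀ t ∈ Ioo (-2 : ℝ) 2, HasDerivAt (Y p) (p.1 • v (Y p t)) t) ∧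
      (∀ ε > 0, ∀ᶠ p in 𝓝 ((0 : ℝ), x₀), ∀ t, dist (Y p t) x₀ < ε) ∧
      ContDiffAt ℝ ∞ (fun p => Y p 1) (0, x₀) := by
  let K := Icc (-2 : ℝ) 2
  let κ : E → C(K, E) := fun x => ContinuousMap.const K x
  let P : C(K, E) → C(K, E) := fun γ => (ContinuousMap.mk v hv.continuous).comp γ
  let F : (ℝ × E) × C(K, E) → C(K, E) := fun q =>
    q.2 - κ q.1.2 - q.1.1 • integralFromZero E (P q.2)
  have hκ : ContDiff ℝ ∞ κ := ContinuousMap.contDiff_const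
  have hF : ContDiff ℝ ∞ F := by
    have h1 : ContDiff ℝ ∞ (fun q : (ℝ × E) × C(K, E) => integralFromZero E (P q.2)) :=
      (integralFromZero E).contDiff.comp ((contDiff_postcomp hv).comp contDiff_snd)
    have h2 : ContDiff ℝ ∞ (fun q : (ℝ × E) × C(K, E) => κ q.1.2) :=
      hκ.comp (contDiff_snd.comp contDiff_fst)
    exact (contDiff_snd.sub h2).sub ((contDiff_fst.comp contDiff_fst).smul h1)
  let u : (ℝ × E) × C(K, E) := ((0, x₀), κ x₀)
  have hFu : F u = 0 := by simp [F, u]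
  have hinr : fderiv ℝ F u ∘L .inr ℝ (ℝ × E) (C(K, E)) = ContinuousLinearMap.id ℝ _ := by
    have h1 : HasFDerivAt (fun γ : C(K, E) => F ((0, x₀), γ))
        (fderiv ℝ F u ∘L .inr ℝ (ℝ × E) (C(K, E))) (κ x₀) :=
      ((hF.differentiable (by simp) u).hasFDerivAt).comp (κ x₀)
        (hasFDerivAt_prodMk_right (0, x₀) (κ x₀))
    have h2 : (fun γ : C(K, E) => F ((0, x₀), γ)) = fun γ => γ - κ x₀ := by
      ext γ t; simp [F]
    rw [h2] at h1
    exact h1.unique ((hasFDerivAt_id (κ x₀)).sub_const (κ x₀))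
  have hinv : (fderiv ℝ F u ∘L .inr ℝ (ℝ × E) (C(K, E))).IsInvertible := by
    rw [hinr]; exact ⟨ContinuousLinearEquiv.refl ℝ _, rfl⟩
  let Γ : ℝ × E → C(K, E) := hF.contDiffAt.implicitFunction (by simp) hinv
  have hΓ : ContDiffAt ℝ ∞ Γ (0, x₀) :=
    hF.contDiffAt.contDiffAt_implicitFunction (by simp) hinv
  have hΓ0 : Γ (0, x₀) = κ x₀ := hF.contDiffAt.implicitFunction_apply_self (by simp) hinv
  have hΓeq : ∀ᶠ p in 𝓝 ((0 : ℝ), x₀), F (p, Γ p) = 0 := by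
    have := hF.contDiffAt.eventually_apply_implicitFunction (by simp) hinv (u := u)
    rwa [hFu] at this
  refine ⟨fun p t => Γ p (projIcc (-2) 2 (by norm_num) t), ?_, ?_, ?_⟩
  · filter_upwards [hΓeq] with p hp
    have key : ∀ t : K, Γ p t = p.2 + p.1 • ∫ τ in (0 : ℝ)..t,
        v (Γ p (projIcc (-2) 2 (by norm_num) τ)) := by
      intro t
      have := DFunLike.congr_fun hp t
      simp only [F, κ, ContinuousMap.sub_apply, ContinuousMap.smul_apply,
        ContinuousMap.const_apply, ContinuousMap.zero_apply] at this
      rw [sub_sub, sub_eq_zero] at this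
      exact this
    refine ⟨?_, fun t ht => ?_⟩
    · rw [key, projIcc_of_mem _ (show (0 : ℝ) ∈ Icc (-2 : ℝ) 2 by norm_num)]
      simp
    · have hc : Continuous fun τ : ℝ => v (Γ p (projIcc (-2) 2 (by norm_num) τ)) :=
        hv.continuous.comp ((Γ p).continuous.comp continuous_projIcc)
      have h1 : HasDerivAt (fun t : ℝ => p.2 + p.1 • ∫ τ in (0 : ℝ)..t,
          v (Γ p (projIcc (-2) 2 (by norm_num) τ)))
          (p.1 • v (Γ p (projIcc (-2) 2 (by norm_num) t))) t :=
        ((intervalIntegral.integral_hasDerivAt_right (hc.intervalIntegrable _ _)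
          (hc.stronglyMeasurableAtFilter _ _) hc.continuousAt).const_smul p.1).const_add p.2
      refine h1.congr_of_eventuallyEq ?_
      filter_upwards [Ioo_mem_nhds ht.1 ht.2] with τ hτ
      rw [key, projIcc_of_mem _ (Ioo_subset_Icc_self hτ)]
  · intro ε hε
    have h1 : ∀ᶠ p in 𝓝 ((0 : ℝ), x₀), dist (Γ p) (κ x₀) < ε := by
      have := hΓ.continuousAt
      rw [ContinuousAt, hΓ0] at this
      exact this (Metric.ball_mem_nhds _ hε)
    filter_upwards [h1] with p hp t
    exact (ContinuousMap.dist_apply_le_dist (f := Γ p) (g := κ x₀) _).trans_lt hp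
  · exact (ContinuousMap.evalCLM ℝ (M := E)
      (projIcc (-2 : ℝ) 2 (by norm_num) 1)).contDiff.contDiffAt.comp _ hΓ

end LocalFlow

section ChartDerivatives

variable {E : Type*} [NormedAddCommGroup E] [NormedSpace ℝ E]
  {H : Type*} [TopologicalSpace H] {I : ModelWithCorners ℝ E H} [I.Boundaryless]
  {M : Type*} [TopologicalSpace M] [ChartedSpace H M] [IsManifold I ∞ M]

theorem extChartAt_target_mem_nhds_of_mem {p : M} {y : E} (hy : y ∈ (extChartAt I p).target) :
    (extChartAt I p).target ∈ 𝓝 y :=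
  (isOpen_extChartAt_target p).mem_nhds hy

theorem mdifferentiableAt_extChartAt_symm {p : M} {y : E} (hy : y ∈ (extChartAt I p).target) :
    MDifferentiableAt 𝓘(ℝ, E) I (extChartAt I p).symm y := by
  have := mdifferentiableWithinAt_extChartAt_symm (I := I) hy
  rwa [I.range_eq_univ, mdifferentiableWithinAt_univ] at this

theorem contMDiffAt_extChartAt_symm {p : M} {y : E} (hy : y ∈ (extChartAt I p).target) :
    ContMDiffAt 𝓘(ℝ, E) I ∞ (extChartAt I p).symm y :=
  (contMDiffOn_extChartAt_symm p).contMDiffAt (extChartAt_target_mem_nhds_of_mem hy)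

theorem mfderiv_extChartAt_symm_comp {p : M} {y : E} (hy : y ∈ (extChartAt I p).target) :
    (mfderiv 𝓘(ℝ, E) I (extChartAt I p).symm y).comp
      (mfderiv I 𝓘(ℝ, E) (extChartAt I p) ((extChartAt I p).symm y)) =
      ContinuousLinearMap.id ℝ _ := by
  have := mfderivWithin_extChartAt_symm_comp_mfderiv_extChartAt (I := I) hy
  rwa [I.range_eq_univ, mfderivWithin_univ] at this

theorem mfderiv_extChartAt_comp_symm {p : M} {y : E} (hy : y ∈ (extChartAt I p).target) :
    (mfderiv I 𝓘(ℝ, E) (extChartAt I p) ((extChartAt I p).symm y)).comp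
      (mfderiv 𝓘(ℝ, E) I (extChartAt I p).symm y) = ContinuousLinearMap.id ℝ _ := by
  have := mfderiv_extChartAt_comp_mfderivWithin_extChartAt_symm (I := I) hy
  rwa [I.range_eq_univ, mfderivWithin_univ] at this

theorem mfderiv_extChartAt_symm_self (p : M) :
    mfderiv 𝓘(ℝ, E) I (extChartAt I p).symm (extChartAt I p p) = ContinuousLinearMap.id ℝ E := by
  have := mfderivWithin_range_extChartAt_symm (I := I) (x := p)
  rwa [I.range_eq_univ, mfderivWithin_univ] at this

end ChartDerivatives

section ManifoldFlow

variable {E : Type u} [NormedAddCommGroup E] [NormedSpace ℝ E] [FiniteDimensional ℝ E]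
  {H : Type*} [TopologicalSpace H] {I : ModelWithCorners ℝ E H} [I.Boundaryless]
  {M : Type*} [TopologicalSpace M] [ChartedSpace H M] [IsManifold I ∞ M]

/-- A smooth vector field read in the chart at `p`. -/
theorem contDiffOn_vectorField_chart {v : ∀ x : M, TangentSpace I x}
    (hv : ContMDiff I I.tangent ∞ (fun x => (⟨x, v x⟩ : TangentBundle I M))) (p : M) :
    ContDiffOn ℝ ∞ (fun y => (mfderiv I 𝓘(ℝ, E) (extChartAt I p) ((extChartAt I p).symm y)
      (v ((extChartAt I p).symm y)) : E)) (extChartAt I p).target := by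
  have h1 := ((trivializationAt E (TangentSpace I) p).contMDiffOn_section_baseSet_iff
    (s := v) (IB := I) (n := ∞)).1 hv.contMDiffOn
  have h2 := h1.comp (contMDiffOn_extChartAt_symm (I := I) (n := ∞) p)
    (fun y hy => by
      have := (extChartAt I p).map_target hy
      rw [extChartAt_source] at this
      simpa using this)
  refine contMDiffOn_iff_contDiffOn.1 (h2.congr fun y hy => ?_)
  have h3 := (extChartAt I p).map_target hy
  rw [extChartAt_source] at h3
  have h4 := TangentBundle.continuousLinearMapAt_trivializationAt (I := I) h3
  have h5 := congrArg (fun A => A (v ((extChartAt I p).symm y))) h4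
  refine h5.symm.trans ?_
  rw [Bundle.Trivialization.continuousLinearMapAt_apply]
  rw [Bundle.Trivialization.coe_linearMapAt_of_mem _ (by simpa using h3)]
  rfl

/-- Integral curves of `s • v` on `(-2, 2)` starting at `x`, for `(s, x)` close to `(0, x₀)`. -/
theorem exists_smooth_integralCurve_family {v : ∀ x : M, TangentSpace I x}
    (hv : ContMDiff I I.tangent ∞ (fun x => (⟨x, v x⟩ : TangentBundle I M))) (x₀ : M) :
    ∃ Z : ℝ × M → ℝ → M, (∀ᶠ p in 𝓝 ((0 : ℝ), x₀), Z p 0 = p.2 ∧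
      IsMIntegralCurveOn (Z p) (p.1 • v) (Ioo (-2 : ℝ) 2)) ∧
      ContMDiffAt (𝓘(ℝ, ℝ).prod I) I ∞ (fun p => Z p 1) (0, x₀) := by
  set φ := extChartAt I x₀ with hφ
  set V : E → E := fun y => mfderiv I 𝓘(ℝ, E) φ (φ.symm y) (v (φ.symm y)) with hVdef
  have hV : ContDiffOn ℝ ∞ V φ.target := contDiffOn_vectorField_chart hv x₀
  have hopen : IsOpen φ.target := isOpen_extChartAt_target x₀
  have hmem : φ x₀ ∈ φ.target := mem_extChartAt_target x₀
  obtain ⟨δ, hδ, hball⟩ := Metric.isOpen_iff.1 hopen _ hmem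
  let b : ContDiffBump (φ x₀) := ⟨δ / 3, δ / 2, by positivity, by linarith⟩
  let W : E → E := fun y => b y • V y
  have hW : ContDiff ℝ ∞ W := by
    rw [contDiff_iff_contDiffAt]
    intro y
    by_cases hy : y ∈ φ.target
    · exact b.contDiff.contDiffAt.smul (hV.contDiffAt (hopen.mem_nhds hy))
    · have h0 : W =ᶠ[𝓝 y] fun _ => 0 := by
        have h1 : (tsupport b)ᶜ ∈ 𝓝 y := (isClosed_tsupport _).isOpen_compl.mem_nhds
          (fun h => hy (hball (by
            rw [b.tsupport_eq] at h
            exact Metric.closedBall_subset_ball (show δ / 2 < δ by linarith) h)))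
        filter_upwards [h1] with z hz
        simp [W, image_eq_zero_of_notMem_tsupport hz]
      exact contDiffAt_const.congr_of_eventuallyEq h0
  obtain ⟨Y, hY1, hY2, hY3⟩ := exists_smooth_solution_family hW (φ x₀)
  have hcont : ContMDiffAt (𝓘(ℝ, ℝ).prod I) 𝓘(ℝ, ℝ × E) ∞
      (fun p : ℝ × M => (p.1, φ p.2)) (0, x₀) := by
    rw [modelWithCornersSelf_prod, ← chartedSpaceSelf_prod]
    exact contMDiffAt_fst.prodMk (contMDiffAt_extChartAt.comp ((0 : ℝ), x₀) contMDiffAt_snd)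
  have htend : Tendsto (fun p : ℝ × M => (p.1, φ p.2)) (𝓝 (0, x₀)) (𝓝 (0, φ x₀)) :=
    hcont.continuousAt
  have hsrc : ∀ᶠ p : ℝ × M in 𝓝 (0, x₀), p.2 ∈ φ.source :=
    continuousAt_snd.preimage_mem_nhds (extChartAt_source_mem_nhds (I := I) x₀)
  have hY0 : ∀ t, Y (0, φ x₀) t = φ x₀ := fun t => by
    refine eq_of_forall_dist_le fun ε hε => ?_
    exact ((hY2 ε hε).self_of_nhds t).le
  refine ⟨fun p t => φ.symm (Y (p.1, φ p.2) t), ?_, ?_⟩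
  · filter_upwards [htend.eventually hY1, htend.eventually (hY2 (δ / 3) (by positivity)), hsrc]
      with p hp1 hp2 hp3
    refine ⟨?_, fun t ht => ?_⟩
    · simp only [hp1.1]
      exact φ.left_inv hp3
    · have hyb : Y (p.1, φ p.2) t ∈ Metric.ball (φ x₀) (δ / 3) := hp2 t
      have hyt : Y (p.1, φ p.2) t ∈ φ.target :=
        hball (Metric.ball_subset_ball (by linarith) hyb)
      have hb1 : b (Y (p.1, φ p.2) t) = 1 :=
        b.one_of_mem_closedBall (Metric.ball_subset_closedBall hyb)
      have h1 := ((hp1.2 t ht).hasFDerivAt.hasMFDerivAt)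
      have h2 := (mdifferentiableAt_extChartAt_symm hyt).hasMFDerivAt.comp t h1
      refine HasMFDerivAt.hasMFDerivWithinAt (h2.congr_mfderiv ?_)
      ext
      have h3 := congrArg (fun A => A (v (φ.symm (Y (p.1, φ p.2) t))))
        (mfderiv_extChartAt_symm_comp (I := I) hyt)
      have h4 : W (Y (p.1, φ p.2) t) = V (Y (p.1, φ p.2) t) := by simp [W, hb1]
      simp only [h4]
      change mfderiv 𝓘(ℝ, E) I φ.symm (Y (p.1, φ p.2) t) ((1 : ℝ) • p.1 • V (Y (p.1, φ p.2) t))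
        = (1 : ℝ) • p.1 • v (φ.symm (Y (p.1, φ p.2) t))
      rw [one_smul, one_smul]
      exact ((mfderiv 𝓘(ℝ, E) I φ.symm (Y (p.1, φ p.2) t)).map_smul _ _).trans
        (congrArg (p.1 • ·) h3)
  · have h1 : ContMDiffAt 𝓘(ℝ, ℝ × E) 𝓘(ℝ, E) ∞ (fun p : ℝ × E => Y p 1) (0, φ x₀) :=
      hY3.contMDiffAt
    have h2 := h1.comp ((0 : ℝ), x₀) hcont
    refine ContMDiffAt.comp ((0 : ℝ), x₀) (g := φ.symm) ?_ h2
    refine contMDiffAt_extChartAt_symm ?_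
    simp only [hY0]
    exact hmem

/-- Uniform local existence of integral curves. -/
theorem eventually_exists_isMIntegralCurveOn {v : ∀ x : M, TangentSpace I x}
    (hv : ContMDiff I I.tangent ∞ (fun x => (⟨x, v x⟩ : TangentBundle I M))) (x₀ : M) :
    ∃ ε > 0, ∀ᶠ x in 𝓝 x₀, ∃ γ : ℝ → M, γ 0 = x ∧ IsMIntegralCurveOn γ v (Ioo (-ε) ε) := by
  obtain ⟨Z, hZ, -⟩ := exists_smooth_integralCurve_family hv x₀
  rw [nhds_prod_eq] at hZ
  obtain ⟨pa, hpa, pb, hpb, hab⟩ := Filter.eventually_prod_iff.1 hZ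
  obtain ⟨δ, hδ, hδ'⟩ := Metric.eventually_nhds_iff.1 hpa
  refine ⟨δ / 2, by positivity, hpb.mono fun x hx => ?_⟩
  obtain ⟨h1, h2⟩ := hab (x := δ / 2) (hδ' (by
    rw [dist_zero_right, Real.norm_of_nonneg (by positivity)]; linarith)) hx
  have hne : (δ / 2)⁻¹ ≠ 0 := by positivity
  refine ⟨Z (δ / 2, x) ∘ (· * (δ / 2)⁻¹), by simp [h1], ?_⟩
  have h3 := h2.comp_mul (δ / 2)⁻¹
  rw [show (δ / 2)⁻¹ • (δ / 2, x).1 • v = v by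
    rw [smul_smul, inv_mul_cancel₀ (by positivity), one_smul]] at h3
  refine h3.mono fun t ht => ?_
  have hpos : (0 : ℝ) < δ / 2 := by positivity
  change t * (δ / 2)⁻¹ ∈ Ioo (-2 : ℝ) 2
  rw [← div_eq_mul_inv, mem_Ioo, lt_div_iff₀ hpos, div_lt_iff₀ hpos]
  constructor <;> [linarith [ht.1]; linarith [ht.2]]

variable [T2Space M]

theorem ContMDiff.vectorField_one {v : ∀ x : M, TangentSpace I x}
    (hv : ContMDiff I I.tangent ∞ (fun x => (⟨x, v x⟩ : TangentBundle I M))) :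
    ContMDiff I I.tangent 1 (fun x => (⟨x, v x⟩ : TangentBundle I M)) :=
  hv.of_le (by exact_mod_cast le_top)

theorem contMDiffAt_flow_zero {v : ∀ x : M, TangentSpace I x}
    (hv : ContMDiff I I.tangent ∞ (fun x => (⟨x, v x⟩ : TangentBundle I M)))
    {θ : ℝ → M → M} (h0 : ∀ x, θ 0 x = x) (hθ : ∀ x, IsMIntegralCurve (fun t => θ t x) v) (x₀ : M) :
    ContMDiffAt (𝓘(ℝ, ℝ).prod I) I ∞ (fun p : ℝ × M => θ p.1 p.2) (0, x₀) := by
  obtain ⟨Z, hZ, hZs⟩ := exists_smooth_integralCurve_family hv x₀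
  refine hZs.congr_of_eventuallyEq ?_
  filter_upwards [hZ] with p hp
  have hpv : ContMDiff I I.tangent 1 (fun x => (⟨x, (p.1 • v) x⟩ : TangentBundle I M)) := by
    intro x
    exact ContMDiffAt.const_smul_section (hv.vectorField_one x)
  have h1 : IsMIntegralCurveOn ((fun t => θ t p.2) ∘ (· * p.1)) (p.1 • v) (Ioo (-2) 2) :=
    ((hθ p.2).comp_mul p.1).isMIntegralCurveOn _
  have h2 := isMIntegralCurveOn_Ioo_eqOn_of_contMDiff_boundaryless (t₀ := 0) (by norm_num)
    hpv h1 hp.2 (by simp [h0, hp.1]) (show (1 : ℝ) ∈ Ioo (-2 : ℝ) 2 by norm_num)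
  simpa using h2

theorem flow_add {v : ∀ x : M, TangentSpace I x}
    (hv : ContMDiff I I.tangent ∞ (fun x => (⟨x, v x⟩ : TangentBundle I M)))
    {θ : ℝ → M → M} (h0 : ∀ x, θ 0 x = x) (hθ : ∀ x, IsMIntegralCurve (fun t => θ t x) v)
    (s t : ℝ) (x : M) : θ (s + t) x = θ s (θ t x) := by
  have h1 := (hθ x).comp_add t
  have h2 := isMIntegralCurve_Ioo_eq_of_contMDiff_boundaryless (t₀ := 0) hv.vectorField_one
    h1 (hθ (θ t x)) (by simp [h0])
  exact congrFun h2 s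

theorem contMDiff_flow {v : ∀ x : M, TangentSpace I x}
    (hv : ContMDiff I I.tangent ∞ (fun x => (⟨x, v x⟩ : TangentBundle I M)))
    {θ : ℝ → M → M} (h0 : ∀ x, θ 0 x = x) (hθ : ∀ x, IsMIntegralCurve (fun t => θ t x) v) :
    ContMDiff (𝓘(ℝ, ℝ).prod I) I ∞ (fun p : ℝ × M => θ p.1 p.2) := by
  rw [contMDiff_infty]
  intro n
  have hadd := flow_add hv h0 hθ
  -- smoothness of the flow for small times, near each point
  have hloc : ∀ y : M, ∃ ε > 0, ∀ᶠ x in 𝓝 y, ∀ s : ℝ, |s| < ε →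
      ContMDiffAt (𝓘(ℝ, ℝ).prod I) I n (fun p : ℝ × M => θ p.1 p.2) (s, x) := by
    intro y
    have h0' : ContMDiffAt (𝓘(ℝ, ℝ).prod I) I n (fun p : ℝ × M => θ p.1 p.2) (0, y) :=
      (contMDiffAt_flow_zero hv h0 hθ y).of_le (by exact_mod_cast le_top)
    have h1 := (contMDiffAt_iff_contMDiffAt_nhds (by simp)).1 h0'
    rw [nhds_prod_eq] at h1
    obtain ⟨pa, hpa, pb, hpb, hab⟩ := Filter.eventually_prod_iff.1 h1
    obtain ⟨ε, hε, hε'⟩ := Metric.eventually_nhds_iff.1 hpa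
    exact ⟨ε, hε, hpb.mono fun x hx s hs => hab (hε' (by simpa using hs)) hx⟩
  -- propagation in time
  have hstep : ∀ (s t : ℝ) (x : M), ContMDiffAt I I n (θ t) x →
      ContMDiffAt (𝓘(ℝ, ℝ).prod I) I n (fun p : ℝ × M => θ p.1 p.2) (s, θ t x) →
      ContMDiffAt (𝓘(ℝ, ℝ).prod I) I n (fun p : ℝ × M => θ p.1 p.2) (s + t, x) := by
    intro s t x h1 h2
    have h3 : ContMDiffAt (𝓘(ℝ, ℝ).prod I) (𝓘(ℝ, ℝ).prod I) n
        (fun p : ℝ × M => (p.1 - t, θ t p.2)) (s + t, x) :=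
      (contMDiffAt_fst.sub contMDiffAt_const).prodMk (h1.comp (s + t, x) contMDiffAt_snd)
    have h4 : ContMDiffAt (𝓘(ℝ, ℝ).prod I) I n
        ((fun p : ℝ × M => θ p.1 p.2) ∘ fun p : ℝ × M => (p.1 - t, θ t p.2)) (s + t, x) := by
      refine ContMDiffAt.comp (s + t, x) ?_ h3
      simpa using h2
    refine h4.congr_of_eventuallyEq (Eventually.of_forall fun p => ?_)
    simp only [Function.comp]
    rw [← hadd, sub_add_cancel]
  have hslice : ∀ (t : ℝ) (x : M),
      ContMDiffAt (𝓘(ℝ, ℝ).prod I) I n (fun p : ℝ × M => θ p.1 p.2) (t, x) →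
      ContMDiffAt I I n (θ t) x := fun t x h =>
    h.comp x (contMDiffAt_const.prodMk contMDiffAt_id)
  have hslices : ∀ (x : M) (t : ℝ), ContMDiffAt I I n (θ t) x := by
    intro x
    have hop : ∀ t₀, ∀ᶠ t in 𝓝 t₀, (ContMDiffAt I I n (θ t) x ↔ ContMDiffAt I I n (θ t₀) x) := by
      intro t₀
      obtain ⟨ε, hε, hev⟩ := hloc (θ t₀ x)
      have hc : ContinuousAt (fun t => θ t x) t₀ := (hθ x).continuous.continuousAt
      filter_upwards [hc.eventually hev, Metric.ball_mem_nhds t₀ hε] with t ht1 ht2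
      rw [Metric.mem_ball, Real.dist_eq] at ht2
      constructor
      · intro h
        have := hslice _ _ (hstep (t₀ - t) t x h (ht1 _ (by rwa [abs_sub_comm])))
        rwa [sub_add_cancel] at this
      · intro h
        have := hslice _ _ (hstep (t - t₀) t₀ x h (hev.self_of_nhds _ ht2))
        rwa [sub_add_cancel] at this
    have hcl : IsClopen {t | ContMDiffAt I I n (θ t) x} := by
      refine ⟨⟨?_⟩, ?_⟩
      · rw [isOpen_iff_mem_nhds]
        intro t ht
        filter_upwards [hop t] with s hs hs'
        exact ht (hs.1 hs')
      · rw [isOpen_iff_mem_nhds]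
        intro t ht
        filter_upwards [hop t] with s hs
        exact hs.2 ht
    have huniv := hcl.eq_univ ⟨0, by
      have : θ 0 = id := funext h0
      simp only [mem_ofPred_eq, this]
      exact contMDiffAt_id⟩
    intro t
    have : t ∈ {t | ContMDiffAt I I n (θ t) x} := huniv ▸ mem_univ t
    exact this
  rintro ⟨t, x⟩
  obtain ⟨ε, hε, hev⟩ := hloc (θ t x)
  have := hstep 0 t x (hslices x t) (hev.self_of_nhds 0 (by simpa using hε))
  rwa [zero_add] at this

end ManifoldFlow

section Distance

open Bundle

variable {E : Type*} [NormedAddCommGroup E] [NormedSpace ℝ E]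
  {H : Type*} [TopologicalSpace H] {I : ModelWithCorners ℝ E H}
  {M : Type*} [TopologicalSpace M] [ChartedSpace H M] [IsManifold I ∞ M]
  {E' : Type*} [NormedAddCommGroup E'] [NormedSpace ℝ E']
  {H' : Type*} [TopologicalSpace H'] {I' : ModelWithCorners ℝ E' H'}
  {M' : Type*} [TopologicalSpace M'] [ChartedSpace H' M'] [IsManifold I' ∞ M']

/-- The length of the path `γ` on `[a, b]` with respect to `g`. -/
def metricLength (g : SmoothMetric I M) (γ : ℝ → M) (a b : ℝ) : ℝ≥0∞ :=
  letI : RiemannianBundle (fun x : M => TangentSpace I x) := ⟨g.toRiemannianMetric⟩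
  pathELength I γ a b

/-- The Riemannian distance of `g`. -/
def metricEDist (g : SmoothMetric I M) (x y : M) : ℝ≥0∞ :=
  letI : RiemannianBundle (fun x : M => TangentSpace I x) := ⟨g.toRiemannianMetric⟩
  riemannianEDist I x y

theorem metricLength_eq (g : SmoothMetric I M) (γ : ℝ → M) (a b : ℝ) :
    metricLength g γ a b = ∫⁻ t in Ioo a b, ENNReal.ofReal (Real.sqrt
      (g.inner (γ t) (mfderiv 𝓘(ℝ, ℝ) I γ t (1 : ℝ)) (mfderiv 𝓘(ℝ, ℝ) I γ t (1 : ℝ)))) := by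
  let _ : RiemannianBundle (fun x : M => TangentSpace I x) := ⟨g.toRiemannianMetric⟩
  rw [metricLength, pathELength_eq_lintegral_mfderiv_Ioo]
  refine MeasureTheory.lintegral_congr fun t => ?_
  rw [← ofReal_norm]
  rfl

theorem isCompleteMetric_iff (g : SmoothMetric I M) : IsCompleteMetric g ↔
    ∀ s : ℕ → M, (∀ ε : ℝ≥0∞, 0 < ε → ∃ K : ℕ, ∀ i ≥ K, ∀ j ≥ K, metricEDist g (s i) (s j) < ε) →
      ∃ x : M, Tendsto s atTop (𝓝 x) := Iff.rfl

theorem metricEDist_comm (g : SmoothMetric I M) (x y : M) :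
    metricEDist g x y = metricEDist g y x := by
  let _ : RiemannianBundle (fun x : M => TangentSpace I x) := ⟨g.toRiemannianMetric⟩
  exact riemannianEDist_comm

theorem metricEDist_le_length (g : SmoothMetric I M) {γ : ℝ → M} {a b : ℝ} (hab : a ≤ b)
    (hγ : ContMDiffOn 𝓘(ℝ, ℝ) I 1 γ (Icc a b)) :
    metricEDist g (γ a) (γ b) ≤ metricLength g γ a b := by
  let _ : RiemannianBundle (fun x : M => TangentSpace I x) := ⟨g.toRiemannianMetric⟩
  exact riemannianEDist_le_pathELength hγ rfl rfl hab

theorem exists_metricLength_lt (g : SmoothMetric I M) {x y : M} {r : ℝ≥0∞}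
    (h : metricEDist g x y < r) : ∃ γ : ℝ → M, γ 0 = x ∧ γ 1 = y ∧
      ContMDiffOn 𝓘(ℝ, ℝ) I 1 γ (Icc 0 1) ∧ metricLength g γ 0 1 < r := by
  let _ : RiemannianBundle (fun x : M => TangentSpace I x) := ⟨g.toRiemannianMetric⟩
  exact exists_lt_of_riemannianEDist_lt h

theorem metricEDist_le_of_speed_le (g : SmoothMetric I M) {γ : ℝ → M} {a b C : ℝ} (hab : a ≤ b)
    (hC : 0 ≤ C) (hγ : ContMDiffOn 𝓘(ℝ, ℝ) I 1 γ (Icc a b))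
    (hs : ∀ t ∈ Ioo a b, g.inner (γ t) (mfderiv 𝓘(ℝ, ℝ) I γ t (1 : ℝ))
      (mfderiv 𝓘(ℝ, ℝ) I γ t (1 : ℝ)) ≤ C ^ 2) :
    metricEDist g (γ a) (γ b) ≤ ENNReal.ofReal (C * (b - a)) := by
  refine (metricEDist_le_length g hab hγ).trans ?_
  rw [metricLength_eq]
  refine (MeasureTheory.setLIntegral_mono' measurableSet_Ioo (g := fun _ => ENNReal.ofReal C)
    fun t ht => ENNReal.ofReal_le_ofReal ?_).trans ?_
  · exact (Real.sqrt_le_sqrt (hs t ht)).trans_eq (Real.sqrt_sq hC)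
  · rw [MeasureTheory.setLIntegral_const, Real.volume_Ioo, ENNReal.ofReal_mul hC]

theorem metricEDist_map_le (g : SmoothMetric I M) (g' : SmoothMetric I' M') {φ : M → M'}
    (hφ : ContMDiff I I' ∞ φ) {C : ℝ} (hC : 0 < C)
    (hle : ∀ (x : M) (v : TangentSpace I x), g'.inner (φ x) (mfderiv I I' φ x v)
      (mfderiv I I' φ x v) ≤ C ^ 2 * g.inner x v v) (x y : M) :
    metricEDist g' (φ x) (φ y) ≤ ENNReal.ofReal C * metricEDist g x y := by
  have hφ1 : ContMDiff I I' 1 φ := hφ.of_le (by exact_mod_cast le_top)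
  have key : ∀ r, metricEDist g x y < r → metricEDist g' (φ x) (φ y) ≤ ENNReal.ofReal C * r := by
    intro r hr
    obtain ⟨γ, h0, h1, hγ, hl⟩ := exists_metricLength_lt g hr
    have h2 := metricEDist_le_length g' (γ := φ ∘ γ) zero_le_one (hφ1.comp_contMDiffOn hγ)
    simp only [Function.comp, h0, h1] at h2
    refine h2.trans (le_trans ?_ (mul_le_mul_right hl.le _))
    rw [metricLength_eq, metricLength_eq,
      ← MeasureTheory.lintegral_const_mul' _ _ ENNReal.ofReal_ne_top]
    refine MeasureTheory.setLIntegral_mono' measurableSet_Ioo fun t ht => ?_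
    rw [← ENNReal.ofReal_mul hC.le]
    refine ENNReal.ofReal_le_ofReal ?_
    have hd : MDifferentiableAt 𝓘(ℝ, ℝ) I γ t :=
      ((hγ.contMDiffAt (Icc_mem_nhds ht.1 ht.2)).mdifferentiableAt (by simp))
    have h3 : mfderiv 𝓘(ℝ, ℝ) I' (φ ∘ γ) t =
        (mfderiv I I' φ (γ t)).comp (mfderiv 𝓘(ℝ, ℝ) I γ t) :=
      mfderiv_comp (I' := I) t (hφ1.mdifferentiable (by simp) _) hd
    rw [h3]
    refine (Real.sqrt_le_sqrt (hle _ _)).trans_eq ?_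
    rw [Real.sqrt_mul (by positivity), Real.sqrt_sq hC.le]
    rfl
  have hC0 : ENNReal.ofReal C ≠ 0 := by simpa using hC
  rw [mul_comm, ← ENNReal.div_le_iff hC0 ENNReal.ofReal_ne_top]
  refine le_of_forall_gt fun r hr => ?_
  obtain ⟨q, hq1, hq2⟩ := exists_between hr
  refine lt_of_le_of_lt ?_ hq2
  rw [ENNReal.div_le_iff hC0 ENNReal.ofReal_ne_top, mul_comm]
  exact key q hq1

end Distance

section GlobalFlow

variable {E : Type u} [NormedAddCommGroup E] [NormedSpace ℝ E] [FiniteDimensional ℝ E]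
  {H : Type*} [TopologicalSpace H] {I : ModelWithCorners ℝ E H} [I.Boundaryless]
  {M : Type*} [TopologicalSpace M] [ChartedSpace H M] [IsManifold I ∞ M]

theorem IsMIntegralCurveOn.contMDiffAt_one {v : ∀ x : M, TangentSpace I x}
    (hv : ContMDiff I I.tangent ∞ (fun x => (⟨x, v x⟩ : TangentBundle I M)))
    {γ : ℝ → M} {s : Set ℝ} (hs : IsOpen s) (hγ : IsMIntegralCurveOn γ v s) {t : ℝ} (ht : t ∈ s) :
    ContMDiffAt 𝓘(ℝ, ℝ) I 1 γ t := by
  have hct : ∀ τ ∈ s, ContinuousAt γ τ := fun τ hτ =>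
    (hγ.continuousOn τ hτ).continuousAt (hs.mem_nhds hτ)
  set φ := extChartAt I (γ t) with hφ
  have hV := contDiffOn_vectorField_chart hv (γ t)
  rw [contMDiffAt_iff_target]
  refine ⟨hct t ht, ?_⟩
  rw [contMDiffAt_iff_contDiffAt, contDiffAt_one_iff]
  have hsrc : γ ⁻¹' φ.source ∈ 𝓝 t :=
    (hct t ht).preimage_mem_nhds (extChartAt_source_mem_nhds (I := I) (γ t))
  obtain ⟨U, hU1, hU2, hU3⟩ := mem_nhds_iff.1 (inter_mem hsrc (hs.mem_nhds ht))
  refine ⟨fun τ => ContinuousLinearMap.toSpanSingleton ℝ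
    ((mfderiv I 𝓘(ℝ, E) φ (φ.symm (φ (γ τ))) (v (φ.symm (φ (γ τ)))) : E)), U, hU2.mem_nhds hU3,
    ?_, fun τ hτ => ?_⟩
  · have h1 : ContinuousOn (fun τ => φ (γ τ)) U := fun τ hτ =>
      ((continuousAt_extChartAt' (hU1 hτ).1).comp (hct τ (hU1 hτ).2)).continuousWithinAt
    have h2 := hV.continuousOn.comp h1 (fun τ hτ => φ.map_source (hU1 hτ).1)
    exact (ContinuousLinearMap.toSpanSingletonCLE (𝕜 := ℝ)).continuous.comp_continuousOn h2
  · have h1 : HasMFDerivAt 𝓘(ℝ, ℝ) I γ τ ((1 : ℝ →L[ℝ] ℝ).smulRight (v (γ τ))) :=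
      (hγ τ (hU1 hτ).2).hasMFDerivAt (hs.mem_nhds (hU1 hτ).2)
    have h0 := (hU1 hτ).1
    have h2 : HasMFDerivAt I 𝓘(ℝ, E) φ (γ τ) (mfderiv I 𝓘(ℝ, E) φ (γ τ)) :=
      (mdifferentiableAt_extChartAt (by rw [← extChartAt_source I]; exact h0)).hasMFDerivAt
    have h3 := (h2.comp τ h1).hasFDerivAt
    have h4 : φ.symm (φ (γ τ)) = γ τ := φ.left_inv h0
    refine h3.congr_fderiv ?_
    ext
    change mfderiv I 𝓘(ℝ, E) φ (γ τ) ((1 : ℝ) • v (γ τ)) =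
      (1 : ℝ) • (mfderiv I 𝓘(ℝ, E) φ (φ.symm (φ (γ τ))) (v (φ.symm (φ (γ τ)))) : E)
    rw [h4]
    exact (mfderiv I 𝓘(ℝ, E) φ (γ τ)).map_smul _ _

theorem IsMIntegralCurveOn.metricEDist_le {v : ∀ x : M, TangentSpace I x}
    (hv : ContMDiff I I.tangent ∞ (fun x => (⟨x, v x⟩ : TangentBundle I M)))
    (g : SmoothMetric I M) {C : ℝ} (hC : 0 ≤ C) (hvC : ∀ x, g.inner x (v x) (v x) ≤ C ^ 2)
    {γ : ℝ → M} {s : Set ℝ} (hs : IsOpen s) (hγ : IsMIntegralCurveOn γ v s) {a b : ℝ}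
    (hab : a ≤ b) (hsub : Icc a b ⊆ s) :
    metricEDist g (γ a) (γ b) ≤ ENNReal.ofReal (C * (b - a)) := by
  refine metricEDist_le_of_speed_le g hab hC
    (fun t ht => (hγ.contMDiffAt_one hv hs (hsub ht)).contMDiffWithinAt) fun t ht => ?_
  have h1 : HasMFDerivAt 𝓘(ℝ, ℝ) I γ t ((1 : ℝ →L[ℝ] ℝ).smulRight (v (γ t))) :=
    (hγ t (hsub (Ioo_subset_Icc_self ht))).hasMFDerivAt
      (hs.mem_nhds (hsub (Ioo_subset_Icc_self ht)))
  have h2 : mfderiv 𝓘(ℝ, ℝ) I γ t (1 : ℝ) = v (γ t) := by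
    rw [h1.mfderiv]
    exact one_smul ℝ (v (γ t))
  rw [h2]
  exact hvC _

variable [T2Space M]

theorem IsMIntegralCurveOn.exists_extension_right {v : ∀ x : M, TangentSpace I x}
    (hv : ContMDiff I I.tangent ∞ (fun x => (⟨x, v x⟩ : TangentBundle I M)))
    (g : SmoothMetric I M) (hcomplete : IsCompleteMetric g) {C : ℝ} (hC : 0 ≤ C)
    (hvC : ∀ x, g.inner x (v x) (v x) ≤ C ^ 2) {γ : ℝ → M} {a b : ℝ} (ha : 0 < a) (hb : 0 < b)
    (hγ : IsMIntegralCurveOn γ v (Ioo (-b) a)) :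
    ∃ a' > a, ∃ γ' : ℝ → M, γ' 0 = γ 0 ∧ IsMIntegralCurveOn γ' v (Ioo (-b) a') := by
  let t : ℕ → ℝ := fun n => a - a * (1 / ((n : ℝ) + 1))
  have ht : ∀ n, t n ∈ Ico 0 a := fun n => by
    have h1 : 0 < 1 / ((n : ℝ) + 1) := Nat.one_div_pos_of_nat
    have h2 : 1 / ((n : ℝ) + 1) ≤ 1 := by
      rw [div_le_one (by positivity)]; linarith [n.cast_nonneg (α := ℝ)]
    constructor <;> simp only [t] <;> nlinarith
  have htend : Tendsto t atTop (𝓝 a) := by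
    have := (tendsto_one_div_add_atTop_nhds_zero_nat (𝕜 := ℝ)).const_mul a
    simpa [t] using this.const_sub a
  have hcau : ∀ ε : ℝ≥0∞, 0 < ε → ∃ K : ℕ, ∀ i ≥ K, ∀ j ≥ K,
      metricEDist g (γ (t i)) (γ (t j)) < ε := by
    intro ε hε
    obtain ⟨δ, hδ, hδε⟩ : ∃ δ : ℝ, 0 < δ ∧ ENNReal.ofReal (C * δ) < ε := by
      have h1 : Tendsto (fun δ : ℝ => ENNReal.ofReal (C * δ)) (𝓝[>] 0) (𝓝 0) := by
        have : Continuous fun δ : ℝ => ENNReal.ofReal (C * δ) :=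
          ENNReal.continuous_ofReal.comp (continuous_const_mul C)
        have := this.tendsto 0
        simp only [mul_zero, ENNReal.ofReal_zero] at this
        exact this.mono_left nhdsWithin_le_nhds
      exact ((eventually_mem_nhdsWithin).and (h1.eventually_lt_const hε)).exists
    obtain ⟨K, hK⟩ := Metric.cauchySeq_iff.1 htend.cauchySeq δ hδ
    have main : ∀ i ≥ K, ∀ j ≥ K, t i ≤ t j → metricEDist g (γ (t i)) (γ (t j)) < ε := by
      intro i hi j hj hij
      have h1 := hγ.metricEDist_le hv g hC hvC isOpen_Ioo hij
        (fun τ hτ => ⟨by linarith [(ht i).1, hτ.1], by linarith [(ht j).2, hτ.2]⟩)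
      refine h1.trans_lt (lt_of_le_of_lt (ENNReal.ofReal_le_ofReal ?_) hδε)
      have h2 := hK i hi j hj
      rw [Real.dist_eq, abs_lt] at h2
      exact mul_le_mul_of_nonneg_left (by linarith) hC
    refine ⟨K, fun i hi j hj => ?_⟩
    rcases le_total (t i) (t j) with hij | hij
    · exact main i hi j hj hij
    · rw [metricEDist_comm]
      exact main j hj i hi hij
  obtain ⟨x, hx⟩ := (isCompleteMetric_iff g).1 hcomplete _ hcau
  obtain ⟨ε, hε, hev⟩ := eventually_exists_isMIntegralCurveOn hv x
  obtain ⟨n, ⟨η, hη0, hη⟩, hn⟩ := ((hx.eventually hev).and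
    (htend.eventually (lt_mem_nhds (show a - ε < a by linarith)))).exists
  have hη' : IsMIntegralCurveOn (η ∘ (· - t n)) v (Ioo (t n - ε) (t n + ε)) := by
    have := (isMIntegralCurveOn_comp_sub (dt := t n)).2 hη
    refine this.mono fun τ hτ => ?_
    exact ⟨by linarith [hτ.1], by linarith [hτ.2]⟩
  have htn := ht n
  have h1 := isMIntegralCurveOn_piecewise (t₀ := t n) hv.vectorField_one hγ hη'
    ⟨⟨by linarith [htn.1], htn.2⟩, ⟨by linarith, by linarith⟩⟩ (by simp [hη0])
  refine ⟨t n + ε, by linarith, _, ?_, h1.mono ?_⟩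
  · rw [piecewise, if_pos ⟨by linarith, ha⟩]
  · exact Ioo_subset_Ioo_union_Ioo le_rfl (by linarith [htn.2]) le_rfl

theorem IsMIntegralCurveOn.neg {v : ∀ x : M, TangentSpace I x} {γ : ℝ → M} {a b : ℝ}
    (hγ : IsMIntegralCurveOn γ v (Ioo a b)) :
    IsMIntegralCurveOn (γ ∘ Neg.neg) (fun x => -v x) (Ioo (-b) (-a)) := by
  have h1 := hγ.comp_mul (-1)
  have h2 : (fun x => -v x) = (-1 : ℝ) • v := by
    ext x; simp
  have h3 : (γ ∘ Neg.neg) = γ ∘ (· * (-1)) := by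
    ext t; simp
  rw [h2, h3]
  refine h1.mono fun t ht => ?_
  exact ⟨by linarith [ht.2], by linarith [ht.1]⟩

/-- A bounded vector field on a complete Riemannian manifold is complete. -/
theorem exists_isMIntegralCurve_of_isCompleteMetric {v : ∀ x : M, TangentSpace I x}
    (hv : ContMDiff I I.tangent ∞ (fun x => (⟨x, v x⟩ : TangentBundle I M)))
    (g : SmoothMetric I M) (hcomplete : IsCompleteMetric g) {C : ℝ} (hC : 0 ≤ C)
    (hvC : ∀ x, g.inner x (v x) (v x) ≤ C ^ 2) (x : M) :
    ∃ γ : ℝ → M, γ 0 = x ∧ IsMIntegralCurve γ v := by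
  have hv' : ContMDiff I I.tangent ∞ (fun x => (⟨x, -v x⟩ : TangentBundle I M)) := fun x =>
    ContMDiffAt.neg_section (hv x)
  have hvC' : ∀ x, g.inner x (-v x) (-v x) ≤ C ^ 2 := fun x => by
    simpa using hvC x
  let S := {a : ℝ | 0 < a ∧ ∃ γ : ℝ → M, γ 0 = x ∧ IsMIntegralCurveOn γ v (Ioo (-a) a)}
  suffices hbdd : ¬ BddAbove S by
    rw [not_bddAbove_iff] at hbdd
    rw [exists_isMIntegralCurve_iff_exists_isMIntegralCurveOn_Ioo hv.vectorField_one]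
    intro a
    obtain ⟨y, ⟨-, γ, hγ1, hγ2⟩, hlt⟩ := hbdd a
    exact ⟨γ, hγ1, hγ2.mono <| Ioo_subset_Ioo (neg_le_neg hlt.le) hlt.le⟩
  intro hbdd
  have hne : S.Nonempty := by
    obtain ⟨ε, hε, hev⟩ := eventually_exists_isMIntegralCurveOn hv x
    exact ⟨ε, hε, hev.self_of_nhds⟩
  set a := sSup S with ha_def
  have ha : 0 < a := by
    obtain ⟨ε, hε⟩ := hne
    exact hε.1.trans_le (le_csSup hbdd hε)
  have hch : ∀ t : ℝ, ∃ c, |t| < a → |t| < c ∧ c ∈ S := by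
    intro t
    by_cases h : |t| < a
    · obtain ⟨c, hc, hlt⟩ := exists_lt_of_lt_csSup hne h
      exact ⟨c, fun _ => ⟨hlt, hc⟩⟩
    · exact ⟨0, fun h' => absurd h' h⟩
  choose c hc using hch
  have hcur : ∀ a ∈ S, ∃ γ : ℝ → M, γ 0 = x ∧ IsMIntegralCurveOn γ v (Ioo (-a) a) :=
    fun a ha => ha.2
  have : Nonempty M := ⟨x⟩
  choose! Γ hΓ0 hΓ using hcur
  let γ : ℝ → M := fun t => Γ (c t) t
  have hγeq : ∀ b ∈ S, EqOn γ (Γ b) (Ioo (-b) b) := by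
    intro b hb t ht
    have htb : |t| < b := abs_lt.2 ht
    obtain ⟨h1, h2⟩ := hc t (htb.trans_le (le_csSup hbdd hb))
    have hm : (0 : ℝ) < min b (c t) := lt_min hb.1 h2.1
    have := isMIntegralCurveOn_Ioo_eqOn_of_contMDiff_boundaryless (t₀ := 0)
      (a := -min b (c t)) (b := min b (c t)) ⟨by linarith, hm⟩ hv.vectorField_one
      ((hΓ (c t) h2).mono (Ioo_subset_Ioo (neg_le_neg (min_le_right _ _)) (min_le_right _ _)))
      ((hΓ b hb).mono (Ioo_subset_Ioo (neg_le_neg (min_le_left _ _)) (min_le_left _ _)))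
      (by rw [hΓ0 _ h2, hΓ0 _ hb])
    exact this (abs_lt.1 (lt_min htb h1))
  have hγ : IsMIntegralCurveOn γ v (Ioo (-a) a) := by
    intro t ht
    obtain ⟨h1, h2⟩ := hc t (abs_lt.2 ht)
    have h3 : Ioo (-c t) (c t) ∈ 𝓝 t := Ioo_mem_nhds (abs_lt.1 h1).1 (abs_lt.1 h1).2
    have h4 := ((hΓ (c t) h2) t (abs_lt.1 h1)).hasMFDerivAt h3
    have h5 : γ =ᶠ[𝓝 t] Γ (c t) := by
      filter_upwards [h3] with τ hτ using hγeq _ h2 hτ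
    exact (h4.congr_of_eventuallyEq h5).hasMFDerivWithinAt
  have hγ0 : γ 0 = x := by
    obtain ⟨b, hb⟩ := hne
    rw [hγeq b hb ⟨by linarith [hb.1], hb.1⟩, hΓ0 b hb]
  obtain ⟨a₁, ha₁, γ₁, hγ₁0, hγ₁⟩ := hγ.exists_extension_right hv g hcomplete hC hvC ha ha
  obtain ⟨a₂, ha₂, γ₂, hγ₂0, hγ₂⟩ := (hγ₁.neg.mono (Ioo_subset_Ioo le_rfl
    (neg_neg a).ge)).exists_extension_right hv' g hcomplete hC hvC' ha (ha.trans ha₁)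
  have h3 := hγ₂.neg
  simp only [neg_neg] at h3
  have hm : min a₁ a₂ ∈ S := by
    refine ⟨lt_min (ha.trans ha₁) (ha.trans ha₂), γ₂ ∘ Neg.neg, ?_, h3.mono
      (Ioo_subset_Ioo (neg_le_neg (min_le_right _ _)) (min_le_left _ _))⟩
    simp [hγ₂0, hγ₁0, hγ0]
  exact absurd (le_csSup hbdd hm) (not_le.2 (lt_min ha₁ ha₂))

end GlobalFlow

section CoordinateCalculus

variable {E : Type*} [NormedAddCommGroup E] [NormedSpace ℝ E] [FiniteDimensional ℝ E]

theorem ContinuousLinearMap.isInvertible_of_pos {A : E →L[ℝ] E →L[ℝ] ℝ}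
    (h : ∀ v, v ≠ 0 → 0 < A v v) : A.IsInvertible := by
  have hinj : Function.Injective (A : E →ₗ[ℝ] E →L[ℝ] ℝ) := by
    rw [← LinearMap.ker_eq_bot, LinearMap.ker_eq_bot']
    intro v hv
    by_contra hne
    have h1 := h v hne
    have h2 : A v = 0 := hv
    simp [h2] at h1
  have hrank : Module.finrank ℝ E = Module.finrank ℝ (E →L[ℝ] ℝ) := by
    rw [← LinearMap.toContinuousLinearMap (𝕜 := ℝ) (E := E) (F' := ℝ) |>.finrank_eq,
      Module.finrank_linearMap, Module.finrank_self, mul_one]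
  exact ⟨(LinearEquiv.ofInjectiveOfFinrankEq _ hinj hrank).toContinuousLinearEquiv, by
    ext; rfl⟩

/-- `G` is a `C^n` field of symmetric, positive definite bilinear forms near `c`. -/
structure IsMetricAt (n : WithTop ℕ∞) (G : E → E →L[ℝ] E →L[ℝ] ℝ) (c : E) : Prop where
  contDiffAt : ContDiffAt ℝ n G c
  pos : ∀ᶠ y in 𝓝 c, ∀ v, v ≠ 0 → 0 < G y v v
  symm : ∀ᶠ y in 𝓝 c, ∀ v w, G y v w = G y w v

/-- The gradient of `k` with respect to `G`. -/
def coordGradient (G : E → E →L[ℝ] E →L[ℝ] ℝ) (k : E → ℝ) (y : E) : E :=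
  (G y).inverse (fderiv ℝ k y)

namespace IsMetricAt

variable {G : E → E →L[ℝ] E →L[ℝ] ℝ} {c : E} {k : E → ℝ} {n : WithTop ℕ∞}

theorem differentiableAt (h : IsMetricAt n G c) (hn : n ≠ 0) : DifferentiableAt ℝ G c :=
  h.contDiffAt.differentiableAt hn

theorem eventually_nhds (h : IsMetricAt n G c) (hn : n ≠ (∞ : WithTop ℕ∞)) : ∀ᶠ y in 𝓝 c, IsMetricAt n G y := by
  filter_upwards [h.contDiffAt.eventually hn, h.pos.eventually_nhds, h.symm.eventually_nhds]
    with y h1 h2 h3 using ⟨h1, h2, h3⟩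

theorem of_le {m : WithTop ℕ∞} (h : IsMetricAt n G c) (hm : m ≤ n) : IsMetricAt m G c :=
  ⟨h.contDiffAt.of_le hm, h.pos, h.symm⟩

theorem isInvertible (h : IsMetricAt n G c) : (G c).IsInvertible :=
  ContinuousLinearMap.isInvertible_of_pos h.pos.self_of_nhds

theorem eventually_isInvertible (h : IsMetricAt n G c) : ∀ᶠ y in 𝓝 c, (G y).IsInvertible :=
  h.pos.mono fun _ hy => ContinuousLinearMap.isInvertible_of_pos hy

theorem symm_self (h : IsMetricAt n G c) (v w : E) : G c v w = G c w v := h.symm.self_of_nhds v w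

theorem contDiffAt_inverse (h : IsMetricAt n G c) :
    ContDiffAt ℝ n (fun y => (G y).inverse) c :=
  (h.isInvertible.contDiffAt_map_inverse).comp c h.contDiffAt

theorem fderiv_apply₂ (h : IsMetricAt n G c) (hn : n ≠ 0) (u v w : E) :
    fderiv ℝ (fun y => G y v w) c u = fderiv ℝ G c u v w := by
  have h1 : HasFDerivAt (fun y => G y v w) _ c :=
    ((h.differentiableAt hn).hasFDerivAt.clm_apply (hasFDerivAt_const v c)).clm_apply
      (hasFDerivAt_const w c)
  rw [h1.fderiv]
  simp

theorem fderiv_symm (h : IsMetricAt n G c) (hn : n ≠ 0) (u v w : E) :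
    fderiv ℝ G c u v w = fderiv ℝ G c u w v := by
  rw [← h.fderiv_apply₂ hn, ← h.fderiv_apply₂ hn]
  have : (fun y => G y v w) =ᶠ[𝓝 c] fun y => G y w v := h.symm.mono fun y hy => hy v w
  rw [this.fderiv_eq]

theorem apply_christoffel (h : IsMetricAt n G c) (u v w : E) :
    G c (christoffel G c u v) w = christoffelFirst G c u v w := by
  rw [christoffel_apply, h.isInvertible.self_apply_inverse]

theorem christoffel_eq_iff (h : IsMetricAt n G c) (u v z : E) :
    christoffel G c u v = z ↔ ∀ w, christoffelFirst G c u v w = G c z w := by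
  constructor
  · rintro rfl w
    rw [h.apply_christoffel]
  · intro hz
    rw [christoffel_apply, h.isInvertible.inverse_apply_eq]
    ext w
    exact hz w

theorem apply_coordGradient (h : IsMetricAt n G c) (w : E) :
    G c (coordGradient G k c) w = fderiv ℝ k c w := by
  rw [coordGradient, h.isInvertible.self_apply_inverse]

theorem eventually_apply_coordGradient (h : IsMetricAt n G c) :
    (fun y => G y (coordGradient G k y)) =ᶠ[𝓝 c] fderiv ℝ k :=
  h.eventually_isInvertible.mono fun y hy => by
    simp only [coordGradient]
    rw [hy.self_apply_inverse]

theorem contDiffAt_coordGradient (h : IsMetricAt ∞ G c) (hk : ContDiffAt ℝ ∞ k c) :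
    ContDiffAt ℝ ∞ (coordGradient G k) c :=
  h.contDiffAt_inverse.clm_apply (hk.fderiv_right (by simp))

theorem coordHessian_eq (h : IsMetricAt ∞ G c) (u v : E) : coordHessian G k c u v =
    fderiv ℝ (fderiv ℝ k) c u v - christoffelFirst G c u v (coordGradient G k c) := by
  rw [coordHessian, ← h.apply_coordGradient (k := k), h.symm_self, h.apply_christoffel]

theorem fderiv_fderiv_eq (h : IsMetricAt ∞ G c) (hk : ContDiffAt ℝ ∞ k c) (u v : E) :
    fderiv ℝ (fderiv ℝ k) c u v = fderiv ℝ G c u (coordGradient G k c) v +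
      G c (fderiv ℝ (coordGradient G k) c u) v := by
  have hX : DifferentiableAt ℝ (coordGradient G k) c :=
    (h.contDiffAt_coordGradient hk).differentiableAt (by simp)
  rw [← (h.eventually_apply_coordGradient (k := k)).fderiv_eq,
    ((h.differentiableAt (by simp)).hasFDerivAt.clm_apply hX.hasFDerivAt).fderiv]
  simp [add_comm]

/-- The derivative of `|∇k|²` is `2 ∇²k (·, ∇k)`. -/
theorem fderiv_gradient_sq (h : IsMetricAt ∞ G c) (hk : ContDiffAt ℝ ∞ k c) (u : E) :
    fderiv ℝ (fun y => fderiv ℝ k y (coordGradient G k y)) c u =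
      2 * coordHessian G k c u (coordGradient G k c) := by
  have hX : DifferentiableAt ℝ (coordGradient G k) c :=
    (h.contDiffAt_coordGradient hk).differentiableAt (by simp)
  have hk1 : ContDiffAt ℝ ∞ (fderiv ℝ k) c := hk.fderiv_right (by simp)
  have hd : DifferentiableAt ℝ (fderiv ℝ k) c := hk1.differentiableAt (by simp)
  rw [(hd.hasFDerivAt.clm_apply hX.hasFDerivAt).fderiv, h.coordHessian_eq,
    christoffelFirst_apply]
  have h1 : fderiv ℝ k c (fderiv ℝ (coordGradient G k) c u) =
      G c (fderiv ℝ (coordGradient G k) c u) (coordGradient G k c) := by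
    rw [← h.apply_coordGradient (k := k), h.symm_self]
  have h2 := h.fderiv_fderiv_eq hk u (coordGradient G k c)
  simp only [add_apply, ContinuousLinearMap.comp_apply,
    ContinuousLinearMap.flip_apply, h1]
  rw [h2]
  ring

theorem coordHessian_self_eq (h : IsMetricAt ∞ G c) (hk : ContDiffAt ℝ ∞ k c) (u : E) :
    coordHessian G k c u u = G c (fderiv ℝ (coordGradient G k) c u) u +
      1 / 2 * fderiv ℝ G c (coordGradient G k c) u u := by
  rw [h.coordHessian_eq, christoffelFirst_apply, h.fderiv_fderiv_eq hk,
    h.fderiv_symm (by simp) u (coordGradient G k c) u]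
  ring

end IsMetricAt

end CoordinateCalculus

section Centre

variable {E : Type*} [NormedAddCommGroup E] [NormedSpace ℝ E] [FiniteDimensional ℝ E]
  {H : Type*} [TopologicalSpace H] {I : ModelWithCorners ℝ E H} [I.Boundaryless]
  {M : Type*} [TopologicalSpace M] [ChartedSpace H M] [IsManifold I ∞ M]

/-- The differential of a real function, as a linear form on the model space. -/
def differential (I : ModelWithCorners ℝ E H) (h : M → ℝ) (p : M) : E →L[ℝ] ℝ :=
  mfderiv I 𝓘(ℝ, ℝ) h p

/-- The value of a metric at a point, as a bilinear form on the model space. -/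
def SmoothMetric.form (g : SmoothMetric I M) (p : M) : E →L[ℝ] E →L[ℝ] ℝ := g.inner p

/-- The gradient, as a vector of the model space. -/
def gradientVec (g : SmoothMetric I M) (h : M → ℝ) (p : M) : E := metricGradient g h p

/-- The derivative of the inverse of the preferred chart at `p`. -/
def chartSymmDeriv (I : ModelWithCorners ℝ E H) (p : M) (y : E) : E →L[ℝ] E :=
  mfderiv 𝓘(ℝ, E) I (extChartAt I p).symm y

/-- The derivative of the preferred chart at `p`. -/
def chartDeriv (I : ModelWithCorners ℝ E H) (p x : M) : E →L[ℝ] E :=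
  mfderiv I 𝓘(ℝ, E) (extChartAt I p) x

theorem SmoothMetric.form_pos (g : SmoothMetric I M) (p : M) {v : E} (hv : v ≠ 0) :
    0 < g.form p v v := g.pos p v hv

theorem SmoothMetric.form_nonneg (g : SmoothMetric I M) (p : M) (v : E) :
    0 ≤ g.form p v v := g.inner_self_nonneg p v

theorem SmoothMetric.form_symm (g : SmoothMetric I M) (p : M) (v w : E) :
    g.form p v w = g.form p w v := g.symm p v w

theorem SmoothMetric.isInvertible (g : SmoothMetric I M) (x : M) : (g.form x).IsInvertible :=
  ContinuousLinearMap.isInvertible_of_pos fun _ hv => g.form_pos x hv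

theorem form_gradientVec (g : SmoothMetric I M) (h : M → ℝ) (x : M) (v : E) :
    g.form x (gradientVec g h x) v = differential I h x v :=
  congrArg (fun A : E →L[ℝ] ℝ => A v)
    ((g.isInvertible x).self_apply_inverse (differential I h x))

theorem eq_gradientVec_iff (g : SmoothMetric I M) (h : M → ℝ) (x : M) (X : E) :
    X = gradientVec g h x ↔ ∀ v, g.form x X v = differential I h x v := by
  constructor
  · rintro rfl v
    exact form_gradientVec g h x v
  · intro hX
    refine (g.isInvertible x).injective ?_
    ext v
    rw [hX, form_gradientVec]

theorem chartSymmDeriv_comp_chartDeriv {p : M} {y : E} (hy : y ∈ (extChartAt I p).target) (v : E) :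
    chartSymmDeriv I p y (chartDeriv I p ((extChartAt I p).symm y) v) = v :=
  congrArg (fun A : E →L[ℝ] E => A v) (mfderiv_extChartAt_symm_comp (I := I) hy)

theorem chartDeriv_comp_chartSymmDeriv {p : M} {y : E} (hy : y ∈ (extChartAt I p).target) (v : E) :
    chartDeriv I p ((extChartAt I p).symm y) (chartSymmDeriv I p y v) = v :=
  congrArg (fun A : E →L[ℝ] E => A v) (mfderiv_extChartAt_comp_symm (I := I) hy)

theorem chartSymmDeriv_self (p : M) (v : E) : chartSymmDeriv I p (extChartAt I p p) v = v :=
  congrArg (fun A : E →L[ℝ] E => A v) (mfderiv_extChartAt_symm_self (I := I) p)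

theorem chartDeriv_self (p : M) (v : E) : chartDeriv I p p v = v :=
  congrArg (fun A : E →L[ℝ] E => A v) (mfderiv_extChartAt_self (I := I) (x := p))

theorem chartMetric_apply (g : SmoothMetric I M) (p : M) (y v w : E) :
    chartMetric g p y v w = g.form ((extChartAt I p).symm y)
      (chartSymmDeriv I p y v) (chartSymmDeriv I p y w) := rfl

theorem chartMetric_self (g : SmoothMetric I M) (p : M) :
    chartMetric g p (extChartAt I p p) = g.form p := by
  ext v w
  rw [chartMetric_apply, chartSymmDeriv_self, chartSymmDeriv_self, extChartAt_to_inv]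

theorem chartMetric_pos (g : SmoothMetric I M) {p : M} {y : E} (hy : y ∈ (extChartAt I p).target)
    {v : E} (hv : v ≠ 0) : 0 < chartMetric g p y v v := by
  rw [chartMetric_apply]
  refine g.form_pos _ fun h0 => hv ?_
  rw [← chartDeriv_comp_chartSymmDeriv hy v, h0, map_zero]

theorem chartMetric_symm (g : SmoothMetric I M) (p : M) (y v w : E) :
    chartMetric g p y v w = chartMetric g p y w v := by
  rw [chartMetric_apply, g.form_symm, ← chartMetric_apply]

theorem contDiffAt_chartMetric (g : SmoothMetric I M) (p : M) :
    ContDiffAt ℝ ∞ (chartMetric g p) (extChartAt I p p) := by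
  have h1 := (contMDiffAt_form_iff g.inner p).1 (g.contMDiff p)
  have h2 : ContMDiffAt 𝓘(ℝ, E) I ∞ (extChartAt I p).symm (extChartAt I p p) :=
    contMDiffAt_extChartAt_symm (mem_extChartAt_target p)
  have h3 := ContMDiffAt.comp_of_eq h1 h2 (extChartAt_to_inv p)
  refine contMDiffAt_iff_contDiffAt.1 (h3.congr_of_eventuallyEq ?_)
  filter_upwards [extChartAt_target_mem_nhds_of_mem (mem_extChartAt_target (I := I) p)] with y hy
  have hs := (extChartAt I p).map_target hy
  have h4 := TangentBundle.symmL_trivializationAt (I := I)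
    (x₀ := p) (x := (extChartAt I p).symm y) (by rwa [extChartAt_source] at hs)
  rw [(extChartAt I p).right_inv hy, I.range_eq_univ, mfderivWithin_univ] at h4
  ext v w
  have hv := congrArg (fun A => A v) h4
  have hw := congrArg (fun A => A w) h4
  change _ = g.inner ((extChartAt I p).symm y)
    ((trivializationAt E (TangentSpace I) p).symmL ℝ ((extChartAt I p).symm y) v)
    ((trivializationAt E (TangentSpace I) p).symmL ℝ ((extChartAt I p).symm y) w)
  exact congrArg₂ (fun a b => g.inner ((extChartAt I p).symm y) a b) hv.symm hw.symm

theorem isMetricAt_chartMetric (g : SmoothMetric I M) (p : M) :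
    IsMetricAt ∞ (chartMetric g p) (extChartAt I p p) where
  contDiffAt := contDiffAt_chartMetric g p
  pos := by
    filter_upwards [extChartAt_target_mem_nhds_of_mem (mem_extChartAt_target (I := I) p)]
      with y hy v hv using chartMetric_pos g hy hv
  symm := Eventually.of_forall fun y v w => chartMetric_symm g p y v w

theorem contDiffAt_comp_extChartAt_symm {h : M → ℝ} (hh : ContMDiff I 𝓘(ℝ, ℝ) ∞ h) {p : M} {y : E}
    (hy : y ∈ (extChartAt I p).target) : ContDiffAt ℝ ∞ (h ∘ (extChartAt I p).symm) y :=
  contMDiffAt_iff_contDiffAt.1 ((hh _).comp y (contMDiffAt_extChartAt_symm hy))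

theorem fderiv_comp_extChartAt_symm {h : M → ℝ} (hh : ContMDiff I 𝓘(ℝ, ℝ) ∞ h) {p : M} {y : E}
    (hy : y ∈ (extChartAt I p).target) (v : E) : fderiv ℝ (h ∘ (extChartAt I p).symm) y v =
      differential I h ((extChartAt I p).symm y) (chartSymmDeriv I p y v) := by
  rw [← mfderiv_eq_fderiv, mfderiv_comp (I' := I) y (hh.mdifferentiable (by simp) _)
    (mdifferentiableAt_extChartAt_symm hy)]
  rfl

theorem differential_eq_fderiv {h : M → ℝ} (hh : ContMDiff I 𝓘(ℝ, ℝ) ∞ h) (p : M) :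
    differential I h p = fderiv ℝ (h ∘ (extChartAt I p).symm) (extChartAt I p p) := by
  ext v
  rw [fderiv_comp_extChartAt_symm hh (mem_extChartAt_target p), chartSymmDeriv_self,
    extChartAt_to_inv]

/-- The Hessian, as a bilinear form on the model space. -/
def hessianForm (g : SmoothMetric I M) (h : M → ℝ) (p : M) (a b : E) : ℝ := hessian g h p a b

theorem hessianForm_eq (g : SmoothMetric I M) (h : M → ℝ) (p : M) (a b : E) :
    hessianForm g h p a b = coordHessian (chartMetric g p) (h ∘ (extChartAt I p).symm)
      (extChartAt I p p) a b :=
  congrArg₂ (coordHessian (chartMetric g p) (h ∘ (extChartAt I p).symm) (extChartAt I p p))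
    (chartDeriv_self p a) (chartDeriv_self p b)

theorem chartSymmDeriv_coordGradient (g : SmoothMetric I M) {h : M → ℝ}
    (hh : ContMDiff I 𝓘(ℝ, ℝ) ∞ h) {p : M} {y : E} (hy : y ∈ (extChartAt I p).target) :
    chartSymmDeriv I p y (coordGradient (chartMetric g p) (h ∘ (extChartAt I p).symm) y) =
      gradientVec g h ((extChartAt I p).symm y) := by
  rw [eq_gradientVec_iff]
  intro v
  rw [← chartSymmDeriv_comp_chartDeriv hy v, ← fderiv_comp_extChartAt_symm hh hy,
    ← chartMetric_apply, coordGradient, (ContinuousLinearMap.isInvertible_of_pos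
      (fun v hv => chartMetric_pos g hy hv)).self_apply_inverse]

theorem coordGradient_self (g : SmoothMetric I M) {h : M → ℝ} (hh : ContMDiff I 𝓘(ℝ, ℝ) ∞ h)
    (p : M) : coordGradient (chartMetric g p) (h ∘ (extChartAt I p).symm) (extChartAt I p p) =
      gradientVec g h p := by
  rw [eq_gradientVec_iff]
  intro v
  rw [differential_eq_fderiv hh, ← chartMetric_self]
  exact (isMetricAt_chartMetric g p).apply_coordGradient v

/-- `|∇h|²`. -/
def gradientSq (g : SmoothMetric I M) (h : M → ℝ) (p : M) : ℝ :=
  g.form p (gradientVec g h p) (gradientVec g h p)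

theorem gradientSq_eq (g : SmoothMetric I M) (h : M → ℝ) (p : M) :
    gradientSq g h p = differential I h p (gradientVec g h p) :=
  form_gradientVec g h p _

theorem gradientNorm_eq (g : SmoothMetric I M) (h : M → ℝ) (p : M) :
    gradientNorm g h p = Real.sqrt (gradientSq g h p) := rfl

theorem gradientSq_nonneg (g : SmoothMetric I M) (h : M → ℝ) (p : M) : 0 ≤ gradientSq g h p :=
  g.form_nonneg p _

theorem gradientSq_eq_zero_iff (g : SmoothMetric I M) (h : M → ℝ) (p : M) :
    gradientSq g h p = 0 ↔ differential I h p = 0 := by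
  constructor
  · intro h0
    have h1 : gradientVec g h p = 0 := by
      by_contra hne
      exact (g.form_pos p hne).ne' h0
    ext v
    rw [← form_gradientVec g h p, h1]
    simp
  · intro h0
    rw [gradientSq_eq, h0]
    rfl

theorem gradientSq_comp_extChartAt_symm (g : SmoothMetric I M) {h : M → ℝ}
    (hh : ContMDiff I 𝓘(ℝ, ℝ) ∞ h) {p : M} {y : E} (hy : y ∈ (extChartAt I p).target) :
    gradientSq g h ((extChartAt I p).symm y) = fderiv ℝ (h ∘ (extChartAt I p).symm) y
      (coordGradient (chartMetric g p) (h ∘ (extChartAt I p).symm) y) := by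
  rw [gradientSq_eq, fderiv_comp_extChartAt_symm hh hy, chartSymmDeriv_coordGradient g hh hy]

theorem eventuallyEq_gradientSq_chart (g : SmoothMetric I M) {h : M → ℝ}
    (hh : ContMDiff I 𝓘(ℝ, ℝ) ∞ h) (p : M) :
    gradientSq g h ∘ (extChartAt I p).symm =ᶠ[𝓝 (extChartAt I p p)]
    fun y => fderiv ℝ (h ∘ (extChartAt I p).symm) y
      (coordGradient (chartMetric g p) (h ∘ (extChartAt I p).symm) y) := by
  filter_upwards [extChartAt_target_mem_nhds_of_mem (mem_extChartAt_target (I := I) p)]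
    with y hy using gradientSq_comp_extChartAt_symm g hh hy

theorem contMDiff_gradientSq (g : SmoothMetric I M) {h : M → ℝ} (hh : ContMDiff I 𝓘(ℝ, ℝ) ∞ h) :
    ContMDiff I 𝓘(ℝ, ℝ) ∞ (gradientSq g h) := by
  intro p
  have hk := contDiffAt_comp_extChartAt_symm hh (mem_extChartAt_target (I := I) p)
  have hm := isMetricAt_chartMetric g p
  have hk1 : ContDiffAt ℝ ∞ (fderiv ℝ (h ∘ (extChartAt I p).symm)) (extChartAt I p p) :=
    hk.fderiv_right (by simp)
  have h1 := (hk1.clm_apply (hm.contDiffAt_coordGradient hk)).congr_of_eventuallyEq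
    (eventuallyEq_gradientSq_chart g hh p)
  have h2 := h1.contMDiffAt.comp p (contMDiffAt_extChartAt (I := I) (n := ∞))
  refine h2.congr_of_eventuallyEq ?_
  filter_upwards [extChartAt_source_mem_nhds (I := I) p] with x hx
  simp only [Function.comp, (extChartAt I p).left_inv hx]

theorem differential_gradientSq (g : SmoothMetric I M) {h : M → ℝ}
    (hh : ContMDiff I 𝓘(ℝ, ℝ) ∞ h) (p : M) (v : E) :
    differential I (gradientSq g h) p v = 2 * hessianForm g h p v (gradientVec g h p) := by
  rw [differential_eq_fderiv (contMDiff_gradientSq g hh) p,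
    (eventuallyEq_gradientSq_chart g hh p).fderiv_eq,
    (isMetricAt_chartMetric g p).fderiv_gradient_sq
      (contDiffAt_comp_extChartAt_symm hh (mem_extChartAt_target p)),
    coordGradient_self g hh, ← hessianForm_eq]

theorem differential_gradientSq_of_hessian_eq (g : SmoothMetric I M) {h : M → ℝ}
    (hh : ContMDiff I 𝓘(ℝ, ℝ) ∞ h) (p : M) {c : ℝ}
    (hc : ∀ a b : E, hessianForm g h p a b = c * g.form p a b) (v : E) :
    differential I (gradientSq g h) p v = 2 * c * differential I h p v := by
  rw [differential_gradientSq g hh, hc, g.form_symm, form_gradientVec, mul_assoc]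

/-- The gradient is a smooth vector field. -/
theorem contMDiff_metricGradient (g : SmoothMetric I M) {h : M → ℝ}
    (hh : ContMDiff I 𝓘(ℝ, ℝ) ∞ h) :
    ContMDiff I I.tangent ∞ (fun x => (⟨x, metricGradient g h x⟩ : TangentBundle I M)) := by
  intro p
  refine ((trivializationAt E (TangentSpace I) p).contMDiffAt_section_iff
    (s := metricGradient g h) (IB := I) (n := ∞) (mem_baseSet_trivializationAt _ _ _)).2 ?_
  have hk := contDiffAt_comp_extChartAt_symm hh (mem_extChartAt_target (I := I) p)
  have h1 := ((isMetricAt_chartMetric g p).contDiffAt_coordGradient hk).contMDiffAt.comp p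
    (contMDiffAt_extChartAt (I := I) (n := ∞))
  refine h1.congr_of_eventuallyEq ?_
  filter_upwards [extChartAt_source_mem_nhds (I := I) p] with x hx
  have hx' : x ∈ (chartAt H p).source := by rwa [extChartAt_source] at hx
  have hy := (extChartAt I p).map_source hx
  have h5 : chartDeriv I p x (gradientVec g h x) = coordGradient (chartMetric g p)
      (h ∘ (extChartAt I p).symm) (extChartAt I p x) := by
    have h2 := chartDeriv_comp_chartSymmDeriv hy (coordGradient (chartMetric g p)
      (h ∘ (extChartAt I p).symm) (extChartAt I p x))
    rwa [chartSymmDeriv_coordGradient g hh hy, (extChartAt I p).left_inv hx] at h2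
  refine Eq.trans ?_ h5
  have h6 := congrArg (fun A => A (metricGradient g h x))
    (TangentBundle.continuousLinearMapAt_trivializationAt (I := I) hx')
  refine Eq.trans ?_ h6
  rw [Bundle.Trivialization.continuousLinearMapAt_apply,
    Bundle.Trivialization.coe_linearMapAt_of_mem _ (by simpa using hx')]

/-- A function with vanishing differential on a connected manifold is constant. -/
theorem eq_of_differential_eq_zero [PreconnectedSpace M] {h : M → ℝ} (hh : ContMDiff I 𝓘(ℝ, ℝ) ∞ h)
    (h0 : ∀ p, differential I h p = 0) (x y : M) : h x = h y := by
  have hloc : IsLocallyConstant h := by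
    rw [IsLocallyConstant.iff_eventually_eq]
    intro p
    obtain ⟨δ, hδ, hball⟩ := Metric.isOpen_iff.1 (isOpen_extChartAt_target (I := I) p) _
      (mem_extChartAt_target p)
    have h1 : ∀ y ∈ Metric.ball (extChartAt I p p) δ,
        fderiv ℝ (h ∘ (extChartAt I p).symm) y = 0 := by
      intro y hy
      ext v
      rw [fderiv_comp_extChartAt_symm hh (hball hy), h0]
      rfl
    have h2 : ∀ᶠ x in 𝓝 p, extChartAt I p x ∈ Metric.ball (extChartAt I p p) δ :=
      (continuousAt_extChartAt p).preimage_mem_nhds (Metric.ball_mem_nhds _ hδ)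
    filter_upwards [h2, extChartAt_source_mem_nhds (I := I) p] with x hx hxs
    have h3 := Metric.isOpen_ball.is_const_of_fderiv_eq_zero
      (convex_ball _ _).isPreconnected
      (fun y hy => ((contDiffAt_comp_extChartAt_symm hh (hball hy)).differentiableAt
        (by simp)).differentiableWithinAt) h1 hx (Metric.mem_ball_self hδ)
    simp only [Function.comp, (extChartAt I p).left_inv hxs, extChartAt_to_inv] at h3
    exact h3
  exact hloc.apply_eq_of_preconnectedSpace x y

end Centre

section WarpedCoordinates

variable {E : Type*} [NormedAddCommGroup E] [NormedSpace ℝ E] [FiniteDimensional ℝ E]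
  {E' : Type*} [NormedAddCommGroup E'] [NormedSpace ℝ E'] [FiniteDimensional ℝ E']

theorem LinearMap.trace_prod_eq (T : E × E' →ₗ[ℝ] E × E') :
    LinearMap.trace ℝ (E × E') T =
      LinearMap.trace ℝ E (LinearMap.fst ℝ E E' ∘ₗ T ∘ₗ LinearMap.inl ℝ E E') +
      LinearMap.trace ℝ E' (LinearMap.snd ℝ E E' ∘ₗ T ∘ₗ LinearMap.inr ℝ E E') := by
  have h : T = (T ∘ₗ LinearMap.inl ℝ E E') ∘ₗ LinearMap.fst ℝ E E' +
      (T ∘ₗ LinearMap.inr ℝ E E') ∘ₗ LinearMap.snd ℝ E E' := by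
    ext x <;> simp [show ((0 : E), (0 : E')) = 0 from rfl]
  conv_lhs => rw [h]
  rw [map_add, LinearMap.trace_comp_comm', LinearMap.trace_comp_comm' _ (LinearMap.snd ℝ E E')]

/-- Near `q`, the field `G` is the warped product of `GB` and `GF` with warping function `φ`. -/
structure IsWarpedAt (n : WithTop ℕ∞) (G : E × E' → E × E' →L[ℝ] E × E' →L[ℝ] ℝ)
    (GB : E → E →L[ℝ] E →L[ℝ] ℝ) (GF : E' → E' →L[ℝ] E' →L[ℝ] ℝ) (φ : E → ℝ) (q : E × E') :
    Prop where
  metric : IsMetricAt n G q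
  base : IsMetricAt n GB q.1
  fibre : IsMetricAt n GF q.2
  warp : ContDiffAt ℝ n φ q.1
  pos : ∀ᶠ x in 𝓝 q.1, 0 < φ x
  apply_eq : ∀ᶠ r in 𝓝 q, ∀ V W : E × E',
    G r V W = GB r.1 V.1 W.1 + φ r.1 ^ 2 * GF r.2 V.2 W.2

namespace IsMetricAt

variable {G : E → E →L[ℝ] E →L[ℝ] ℝ} {c : E}

theorem contDiffAt_christoffel (h : IsMetricAt ∞ G c) : ContDiffAt ℝ ∞ (christoffel G) c := by
  have hD : ContDiffAt ℝ ∞ (fderiv ℝ G) c := h.contDiffAt.fderiv_right (by simp)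
  have hf : ContDiffAt ℝ ∞ (fun x => (fderiv ℝ G x).flip) c :=
    (ContinuousLinearMap.flipₗᵢ ℝ E E (E →L[ℝ] ℝ)).contDiff.contDiffAt.comp c hD
  have h1 : ContDiffAt ℝ ∞ (christoffelFirst G) c :=
    (contDiffAt_const (c := (1 / 2 : ℝ))).smul ((hD.add hf).sub ((contDiffAt_const
      (c := ((ContinuousLinearMap.flipₗᵢ ℝ E E ℝ).toContinuousLinearEquiv).toContinuousLinearMap)
      ).clm_comp hf))
  have h2 : ContDiffAt ℝ ∞
      (fun x => ContinuousLinearMap.compL ℝ E (E →L[ℝ] ℝ) E (G x).inverse) c :=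
    (ContinuousLinearMap.contDiff _).contDiffAt.comp c h.contDiffAt_inverse
  exact h2.clm_comp h1

theorem fderiv_christoffel_apply (h : IsMetricAt ∞ G c) (u v w : E) :
    fderiv ℝ (christoffel G) c u v w = fderiv ℝ (fun x => christoffel G x v w) c u := by
  have h1 : HasFDerivAt (fun x => christoffel G x v w) _ c :=
    (((h.contDiffAt_christoffel.differentiableAt (by simp)).hasFDerivAt.clm_apply
      (hasFDerivAt_const v c)).clm_apply (hasFDerivAt_const w c))
  rw [h1.fderiv]
  simp

end IsMetricAt

namespace IsWarpedAt

variable {G : E × E' → E × E' →L[ℝ] E × E' →L[ℝ] ℝ} {GB : E → E →L[ℝ] E →L[ℝ] ℝ}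
  {GF : E' → E' →L[ℝ] E' →L[ℝ] ℝ} {φ : E → ℝ} {q : E × E'} {n : WithTop ℕ∞}

theorem of_le {m : WithTop ℕ∞} (h : IsWarpedAt n G GB GF φ q) (hm : m ≤ n) :
    IsWarpedAt m G GB GF φ q :=
  ⟨h.metric.of_le hm, h.base.of_le hm, h.fibre.of_le hm, h.warp.of_le hm, h.pos, h.apply_eq⟩

theorem eventually_nhds (h : IsWarpedAt n G GB GF φ q) (hn : n ≠ (∞ : WithTop ℕ∞)) :
    ∀ᶠ r in 𝓝 q, IsWarpedAt n G GB GF φ r := by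
  filter_upwards [h.metric.eventually_nhds hn,
    continuousAt_fst.eventually (h.base.eventually_nhds hn),
    continuousAt_snd.eventually (h.fibre.eventually_nhds hn),
    continuousAt_fst.eventually (h.warp.eventually hn),
    continuousAt_fst.eventually h.pos.eventually_nhds, h.apply_eq.eventually_nhds]
    with r h1 h2 h3 h4 h5 h6 using ⟨h1, h2, h3, h4, h5, h6⟩

theorem fderiv_apply (h : IsWarpedAt n G GB GF φ q) (hn : n ≠ 0) (U V W : E × E') :
    fderiv ℝ G q U V W = fderiv ℝ GB q.1 U.1 V.1 W.1 +
      2 * φ q.1 * fderiv ℝ φ q.1 U.1 * GF q.2 V.2 W.2 +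
      φ q.1 ^ 2 * fderiv ℝ GF q.2 U.2 V.2 W.2 := by
  rw [← h.metric.fderiv_apply₂ hn]
  have h0 : (fun r => G r V W) =ᶠ[𝓝 q]
      fun r => GB r.1 V.1 W.1 + φ r.1 ^ 2 * GF r.2 V.2 W.2 :=
    h.apply_eq.mono fun r hr => hr V W
  have hB : HasFDerivAt (fun x => GB x V.1 W.1) _ q.1 :=
    (((h.base.differentiableAt hn).hasFDerivAt.clm_apply (hasFDerivAt_const V.1 _)).clm_apply
      (hasFDerivAt_const W.1 _))
  have hF : HasFDerivAt (fun x => GF x V.2 W.2) _ q.2 :=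
    (((h.fibre.differentiableAt hn).hasFDerivAt.clm_apply (hasFDerivAt_const V.2 _)).clm_apply
      (hasFDerivAt_const W.2 _))
  have hφ := (h.warp.differentiableAt hn).hasFDerivAt
  have h1 := (hB.comp q hasFDerivAt_fst).add
    (((hφ.comp q hasFDerivAt_fst).pow 2).mul (hF.comp q hasFDerivAt_snd))
  have h2 := h1.congr_of_eventuallyEq h0
  rw [h2.fderiv]
  simp
  ring

theorem self_apply (h : IsWarpedAt n G GB GF φ q) (V W : E × E') :
    G q V W = GB q.1 V.1 W.1 + φ q.1 ^ 2 * GF q.2 V.2 W.2 :=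
  h.apply_eq.self_of_nhds V W

theorem christoffel_eq (h : IsWarpedAt n G GB GF φ q) (hn : n ≠ 0) (V W : E × E') :
    christoffel G q V W =
      (christoffel GB q.1 V.1 W.1 - GF q.2 V.2 W.2 • φ q.1 • coordGradient GB φ q.1,
        christoffel GF q.2 V.2 W.2 + ((φ q.1)⁻¹ * fderiv ℝ φ q.1 V.1) • W.2 +
          ((φ q.1)⁻¹ * fderiv ℝ φ q.1 W.1) • V.2) := by
  rw [h.metric.christoffel_eq_iff]
  intro Z
  have hφ : φ q.1 ≠ 0 := h.pos.self_of_nhds.ne'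
  rw [h.self_apply, christoffelFirst_apply]
  simp only [h.fderiv_apply hn, map_sub, map_add, map_smul, sub_apply, add_apply, smul_apply,
    smul_eq_mul, h.base.apply_christoffel, h.fibre.apply_christoffel, h.base.apply_coordGradient,
    christoffelFirst_apply]
  rw [h.fibre.symm_self W.2 Z.2]
  rw [h.fibre.symm_self V.2 Z.2, h.fibre.symm_self Z.2 W.2, h.fibre.symm_self Z.2 V.2]
  field_simp
  ring

/-- The field `φ ∇φ`. -/
def warpField (GB : E → E →L[ℝ] E →L[ℝ] ℝ) (φ : E → ℝ) (x : E) : E := φ x • coordGradient GB φ x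

/-- The logarithmic derivative of `φ`. -/
def logDeriv (φ : E → ℝ) (x : E) : E →L[ℝ] ℝ := (φ x)⁻¹ • fderiv ℝ φ x

theorem differentiableAt_warpField (h : IsWarpedAt ∞ G GB GF φ q) :
    DifferentiableAt ℝ (warpField GB φ) q.1 :=
  (h.warp.smul (h.base.contDiffAt_coordGradient h.warp)).differentiableAt (by simp)

theorem differentiableAt_logDeriv (h : IsWarpedAt ∞ G GB GF φ q) :
    DifferentiableAt ℝ (logDeriv φ) q.1 := by
  have h1 : ContDiffAt ℝ ∞ (fderiv ℝ φ) q.1 := h.warp.fderiv_right (by simp)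
  exact ((h.warp.inv h.pos.self_of_nhds.ne').smul h1).differentiableAt (by simp)

theorem christoffel_eq' (h : IsWarpedAt n G GB GF φ q) (hn : n ≠ 0) (V W : E × E') :
    christoffel G q V W =
      (christoffel GB q.1 V.1 W.1 - GF q.2 V.2 W.2 • warpField GB φ q.1,
        christoffel GF q.2 V.2 W.2 + logDeriv φ q.1 V.1 • W.2 + logDeriv φ q.1 W.1 • V.2) :=
  h.christoffel_eq hn V W

theorem fderiv_christoffel_eq (h : IsWarpedAt ∞ G GB GF φ q) (U V W : E × E') :
    fderiv ℝ (christoffel G) q U V W =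
      (fderiv ℝ (christoffel GB) q.1 U.1 V.1 W.1 -
        (GF q.2 V.2 W.2 • fderiv ℝ (warpField GB φ) q.1 U.1 +
          fderiv ℝ GF q.2 U.2 V.2 W.2 • warpField GB φ q.1),
      fderiv ℝ (christoffel GF) q.2 U.2 V.2 W.2 +
        fderiv ℝ (logDeriv φ) q.1 U.1 V.1 • W.2 + fderiv ℝ (logDeriv φ) q.1 U.1 W.1 • V.2) := by
  rw [h.metric.fderiv_christoffel_apply]
  have h0 : (fun r => christoffel G r V W) =ᶠ[𝓝 q] fun r =>
      (christoffel GB r.1 V.1 W.1 - GF r.2 V.2 W.2 • warpField GB φ r.1,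
        christoffel GF r.2 V.2 W.2 + logDeriv φ r.1 V.1 • W.2 + logDeriv φ r.1 W.1 • V.2) :=
    ((h.of_le (m := 2) ENat.LEInfty.out).eventually_nhds (by decide)).mono
      fun r hr => hr.christoffel_eq' (by simp) V W
  have hB : HasFDerivAt (fun x => christoffel GB x V.1 W.1) _ q.1 :=
    (((h.base.contDiffAt_christoffel.differentiableAt (by simp)).hasFDerivAt.clm_apply
      (hasFDerivAt_const V.1 _)).clm_apply (hasFDerivAt_const W.1 _))
  have hF : HasFDerivAt (fun x => christoffel GF x V.2 W.2) _ q.2 :=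
    (((h.fibre.contDiffAt_christoffel.differentiableAt (by simp)).hasFDerivAt.clm_apply
      (hasFDerivAt_const V.2 _)).clm_apply (hasFDerivAt_const W.2 _))
  have hG : HasFDerivAt (fun x => GF x V.2 W.2) _ q.2 :=
    (((h.fibre.differentiableAt (by simp)).hasFDerivAt.clm_apply
      (hasFDerivAt_const V.2 _)).clm_apply (hasFDerivAt_const W.2 _))
  have hN := h.differentiableAt_warpField.hasFDerivAt
  have hβV : HasFDerivAt (fun x => logDeriv φ x V.1) _ q.1 :=
    h.differentiableAt_logDeriv.hasFDerivAt.clm_apply (hasFDerivAt_const V.1 _)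
  have hβW : HasFDerivAt (fun x => logDeriv φ x W.1) _ q.1 :=
    h.differentiableAt_logDeriv.hasFDerivAt.clm_apply (hasFDerivAt_const W.1 _)
  have h1 := ((hB.comp q hasFDerivAt_fst).sub
    ((hG.comp q hasFDerivAt_snd).smul (hN.comp q hasFDerivAt_fst))).prodMk
    (((hF.comp q hasFDerivAt_snd).add ((hβV.comp q hasFDerivAt_fst).smul_const W.2)).add
      ((hβW.comp q hasFDerivAt_fst).smul_const V.2))
  rw [(h1.congr_of_eventuallyEq h0).fderiv]
  simp

theorem coordRicci_base (h : IsWarpedAt ∞ G GB GF φ q) (v w : E) :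
    coordRicci G q (v, 0) (w, 0) = coordRicci GB q.1 v w + Module.finrank ℝ E' *
      (logDeriv φ q.1 (christoffel GB q.1 v w) - fderiv ℝ (logDeriv φ) q.1 v w -
        logDeriv φ q.1 v * logDeriv φ q.1 w) := by
  change LinearMap.trace ℝ (E × E') (coordRiemannEnd G q (v, 0) (w, 0)) =
    LinearMap.trace ℝ E (coordRiemannEnd GB q.1 v w) + _
  rw [LinearMap.trace_prod_eq]
  congr 1
  · congr 1
    ext u
    simp [coordRiemannEnd, coordRiemann, h.fderiv_christoffel_eq, h.christoffel_eq']
  · have h1 : LinearMap.snd ℝ E E' ∘ₗ coordRiemannEnd G q (v, 0) (w, 0) ∘ₗ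
        LinearMap.inr ℝ E E' = (logDeriv φ q.1 (christoffel GB q.1 v w) -
          fderiv ℝ (logDeriv φ) q.1 v w - logDeriv φ q.1 v * logDeriv φ q.1 w) •
          (LinearMap.id : E' →ₗ[ℝ] E') := by
      ext u
      simp [coordRiemannEnd, coordRiemann, h.fderiv_christoffel_eq, h.christoffel_eq']
      module
    rw [h1, map_smul, LinearMap.trace_id, smul_eq_mul, mul_comm]

/-- The endomorphism `u ↦ ∇_u (φ ∇φ) - φ⁻¹ dφ(u) φ ∇φ`. -/
def warpEnd (GB : E → E →L[ℝ] E →L[ℝ] ℝ) (φ : E → ℝ) (x : E) : E →L[ℝ] E :=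
  fderiv ℝ (warpField GB φ) x + (christoffel GB x).flip (warpField GB φ x) -
    (logDeriv φ x).smulRight (warpField GB φ x)

theorem coordRicci_fibre (h : IsWarpedAt ∞ G GB GF φ q) (v w : E') :
    coordRicci G q (0, v) (0, w) = coordRicci GF q.2 v w -
      (LinearMap.trace ℝ E (warpEnd GB φ q.1).toLinearMap +
        (Module.finrank ℝ E' - 1) * logDeriv φ q.1 (warpField GB φ q.1)) * GF q.2 v w := by
  change LinearMap.trace ℝ (E × E') (coordRiemannEnd G q (0, v) (0, w)) =
    LinearMap.trace ℝ E' (coordRiemannEnd GF q.2 v w) - _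
  rw [LinearMap.trace_prod_eq]
  have h1 : LinearMap.fst ℝ E E' ∘ₗ coordRiemannEnd G q (0, v) (0, w) ∘ₗ
      LinearMap.inl ℝ E E' = -(GF q.2 v w) • (warpEnd GB φ q.1).toLinearMap := by
    ext u
    simp [coordRiemannEnd, coordRiemann, h.fderiv_christoffel_eq, h.christoffel_eq', warpEnd]
    module
  have h2 : LinearMap.snd ℝ E E' ∘ₗ coordRiemannEnd G q (0, v) (0, w) ∘ₗ
      LinearMap.inr ℝ E E' = coordRiemannEnd GF q.2 v w -
        (logDeriv φ q.1 (warpField GB φ q.1) * GF q.2 v w) • (LinearMap.id : E' →ₗ[ℝ] E') +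
        (logDeriv φ q.1 (warpField GB φ q.1)) •
          ((GF q.2).flip w).toLinearMap.smulRight v := by
    ext u
    simp [coordRiemannEnd, coordRiemann, h.fderiv_christoffel_eq, h.christoffel_eq']
    module
  rw [h1, h2, map_add, map_sub, map_smul, map_smul, map_smul, LinearMap.trace_id,
    LinearMap.trace_smulRight]
  simp
  ring

theorem inverse_apply (h : IsWarpedAt n G GB GF φ q) (ℓ : E × E' →L[ℝ] ℝ) :
    (G q).inverse ℓ = ((GB q.1).inverse (ℓ.comp (ContinuousLinearMap.inl ℝ E E')),
      ((φ q.1) ^ 2)⁻¹ • (GF q.2).inverse (ℓ.comp (ContinuousLinearMap.inr ℝ E E'))) := by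
  have hφ : φ q.1 ≠ 0 := h.pos.self_of_nhds.ne'
  rw [h.metric.isInvertible.inverse_apply_eq]
  ext w
  · simp [h.self_apply, h.base.isInvertible.self_apply_inverse]
  · simp [h.self_apply, h.fibre.isInvertible.self_apply_inverse]
    field_simp

theorem coordScalarCurvature_eq (h : IsWarpedAt ∞ G GB GF φ q) :
    coordScalarCurvature G q = LinearMap.trace ℝ E (((GB q.1).inverse : (E →L[ℝ] ℝ) →ₗ[ℝ] E) ∘ₗ
      (LinearMap.toContinuousLinearMap : (E →ₗ[ℝ] ℝ) ≃ₗ[ℝ] (E →L[ℝ] ℝ)).toLinearMap ∘ₗ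
        (coordRicci G q).compl₁₂ (LinearMap.inl ℝ E E') (LinearMap.inl ℝ E E')) +
      ((φ q.1) ^ 2)⁻¹ * (coordScalarCurvature GF q.2 - Module.finrank ℝ E' *
        (LinearMap.trace ℝ E (warpEnd GB φ q.1).toLinearMap +
        (Module.finrank ℝ E' - 1) * logDeriv φ q.1 (warpField GB φ q.1))) := by
  rw [coordScalarCurvature, LinearMap.trace_prod_eq]
  congr 1
  · congr 1
    ext v
    simp only [LinearMap.comp_apply, ContinuousLinearMap.coe_coe, h.inverse_apply,
      LinearMap.fst_apply]
    congr 1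
  · set t := LinearMap.trace ℝ E (warpEnd GB φ q.1).toLinearMap +
        (Module.finrank ℝ E' - 1) * logDeriv φ q.1 (warpField GB φ q.1) with ht
    rw [coordScalarCurvature, mul_comm (Module.finrank ℝ E' : ℝ), ← LinearMap.trace_id ℝ E',
      ← smul_eq_mul t, ← map_smul, ← map_sub, ← smul_eq_mul, ← map_smul]
    congr 1
    ext v
    simp only [LinearMap.comp_apply, ContinuousLinearMap.coe_coe, h.inverse_apply,
      LinearMap.snd_apply, LinearMap.smul_apply, LinearMap.sub_apply, LinearMap.id_apply]
    congr 1
    rw [h.fibre.isInvertible.inverse_apply_eq, map_sub, map_smul,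
      h.fibre.isInvertible.self_apply_inverse]
    ext w
    simpa using h.coordRicci_fibre v w

/-- The scalar curvature of a warped product is that of the fibre, divided by `φ²`, plus a function
of the base. -/
theorem coordScalarCurvature_sub_eq {G₂ : E × E' → E × E' →L[ℝ] E × E' →L[ℝ] ℝ}
    {GF₂ : E' → E' →L[ℝ] E' →L[ℝ] ℝ} {q₂ : E × E'} (h : IsWarpedAt ∞ G GB GF φ q)
    (h₂ : IsWarpedAt ∞ G₂ GB GF₂ φ q₂) (hq : q₂.1 = q.1) :
    coordScalarCurvature G₂ q₂ - coordScalarCurvature G q = ((φ q.1) ^ 2)⁻¹ *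
      (coordScalarCurvature GF₂ q₂.2 - coordScalarCurvature GF q.2) := by
  rw [h.coordScalarCurvature_eq, h₂.coordScalarCurvature_eq, hq]
  have h1 : (coordRicci G₂ q₂).compl₁₂ (LinearMap.inl ℝ E E') (LinearMap.inl ℝ E E') =
      (coordRicci G q).compl₁₂ (LinearMap.inl ℝ E E') (LinearMap.inl ℝ E E') := by
    ext v w
    simp only [LinearMap.compl₁₂_apply, LinearMap.inl_apply]
    rw [h.coordRicci_base, h₂.coordRicci_base, hq]
  rw [h1]
  ring

end IsWarpedAt

end WarpedCoordinates

section WarpedHessian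

variable {E : Type*} [NormedAddCommGroup E] [NormedSpace ℝ E] [FiniteDimensional ℝ E]
  {E' : Type*} [NormedAddCommGroup E'] [NormedSpace ℝ E'] [FiniteDimensional ℝ E']
  {F : Type*} [NormedAddCommGroup F] [NormedSpace ℝ F]

theorem fderiv_comp_prodMk_left {K : E × E' → F} {x : E} {y : E'}
    (hK : DifferentiableAt ℝ K (x, y)) (u : E) :
    fderiv ℝ (fun x => K (x, y)) x u = fderiv ℝ K (x, y) (u, 0) := by
  have h1 : HasFDerivAt (fun x => K (x, y)) _ x :=
    hK.hasFDerivAt.comp x (hasFDerivAt_prodMk_left x y)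
  rw [h1.fderiv]
  simp

theorem fderiv_comp_prodMk_right {K : E × E' → F} {x : E} {y : E'}
    (hK : DifferentiableAt ℝ K (x, y)) (u : E') :
    fderiv ℝ (fun y => K (x, y)) y u = fderiv ℝ K (x, y) (0, u) := by
  have h1 : HasFDerivAt (fun y => K (x, y)) _ y :=
    hK.hasFDerivAt.comp y (hasFDerivAt_prodMk_right x y)
  rw [h1.fderiv]
  simp

theorem fderiv_fderiv_left {K : E × E' → F} {x : E} {y : E'} (hK : ContDiffAt ℝ ∞ K (x, y))
    (u : E) (W : E × E') : fderiv ℝ (fun x => fderiv ℝ K (x, y) W) x u =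
      fderiv ℝ (fderiv ℝ K) (x, y) (u, 0) W := by
  have h1 : ContDiffAt ℝ ∞ (fderiv ℝ K) (x, y) := hK.fderiv_right (by simp)
  have h2 : HasFDerivAt (fun x => fderiv ℝ K (x, y) W) _ x :=
    ((h1.differentiableAt (by simp)).hasFDerivAt.comp x (hasFDerivAt_prodMk_left x y)).clm_apply
      (hasFDerivAt_const W x)
  rw [h2.fderiv]
  simp

theorem fderiv_fderiv_right {K : E × E' → F} {x : E} {y : E'} (hK : ContDiffAt ℝ ∞ K (x, y))
    (u : E') (W : E × E') : fderiv ℝ (fun y => fderiv ℝ K (x, y) W) y u =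
      fderiv ℝ (fderiv ℝ K) (x, y) (0, u) W := by
  have h1 : ContDiffAt ℝ ∞ (fderiv ℝ K) (x, y) := hK.fderiv_right (by simp)
  have h2 : HasFDerivAt (fun y => fderiv ℝ K (x, y) W) _ y :=
    ((h1.differentiableAt (by simp)).hasFDerivAt.comp y (hasFDerivAt_prodMk_right x y)).clm_apply
      (hasFDerivAt_const W y)
  rw [h2.fderiv]
  simp

theorem fderiv_fderiv_apply {k : E → F} {x : E} (hk : ContDiffAt ℝ ∞ k x) (u v : E) :
    fderiv ℝ (fderiv ℝ k) x u v = fderiv ℝ (fun x => fderiv ℝ k x v) x u := by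
  have h1 : ContDiffAt ℝ ∞ (fderiv ℝ k) x := hk.fderiv_right (by simp)
  have h2 : HasFDerivAt (fun x => fderiv ℝ k x v) _ x :=
    (h1.differentiableAt (by simp)).hasFDerivAt.clm_apply (hasFDerivAt_const v x)
  rw [h2.fderiv]
  simp

theorem ContDiffAt.eventually_differentiableAt {k : E → F} {x : E} (hk : ContDiffAt ℝ ∞ k x) :
    ∀ᶠ y in 𝓝 x, DifferentiableAt ℝ k y :=
  ((hk.of_le (m := 1) (by simp)).eventually (by simp)).mono
    fun _ hy => hy.differentiableAt (by simp)

namespace IsWarpedAt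

variable {G : E × E' → E × E' →L[ℝ] E × E' →L[ℝ] ℝ} {GB : E → E →L[ℝ] E →L[ℝ] ℝ}
  {GF : E' → E' →L[ℝ] E' →L[ℝ] ℝ} {φ : E → ℝ} {x : E} {y : E'} {K : E × E' → ℝ}

theorem coordHessian_mixed (h : IsWarpedAt ∞ G GB GF φ (x, y)) (u : E) (v : E') :
    coordHessian G K (x, y) (u, 0) (0, v) = fderiv ℝ (fderiv ℝ K) (x, y) (u, 0) (0, v) -
      logDeriv φ x u * fderiv ℝ K (x, y) (0, v) := by
  rw [coordHessian, h.christoffel_eq' (by simp)]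
  have : ((0 : E), logDeriv φ x u • v) = logDeriv φ x u • ((0 : E), v) := by simp
  simp [this, -Prod.smul_mk]

theorem coordHessian_base (h : IsWarpedAt ∞ G GB GF φ (x, y)) (hK : ContDiffAt ℝ ∞ K (x, y))
    (u v : E) :
    coordHessian G K (x, y) (u, 0) (v, 0) = coordHessian GB (fun x => K (x, y)) x u v := by
  have hk : ContDiffAt ℝ ∞ (fun x => K (x, y)) x :=
    hK.comp x (contDiffAt_id.prodMk contDiffAt_const)
  rw [coordHessian, coordHessian, h.christoffel_eq' (by simp), fderiv_fderiv_apply hk,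
    fderiv_comp_prodMk_left (hK.differentiableAt (by simp)), ← fderiv_fderiv_left hK]
  congr 1
  · refine congrArg (fun A : E →L[ℝ] ℝ => A u) (EventuallyEq.fderiv_eq ?_)
    have h1 : Tendsto (fun x => (x, y)) (𝓝 x) (𝓝 (x, y)) :=
      (continuous_id.prodMk continuous_const).tendsto x
    filter_upwards [h1.eventually hK.eventually_differentiableAt] with x' hx'
    rw [fderiv_comp_prodMk_left hx']
  · simp

theorem coordHessian_fibre (h : IsWarpedAt ∞ G GB GF φ (x, y)) (hK : ContDiffAt ℝ ∞ K (x, y))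
    (u v : E') :
    coordHessian G K (x, y) (0, u) (0, v) = coordHessian GF (fun y => K (x, y)) y u v +
      GF y u v * fderiv ℝ (fun x => K (x, y)) x (warpField GB φ x) := by
  have hk : ContDiffAt ℝ ∞ (fun y => K (x, y)) y :=
    hK.comp y (contDiffAt_const.prodMk contDiffAt_id)
  have h2 : fderiv ℝ K (x, y) (christoffel G (x, y) (0, u) (0, v)) =
      fderiv ℝ K (x, y) (0, christoffel GF y u v) -
      GF y u v * fderiv ℝ K (x, y) (warpField GB φ x, 0) := by
    rw [h.christoffel_eq' (by simp), ← smul_eq_mul, ← map_smul, ← map_sub]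
    simp
  rw [coordHessian, coordHessian, h2, fderiv_fderiv_apply hk,
    fderiv_comp_prodMk_left (hK.differentiableAt (by simp)),
    fderiv_comp_prodMk_right (hK.differentiableAt (by simp)), ← fderiv_fderiv_right hK]
  have h3 : fderiv ℝ (fun y => fderiv ℝ K (x, y) (0, v)) y =
      fderiv ℝ (fun y' => fderiv ℝ (fun y => K (x, y)) y' v) y := by
    refine EventuallyEq.fderiv_eq ?_
    have h1 : Tendsto (fun y => (x, y)) (𝓝 y) (𝓝 (x, y)) :=
      (continuous_const.prodMk continuous_id).tendsto y
    filter_upwards [h1.eventually hK.eventually_differentiableAt] with x' hx'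
    rw [fderiv_comp_prodMk_right hx']
  rw [h3]
  ring

end IsWarpedAt

end WarpedHessian

section WarpedManifold

variable {E : Type*} [NormedAddCommGroup E] [NormedSpace ℝ E] [FiniteDimensional ℝ E]
  {H : Type*} [TopologicalSpace H] {I : ModelWithCorners ℝ E H} [I.Boundaryless]
  {M : Type*} [TopologicalSpace M] [ChartedSpace H M] [IsManifold I ∞ M]
  {E' : Type*} [NormedAddCommGroup E'] [NormedSpace ℝ E'] [FiniteDimensional ℝ E']
  {H' : Type*} [TopologicalSpace H'] {I' : ModelWithCorners ℝ E' H'} [I'.Boundaryless]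
  {M' : Type*} [TopologicalSpace M'] [ChartedSpace H' M'] [IsManifold I' ∞ M']

theorem extChartAt_prod_symm_apply (b : M) (z : M') (r : E × E') :
    (extChartAt (I.prod I') (b, z)).symm r =
      ((extChartAt I b).symm r.1, (extChartAt I' z).symm r.2) := by
  rw [extChartAt_prod]
  rfl

theorem chartSymmDeriv_prod {b : M} {z : M'} {r : E × E'} (h1 : r.1 ∈ (extChartAt I b).target)
    (h2 : r.2 ∈ (extChartAt I' z).target) (V : E × E') :
    chartSymmDeriv (I.prod I') (b, z) r V =
      (chartSymmDeriv I b r.1 V.1, chartSymmDeriv I' z r.2 V.2) := by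
  have e : ((extChartAt (I.prod I') (b, z)).symm : E × E' → M × M') =
      fun r => ((extChartAt I b).symm r.1, (extChartAt I' z).symm r.2) :=
    funext fun r => extChartAt_prod_symm_apply b z r
  have d1 : MDifferentiableAt 𝓘(ℝ, E × E') 𝓘(ℝ, E) (Prod.fst : E × E' → E) r :=
    differentiableAt_fst.mdifferentiableAt
  have d2 : MDifferentiableAt 𝓘(ℝ, E × E') 𝓘(ℝ, E') (Prod.snd : E × E' → E') r :=
    differentiableAt_snd.mdifferentiableAt
  have a1 := mdifferentiableAt_extChartAt_symm h1
  have a2 := mdifferentiableAt_extChartAt_symm h2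
  have m1 : mfderiv 𝓘(ℝ, E × E') I (fun r : E × E' => (extChartAt I b).symm r.1) r V =
      chartSymmDeriv I b r.1 V.1 := by
    have := mfderiv_comp r a1 d1
    refine (congrArg (fun A => A V) this).trans ?_
    rw [mfderiv_eq_fderiv, fderiv_fst]
    rfl
  have m2 : mfderiv 𝓘(ℝ, E × E') I' (fun r : E × E' => (extChartAt I' z).symm r.2) r V =
      chartSymmDeriv I' z r.2 V.2 := by
    have := mfderiv_comp r a2 d2
    refine (congrArg (fun A => A V) this).trans ?_
    rw [mfderiv_eq_fderiv, fderiv_snd]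
    rfl
  have m3 := mfderiv_prodMk (MDifferentiableAt.comp r a1 d1) (MDifferentiableAt.comp r a2 d2)
  change mfderiv 𝓘(ℝ, E × E') (I.prod I') (extChartAt (I.prod I') (b, z)).symm r V = _
  rw [e]
  refine (congrArg (fun A => A V) m3).trans ?_
  exact Prod.ext m1 m2

variable (gB : SmoothMetric I M) (gF : SmoothMetric I' M') {f : M → ℝ}
    (hf : ContMDiff I 𝓘(ℝ, ℝ) ∞ f) (hpos : ∀ x, 0 < f x)

theorem warpedProduct_form (p : M × M') (V W : E × E') :
    (warpedProduct gB gF f hf hpos).form p V W =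
      gB.form p.1 V.1 W.1 + f p.1 ^ 2 * gF.form p.2 V.2 W.2 :=
  warpedProduct_inner_apply gB gF f hf hpos p V W

theorem isWarpedAt_chartMetric (b : M) (z : M') :
    IsWarpedAt ∞ (chartMetric (warpedProduct gB gF f hf hpos) (b, z)) (chartMetric gB b)
      (chartMetric gF z) (f ∘ (extChartAt I b).symm) (extChartAt I b b, extChartAt I' z z) where
  metric := isMetricAt_chartMetric (warpedProduct gB gF f hf hpos) (b, z)
  base := isMetricAt_chartMetric gB b
  fibre := isMetricAt_chartMetric gF z
  warp := contDiffAt_comp_extChartAt_symm hf (mem_extChartAt_target b)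
  pos := Eventually.of_forall fun x => hpos _
  apply_eq := by
    have h1 := extChartAt_target_mem_nhds_of_mem (mem_extChartAt_target (I := I) b)
    have h2 := extChartAt_target_mem_nhds_of_mem (mem_extChartAt_target (I := I') z)
    filter_upwards [prod_mem_nhds h1 h2] with r hr V W
    rw [chartMetric_apply, chartMetric_apply, chartMetric_apply, warpedProduct_form,
      chartSymmDeriv_prod hr.1 hr.2, chartSymmDeriv_prod hr.1 hr.2, extChartAt_prod_symm_apply]
    rfl

theorem scalarCurvature_warpedProduct_sub (b : M) (z₁ z₂ : M') :
    scalarCurvature (warpedProduct gB gF f hf hpos) (b, z₂) -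
      scalarCurvature (warpedProduct gB gF f hf hpos) (b, z₁) =
      (f b ^ 2)⁻¹ * (scalarCurvature gF z₂ - scalarCurvature gF z₁) := by
  have h := (isWarpedAt_chartMetric gB gF hf hpos b z₁).coordScalarCurvature_sub_eq
    (isWarpedAt_chartMetric gB gF hf hpos b z₂) rfl
  simp only [Function.comp, extChartAt_to_inv] at h
  exact h

variable {h : M × M' → ℝ}

theorem contMDiff_slice_left (hh : ContMDiff (I.prod I') 𝓘(ℝ, ℝ) ∞ h)
    (z : M') : ContMDiff I 𝓘(ℝ, ℝ) ∞ (fun b => h (b, z)) :=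
  hh.comp (contMDiff_id.prodMk contMDiff_const)

theorem contMDiff_slice_right (hh : ContMDiff (I.prod I') 𝓘(ℝ, ℝ) ∞ h)
    (b : M) : ContMDiff I' 𝓘(ℝ, ℝ) ∞ (fun z => h (b, z)) :=
  hh.comp (contMDiff_const.prodMk contMDiff_id)

theorem contDiffAt_prod_chart (hh : ContMDiff (I.prod I') 𝓘(ℝ, ℝ) ∞ h)
    (b : M) (z : M') :
    ContDiffAt ℝ ∞ (h ∘ (extChartAt (I.prod I') (b, z)).symm)
      (extChartAt I b b, extChartAt I' z z) :=
  contDiffAt_comp_extChartAt_symm hh (mem_extChartAt_target (b, z))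

theorem hessianForm_warpedProduct_base (hh : ContMDiff (I.prod I') 𝓘(ℝ, ℝ) ∞ h)
    (b : M) (z : M') (u v : E) :
    hessianForm (warpedProduct gB gF f hf hpos) h (b, z) (u, 0) (v, 0) =
      hessianForm gB (fun b => h (b, z)) b u v := by
  rw [hessianForm_eq, hessianForm_eq]
  refine ((isWarpedAt_chartMetric gB gF hf hpos b z).coordHessian_base
    (contDiffAt_prod_chart hh b z) u v).trans ?_
  congr 1
  funext x
  simp only [Function.comp, extChartAt_prod_symm_apply, extChartAt_to_inv]

theorem hessianForm_warpedProduct_fibre (hh : ContMDiff (I.prod I') 𝓘(ℝ, ℝ) ∞ h)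
    (b : M) (z : M') (u v : E') :
    hessianForm (warpedProduct gB gF f hf hpos) h (b, z) (0, u) (0, v) =
      hessianForm gF (fun z => h (b, z)) z u v + gF.form z u v *
        (f b * differential I (fun b => h (b, z)) b (gradientVec gB f b)) := by
  rw [hessianForm_eq, hessianForm_eq]
  refine ((isWarpedAt_chartMetric gB gF hf hpos b z).coordHessian_fibre
    (contDiffAt_prod_chart hh b z) u v).trans ?_
  rw [IsWarpedAt.warpField, coordGradient_self gB hf, map_smul, chartMetric_self,
    differential_eq_fderiv (contMDiff_slice_left hh z), smul_eq_mul]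
  simp only [Function.comp, extChartAt_prod_symm_apply, extChartAt_to_inv]
  rfl

theorem fderiv_prod_chart_right (hh : ContMDiff (I.prod I') 𝓘(ℝ, ℝ) ∞ h)
    (b : M) (z : M') (v : E') :
    (fun x => differential I' (fun z => h ((extChartAt I b).symm x, z)) z v)
      =ᶠ[𝓝 (extChartAt I b b)] fun x => fderiv ℝ (h ∘ (extChartAt (I.prod I') (b, z)).symm)
        (x, extChartAt I' z z) (0, v) := by
  have h1 : Tendsto (fun x => (x, extChartAt I' z z)) (𝓝 (extChartAt I b b))
      (𝓝 (extChartAt I b b, extChartAt I' z z)) :=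
    (continuous_id.prodMk continuous_const).tendsto _
  filter_upwards [h1.eventually (contDiffAt_prod_chart hh b z).eventually_differentiableAt]
    with x hx
  rw [← fderiv_comp_prodMk_right hx, differential_eq_fderiv (contMDiff_slice_right hh _)]
  congr 1

theorem contMDiff_fibreDeriv (hh : ContMDiff (I.prod I') 𝓘(ℝ, ℝ) ∞ h)
    (z : M') (v : E') :
    ContMDiff I 𝓘(ℝ, ℝ) ∞ (fun b => differential I' (fun z => h (b, z)) z v) := by
  intro b
  have h0 : ContDiffAt ℝ ∞ (fderiv ℝ (h ∘ (extChartAt (I.prod I') (b, z)).symm))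
      (extChartAt I b b, extChartAt I' z z) :=
    (contDiffAt_prod_chart hh b z).fderiv_right (by simp)
  have h1 : ContDiffAt ℝ ∞ (fun x => fderiv ℝ (h ∘ (extChartAt (I.prod I') (b, z)).symm)
      (x, extChartAt I' z z) (0, v)) (extChartAt I b b) :=
    (h0.comp (extChartAt I b b) (contDiffAt_id.prodMk contDiffAt_const)).clm_apply
      contDiffAt_const
  have h2 := (h1.congr_of_eventuallyEq (fderiv_prod_chart_right hh b z v)).contMDiffAt.comp b
    (contMDiffAt_extChartAt (I := I) (n := ∞))
  refine h2.congr_of_eventuallyEq ?_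
  filter_upwards [extChartAt_source_mem_nhds (I := I) b] with x hx
  simp only [Function.comp, (extChartAt I b).left_inv hx]

theorem hessianForm_warpedProduct_mixed (hh : ContMDiff (I.prod I') 𝓘(ℝ, ℝ) ∞ h)
    (b : M) (z : M') (u : E) (v : E') :
    hessianForm (warpedProduct gB gF f hf hpos) h (b, z) (u, 0) (0, v) =
      differential I (fun b => differential I' (fun z => h (b, z)) z v) b u -
        (f b)⁻¹ * differential I f b u * differential I' (fun z => h (b, z)) z v := by
  rw [hessianForm_eq]
  refine ((isWarpedAt_chartMetric gB gF hf hpos b z).coordHessian_mixed u v).trans ?_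
  rw [differential_eq_fderiv (contMDiff_fibreDeriv hh z v), ← fderiv_fderiv_left
    (contDiffAt_prod_chart hh b z), differential_eq_fderiv hf]
  have h1 := fderiv_prod_chart_right hh b z v
  have h2 : differential I' (fun z => h ((extChartAt I b).symm (extChartAt I b b), z)) z v = _ :=
    h1.self_of_nhds
  have h3 := congrArg (fun A : E →L[ℝ] ℝ => A u) h1.fderiv_eq
  rw [extChartAt_to_inv] at h2
  simp only at h2 h3
  rw [← h2, ← h3, IsWarpedAt.logDeriv]
  simp only [Function.comp_def, extChartAt_to_inv]
  rfl

end WarpedManifold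

section Differential

variable {E : Type*} [NormedAddCommGroup E] [NormedSpace ℝ E] [FiniteDimensional ℝ E]
  {H : Type*} [TopologicalSpace H] {I : ModelWithCorners ℝ E H} [I.Boundaryless]
  {M : Type*} [TopologicalSpace M] [ChartedSpace H M] [IsManifold I ∞ M]

theorem hasFDerivAt_comp_extChartAt_symm {h : M → ℝ} (hh : ContMDiff I 𝓘(ℝ, ℝ) ∞ h) (p : M) :
    HasFDerivAt (h ∘ (extChartAt I p).symm) (differential I h p) (extChartAt I p p) := by
  rw [differential_eq_fderiv hh]
  exact ((contDiffAt_comp_extChartAt_symm hh (mem_extChartAt_target p)).differentiableAt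
    (by simp)).hasFDerivAt

theorem differential_eq_of_hasFDerivAt {h : M → ℝ} (hh : ContMDiff I 𝓘(ℝ, ℝ) ∞ h) {p : M}
    {L : E →L[ℝ] ℝ} (hL : HasFDerivAt (h ∘ (extChartAt I p).symm) L (extChartAt I p p)) :
    differential I h p = L :=
  (hasFDerivAt_comp_extChartAt_symm hh p).unique hL

theorem differential_const (c : ℝ) (p : M) : differential I (fun _ : M => c) p = 0 :=
  differential_eq_of_hasFDerivAt contMDiff_const (hasFDerivAt_const c _)

theorem differential_add_const_mul {h k : M → ℝ} (hh : ContMDiff I 𝓘(ℝ, ℝ) ∞ h)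
    (hk : ContMDiff I 𝓘(ℝ, ℝ) ∞ k) (c : ℝ) (p : M) :
    differential I (fun x => h x + c * k x) p = differential I h p + c • differential I k p :=
  differential_eq_of_hasFDerivAt (hh.add (contMDiff_const.mul hk))
    ((hasFDerivAt_comp_extChartAt_symm hh p).add
      ((hasFDerivAt_comp_extChartAt_symm hk p).const_mul c))

theorem differential_mul {h k : M → ℝ} (hh : ContMDiff I 𝓘(ℝ, ℝ) ∞ h)
    (hk : ContMDiff I 𝓘(ℝ, ℝ) ∞ k) (p : M) :
    differential I (fun x => h x * k x) p = h p • differential I k p + k p • differential I h p := by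
  have h1 := (hasFDerivAt_comp_extChartAt_symm hh p).mul (hasFDerivAt_comp_extChartAt_symm hk p)
  simp only [Function.comp, extChartAt_to_inv] at h1
  exact differential_eq_of_hasFDerivAt (hh.mul hk) h1

theorem ContMDiff.fun_mul {h k : M → ℝ} (hh : ContMDiff I 𝓘(ℝ, ℝ) ∞ h)
    (hk : ContMDiff I 𝓘(ℝ, ℝ) ∞ k) : ContMDiff I 𝓘(ℝ, ℝ) ∞ (fun x => h x * k x) := hh.mul hk

theorem ContMDiff.fun_const_mul {k : M → ℝ} (hk : ContMDiff I 𝓘(ℝ, ℝ) ∞ k) (c : ℝ) :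
    ContMDiff I 𝓘(ℝ, ℝ) ∞ (fun x => c * k x) := contMDiff_const.mul hk

theorem differential_const_mul {k : M → ℝ} (hk : ContMDiff I 𝓘(ℝ, ℝ) ∞ k) (c : ℝ) (p : M) :
    differential I (fun x => c * k x) p = c • differential I k p :=
  differential_eq_of_hasFDerivAt (hk.fun_const_mul c)
    ((hasFDerivAt_comp_extChartAt_symm hk p).const_mul c)

theorem ContMDiff.inv_of_pos {f : M → ℝ} (hf : ContMDiff I 𝓘(ℝ, ℝ) ∞ f) (hpos : ∀ x, 0 < f x) :
    ContMDiff I 𝓘(ℝ, ℝ) ∞ (fun x => (f x)⁻¹) := fun x =>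
  ((contDiffAt_inv ℝ (hpos x).ne').contMDiffAt).comp x (hf x)

theorem differential_comp {h : M → ℝ} (hh : ContMDiff I 𝓘(ℝ, ℝ) ∞ h) {φ : ℝ → ℝ} {p : M}
    {φ' : ℝ} (hφh : ContMDiff I 𝓘(ℝ, ℝ) ∞ (fun x => φ (h x))) (hφ : HasDerivAt φ φ' (h p)) :
    differential I (fun x => φ (h x)) p = φ' • differential I h p := by
  refine differential_eq_of_hasFDerivAt hφh ?_
  have h1 : HasDerivAt φ φ' ((h ∘ (extChartAt I p).symm) (extChartAt I p p)) := by
    simpa only [Function.comp, extChartAt_to_inv] using hφ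
  exact h1.comp_hasFDerivAt (extChartAt I p p) (hasFDerivAt_comp_extChartAt_symm hh p)

theorem hessianForm_add_const_mul (g : SmoothMetric I M) {h k : M → ℝ}
    (hh : ContMDiff I 𝓘(ℝ, ℝ) ∞ h) (hk : ContMDiff I 𝓘(ℝ, ℝ) ∞ k) (c : ℝ) (p : M) (u v : E) :
    hessianForm g (fun x => h x + c * k x) p u v =
      hessianForm g h p u v + c * hessianForm g k p u v := by
  have h1 := contDiffAt_comp_extChartAt_symm hh (mem_extChartAt_target (I := I) p)
  have k1 := contDiffAt_comp_extChartAt_symm hk (mem_extChartAt_target (I := I) p)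
  set H' := h ∘ (extChartAt I p).symm with hH
  set K' := k ∘ (extChartAt I p).symm with hK
  have e : (fun x => h x + c * k x) ∘ (extChartAt I p).symm = fun y => H' y + c * K' y := rfl
  have h2 : ContDiffAt ℝ ∞ (fderiv ℝ H') (extChartAt I p p) := h1.fderiv_right (by simp)
  have k2 : ContDiffAt ℝ ∞ (fderiv ℝ K') (extChartAt I p p) := k1.fderiv_right (by simp)
  have e1 : fderiv ℝ (fun y => H' y + c * K' y) =ᶠ[𝓝 (extChartAt I p p)]
      fun y => fderiv ℝ H' y + c • fderiv ℝ K' y := by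
    filter_upwards [h1.eventually_differentiableAt, k1.eventually_differentiableAt] with y hy ky
    exact (hy.hasFDerivAt.add (ky.hasFDerivAt.const_mul c)).fderiv
  have e2 : fderiv ℝ (fderiv ℝ fun y => H' y + c * K' y) (extChartAt I p p) =
      fderiv ℝ (fderiv ℝ H') (extChartAt I p p) +
        c • fderiv ℝ (fderiv ℝ K') (extChartAt I p p) := by
    rw [e1.fderiv_eq]
    exact ((h2.differentiableAt (by simp)).hasFDerivAt.add
      ((k2.differentiableAt (by simp)).hasFDerivAt.const_smul c)).fderiv
  rw [hessianForm_eq, hessianForm_eq, hessianForm_eq, e, ← hH, ← hK, coordHessian, coordHessian,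
    coordHessian, e2, e1.self_of_nhds]
  simp
  ring

theorem hessianForm_const (g : SmoothMetric I M) (c : ℝ) (p : M) (u v : E) :
    hessianForm g (fun _ => c) p u v = 0 := by
  have e : (fun _ : M => c) ∘ (extChartAt I p).symm = fun _ => c := rfl
  have e1 : fderiv ℝ (fun _ : E => c) = fun _ => 0 := funext fun y => fderiv_const_apply c
  rw [hessianForm_eq, e, coordHessian, e1]
  simp

theorem SmoothMetric.form_sq_le (g : SmoothMetric I M) (p : M) (v w : E) :
    g.form p v w ^ 2 ≤ g.form p v v * g.form p w w := by
  by_cases hv : v = 0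
  · simp [hv]
  · have ha := g.form_pos p hv
    have h1 := g.form_nonneg p (g.form p v v • w - g.form p v w • v)
    simp only [map_sub, map_smul, sub_apply, smul_apply, smul_eq_mul, g.form_symm p w v] at h1
    have h2 : 0 ≤ g.form p v v * (g.form p v v * g.form p w w - g.form p v w ^ 2) := by
      nlinarith
    have := nonneg_of_mul_nonneg_right h2 ha
    linarith

theorem IsMIntegralCurve.hasDerivAt_comp {γ : ℝ → M} {v : ∀ x : M, TangentSpace I x}
    (hγ : IsMIntegralCurve γ v) {h : M → ℝ} (hh : ContMDiff I 𝓘(ℝ, ℝ) ∞ h) (t : ℝ) :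
    HasDerivAt (fun t => h (γ t)) (differential I h (γ t) (v (γ t))) t := by
  have h1 : HasFDerivAt (fun t => h (γ t)) ((differential I h (γ t)).comp
      (ContinuousLinearMap.smulRight (1 : ℝ →L[ℝ] ℝ) (v (γ t) : E))) t :=
    ((hh.mdifferentiable (by simp) (γ t)).hasMFDerivAt.comp t (hγ t)).hasFDerivAt
  refine h1.hasDerivAt.congr_deriv ?_
  change differential I h (γ t) ((1 : ℝ) • (v (γ t) : E)) = _
  rw [one_smul]

/-- On a complete manifold, a function bounded below whose gradient has constant length is
constant. -/
theorem gradientSq_eq_zero_of_const [T2Space M] (g : SmoothMetric I M) (hg : IsCompleteMetric g)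
    {f : M → ℝ} (hf : ContMDiff I 𝓘(ℝ, ℝ) ∞ f) (hpos : ∀ x, 0 < f x) {c : ℝ}
    (hc : ∀ x, gradientSq g f x = c) (x : M) : c = 0 := by
  by_contra hne
  have hcpos : 0 < c := lt_of_le_of_ne (hc x ▸ gradientSq_nonneg g f x) (Ne.symm hne)
  obtain ⟨γ, -, hγ⟩ := exists_isMIntegralCurve_of_isCompleteMetric (contMDiff_metricGradient g hf)
    g hg (Real.sqrt_nonneg c) (fun y => by
      rw [Real.sq_sqrt hcpos.le]
      exact (hc y).le) x
  have h1 : ∀ t, HasDerivAt (fun t => f (γ t) - c * t) 0 t := by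
    intro t
    have h2 := (hγ.hasDerivAt_comp hf t).sub ((hasDerivAt_id t).const_mul c)
    have h3 : differential I f (γ t) (metricGradient g f (γ t)) = c :=
      (gradientSq_eq g f (γ t)).symm.trans (hc _)
    rw [h3, mul_one, sub_self] at h2
    exact h2
  have h2 := is_const_of_deriv_eq_zero (fun t => (h1 t).differentiableAt) (fun t => (h1 t).deriv)
    (-(f (γ 0) / c)) 0
  have h3 := hpos (γ (-(f (γ 0) / c)))
  have h4 : c * -(f (γ 0) / c) = -f (γ 0) := by field_simp
  rw [h4] at h2
  linarith

/-- If `|d|∇h|²| ≤ C |∇h|²` locally, a zero of the gradient forces it to vanish identically. -/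
theorem differential_ne_zero_of_hessian_eq [PreconnectedSpace M] (g : SmoothMetric I M)
    {f h : M → ℝ} (hf : ContMDiff I 𝓘(ℝ, ℝ) ∞ f) (hpos : ∀ x, 0 < f x)
    (hh : ContMDiff I 𝓘(ℝ, ℝ) ∞ h) (hnc : ¬ ∃ c, ∀ x, h x = c) {φ : M → ℝ}
    (hess : ∀ (x : M) (u v : E), hessianForm g h x u v = φ x * g.form x u v)
    (hφ : ∀ x, φ x * f x = differential I f x (gradientVec g h x)) (x : M) :
    differential I h x ≠ 0 := by
  have hdu : ∀ (x : M) (v : E), |differential I (gradientSq g h) x v| ≤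
      2 * (Real.sqrt (gradientSq g f x) / f x) * Real.sqrt (g.form x v v) * gradientSq g h x := by
    intro x v
    have hu := gradientSq_nonneg g h x
    have hC := gradientSq_nonneg g f x
    have h1 : |φ x| * f x ≤ Real.sqrt (gradientSq g f x) * Real.sqrt (gradientSq g h x) := by
      have h0 : |φ x| * f x = |φ x * f x| := by rw [abs_mul, abs_of_pos (hpos x)]
      rw [← Real.sqrt_mul hC, h0, hφ, ← form_gradientVec g f]
      exact Real.abs_le_sqrt (g.form_sq_le x _ _)
    have h2 : |differential I h x v| ≤ Real.sqrt (gradientSq g h x) * Real.sqrt (g.form x v v) := by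
      rw [← Real.sqrt_mul hu, ← form_gradientVec g h]
      exact Real.abs_le_sqrt (g.form_sq_le x _ _)
    rw [differential_gradientSq_of_hessian_eq g hh x (hess x), abs_mul, abs_mul, abs_two]
    have h3 : |φ x| ≤ Real.sqrt (gradientSq g f x) / f x * Real.sqrt (gradientSq g h x) := by
      rw [div_mul_eq_mul_div, le_div_iff₀ (hpos x)]
      exact h1
    calc 2 * |φ x| * |differential I h x v|
        ≤ 2 * (Real.sqrt (gradientSq g f x) / f x * Real.sqrt (gradientSq g h x)) *
          (Real.sqrt (gradientSq g h x) * Real.sqrt (g.form x v v)) := by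
          have := div_nonneg (Real.sqrt_nonneg (gradientSq g f x)) (hpos x).le
          gcongr
      _ = 2 * (Real.sqrt (gradientSq g f x) / f x) * Real.sqrt (g.form x v v) *
          (Real.sqrt (gradientSq g h x) * Real.sqrt (gradientSq g h x)) := by ring
      _ = _ := by rw [Real.mul_self_sqrt hu]
  intro hx0
  have hsm := contMDiff_gradientSq g hh
  have hopen : IsOpen {x | gradientSq g h x = 0} := by
    rw [isOpen_iff_mem_nhds]
    intro p hp
    set c := extChartAt I p p with hc
    set A : E → ℝ := fun y => 2 * (Real.sqrt (gradientSq g f ((extChartAt I p).symm y)) /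
      f ((extChartAt I p).symm y)) * Real.sqrt ‖chartMetric g p y‖ with hA
    have hcs : ContinuousAt (extChartAt I p).symm c := continuousAt_extChartAt_symm p
    have hAc : ContinuousAt A c := by
      have a1 : ContinuousAt (fun y => gradientSq g f ((extChartAt I p).symm y)) c :=
        (contMDiff_gradientSq g hf).continuous.continuousAt.comp hcs
      have a2 : ContinuousAt (fun y => f ((extChartAt I p).symm y)) c :=
        hf.continuous.continuousAt.comp hcs
      have a3 : ContinuousAt (fun y => chartMetric g p y) c := (contDiffAt_chartMetric g p).continuousAt
      exact (continuousAt_const.mul (a1.sqrt.div a2 (hpos _).ne')).mul a3.norm.sqrt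
    have hev : ∀ᶠ y in 𝓝 c, A y < A c + 1 ∧ y ∈ (extChartAt I p).target :=
      (hAc.eventually_lt continuousAt_const (by linarith)).and
        (extChartAt_target_mem_nhds_of_mem (mem_extChartAt_target (I := I) p))
    obtain ⟨δ, hδ, hball⟩ := Metric.eventually_nhds_iff_ball.1 hev
    have h2 : ∀ᶠ x in 𝓝 p, extChartAt I p x ∈ Metric.ball c δ :=
      (continuousAt_extChartAt p).preimage_mem_nhds (Metric.ball_mem_nhds _ hδ)
    filter_upwards [h2, extChartAt_source_mem_nhds (I := I) p] with x hx hxs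
    set ξ := extChartAt I p x - c with hξ
    have hseg : ∀ s ∈ Icc (0 : ℝ) 1, c + s • ξ ∈ Metric.ball c δ := by
      intro s hs
      rw [Metric.mem_ball, dist_eq_norm, add_sub_cancel_left, norm_smul, Real.norm_eq_abs,
        abs_of_nonneg hs.1]
      rw [Metric.mem_ball, dist_eq_norm] at hx
      exact lt_of_le_of_lt (mul_le_of_le_one_left (norm_nonneg _) hs.2) hx
    have hder : ∀ s ∈ Icc (0 : ℝ) 1, HasDerivAt
        (fun s : ℝ => (gradientSq g h ∘ (extChartAt I p).symm) (c + s • ξ))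
        (fderiv ℝ (gradientSq g h ∘ (extChartAt I p).symm) (c + s • ξ) ξ) s := by
      intro s hs
      have h3 : HasDerivAt (fun s : ℝ => c + s • ξ) ξ s := by
        simpa using ((hasDerivAt_id s).smul_const ξ).const_add c
      exact ((contDiffAt_comp_extChartAt_symm hsm (hball _ (hseg s hs)).2).differentiableAt
        (by simp)).hasFDerivAt.comp_hasDerivAt s h3
    have h4 := eq_zero_of_abs_deriv_le_mul_abs_self_of_eq_zero_right
      (K := (A c + 1) * ‖ξ‖) (a := 0) (b := 1)
      (fun s hs => (hder s hs).continuousAt.continuousWithinAt)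
      (fun s hs => (hder s ⟨hs.1, hs.2.le⟩).hasDerivWithinAt)
      (by simpa [hc] using hp) (fun s hs => ?_) 1 (by simp)
    · have h5 : c + (1 : ℝ) • ξ = extChartAt I p x := by rw [one_smul, hξ, add_sub_cancel]
      rw [h5, Function.comp_apply, (extChartAt I p).left_inv hxs] at h4
      exact h4
    · have hs' : s ∈ Icc (0 : ℝ) 1 := ⟨hs.1, hs.2.le⟩
      obtain ⟨hAs, hts⟩ := hball _ (hseg s hs')
      rw [fderiv_comp_extChartAt_symm hsm hts, Real.norm_eq_abs, Real.norm_eq_abs,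
        Function.comp_apply, abs_of_nonneg (gradientSq_nonneg g h _)]
      refine (hdu _ _).trans ?_
      refine mul_le_mul_of_nonneg_right ?_ (gradientSq_nonneg g h _)
      rw [← chartMetric_apply]
      have h5 : Real.sqrt (chartMetric g p (c + s • ξ) ξ ξ) ≤
          Real.sqrt ‖chartMetric g p (c + s • ξ)‖ * ‖ξ‖ := by
        rw [← Real.sqrt_sq (norm_nonneg ξ), ← Real.sqrt_mul (norm_nonneg _)]
        refine Real.sqrt_le_sqrt ((le_abs_self _).trans ?_)
        rw [sq, ← mul_assoc, ← Real.norm_eq_abs]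
        exact (chartMetric g p (c + s • ξ)).le_opNorm₂ ξ ξ
      have h6 : 0 ≤ 2 * (Real.sqrt (gradientSq g f ((extChartAt I p).symm (c + s • ξ))) /
          f ((extChartAt I p).symm (c + s • ξ))) :=
        mul_nonneg two_pos.le (div_nonneg (Real.sqrt_nonneg _) (hpos _).le)
      refine (mul_le_mul_of_nonneg_left h5 h6).trans ?_
      rw [← mul_assoc]
      exact mul_le_mul_of_nonneg_right hAs.le (norm_nonneg _)
  have hclosed : IsClosed {x | gradientSq g h x = 0} :=
    isClosed_eq hsm.continuous continuous_const
  have huniv := IsClopen.eq_univ ⟨hclosed, hopen⟩ ⟨x, (gradientSq_eq_zero_iff g h x).2 hx0⟩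
  refine hnc ⟨h x, fun y => eq_of_differential_eq_zero hh (fun p => ?_) y x⟩
  rw [← gradientSq_eq_zero_iff g]
  exact huniv.ge (mem_univ p)

end Differential

section Reduction

variable {E : Type*} [NormedAddCommGroup E] [NormedSpace ℝ E] [FiniteDimensional ℝ E]
  {H : Type*} [TopologicalSpace H] {I : ModelWithCorners ℝ E H} [I.Boundaryless]
  {M : Type*} [TopologicalSpace M] [ChartedSpace H M] [IsManifold I ∞ M]
  {E' : Type*} [NormedAddCommGroup E'] [NormedSpace ℝ E'] [FiniteDimensional ℝ E']
  {H' : Type*} [TopologicalSpace H'] {I' : ModelWithCorners ℝ E' H'} [I'.Boundaryless]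
  {M' : Type*} [TopologicalSpace M'] [ChartedSpace H' M'] [IsManifold I' ∞ M']

/-- A function on a warped product whose Hessian is block diagonal splits. -/
theorem exists_splitting_of_mixed_hessian_eq_zero [PreconnectedSpace M] [PreconnectedSpace M']
    (gB : SmoothMetric I M) (gF : SmoothMetric I' M') {f : M → ℝ}
    (hf : ContMDiff I 𝓘(ℝ, ℝ) ∞ f) (hpos : ∀ x, 0 < f x) {h : M × M' → ℝ}
    (hh : ContMDiff (I.prod I') 𝓘(ℝ, ℝ) ∞ h)
    (hmix : ∀ (b : M) (z : M') (u : E) (v : E'),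
      hessianForm (warpedProduct gB gF f hf hpos) h (b, z) (u, 0) (0, v) = 0) (b₀ : M) (z₀ : M') :
    ∃ k : M' → ℝ, ContMDiff I' 𝓘(ℝ, ℝ) ∞ k ∧ k z₀ = 0 ∧
      ∀ b z, h (b, z) = h (b, z₀) + k z * f b := by
  have hfi := hf.inv_of_pos hpos
  have hconst : ∀ (z : M') (v : E') (b : M),
      (f b)⁻¹ * differential I' (fun z => h (b, z)) z v =
        (f b₀)⁻¹ * differential I' (fun z => h (b₀, z)) z v := by
    intro z v b
    have hD := contMDiff_fibreDeriv hh z v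
    refine eq_of_differential_eq_zero (hfi.fun_mul hD) (fun p => ?_) b b₀
    rw [differential_mul hfi hD, differential_comp hf hfi (hasDerivAt_inv (hpos p).ne')]
    ext u
    have h1 := hessianForm_warpedProduct_mixed gB gF hf hpos hh p z u v
    rw [hmix] at h1
    have hp := (hpos p).ne'
    have h2 : differential I (fun b => differential I' (fun z => h (b, z)) z v) p u =
        (f p)⁻¹ * differential I f p u * differential I' (fun z => h (p, z)) z v := by linarith
    simp only [add_apply, smul_apply, smul_eq_mul, zero_apply, h2]
    field_simp
    ring
  refine ⟨fun z => (f b₀)⁻¹ * h (b₀, z) + (-((f b₀)⁻¹ * h (b₀, z₀))) * 1,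
    (contMDiff_const.mul (contMDiff_slice_right hh b₀)).add contMDiff_const, by ring, ?_⟩
  intro b z
  have s1 := contMDiff_slice_right hh b
  have s0 := contMDiff_slice_right hh b₀
  have h3 : (fun z => (f b)⁻¹ * h (b, z) + (-(f b₀)⁻¹) * h (b₀, z)) z =
      (fun z => (f b)⁻¹ * h (b, z) + (-(f b₀)⁻¹) * h (b₀, z)) z₀ := by
    refine eq_of_differential_eq_zero ((s1.fun_const_mul _).add (s0.fun_const_mul _))
      (fun p => ?_) z z₀
    refine (differential_add_const_mul (s1.fun_const_mul _) s0 _ p).trans ?_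
    rw [differential_const_mul s1]
    ext v
    have := hconst p v b
    simp only [add_apply, smul_apply, smul_eq_mul, zero_apply]
    linarith
  simp only at h3
  have hb := (hpos b).ne'
  have hb₀ := (hpos b₀).ne'
  have h4 : (f b)⁻¹ * h (b, z) = (f b)⁻¹ * h (b, z₀) + (f b₀)⁻¹ * h (b₀, z)
      - (f b₀)⁻¹ * h (b₀, z₀) := by linarith
  calc h (b, z) = f b * ((f b)⁻¹ * h (b, z)) := by field_simp
    _ = _ := by rw [h4]; field_simp; ring

/-- A soliton function on a warped product with complete base is a function of the base. -/
theorem exists_base_function_of_soliton [T2Space M] [PreconnectedSpace M] [PreconnectedSpace M']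
    [Nontrivial E] [Nontrivial E'] [Nonempty M] [Nonempty M']
    (gB : SmoothMetric I M) (gF : SmoothMetric I' M') {f : M → ℝ}
    (hf : ContMDiff I 𝓘(ℝ, ℝ) ∞ f) (hpos : ∀ x, 0 < f x) (hfnc : ¬ ∃ c, ∀ b, f b = c)
    {h : M × M' → ℝ} {ρ : ℝ}
    (hsol : IsYamabeGradientSoliton (warpedProduct gB gF f hf hpos) h ρ)
    (hcomplete : IsCompleteMetric gB) :
    ∃ (h₀ φ : M → ℝ), ContMDiff I 𝓘(ℝ, ℝ) ∞ h₀ ∧ (∀ b z, h (b, z) = h₀ b) ∧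
      (∀ b (u v : E), hessianForm gB h₀ b u v = φ b * gB.form b u v) ∧
      ∀ b, φ b * f b = differential I f b (gradientVec gB h₀ b) := by
  obtain ⟨b₀⟩ := ‹Nonempty M›
  obtain ⟨z₀⟩ := ‹Nonempty M'›
  obtain ⟨e, he⟩ := exists_ne (0 : E)
  obtain ⟨e', he'⟩ := exists_ne (0 : E')
  have hh := hsol.contMDiff
  set lam : M → M' → ℝ := fun b z =>
    scalarCurvature (warpedProduct gB gF f hf hpos) (b, z) - ρ with hlam
  have hess : ∀ (b : M) (z : M') (V W : E × E'),
      hessianForm (warpedProduct gB gF f hf hpos) h (b, z) V W =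
        lam b z * (gB.form b V.1 W.1 + f b ^ 2 * gF.form z V.2 W.2) := by
    intro b z V W
    rw [← warpedProduct_form gB gF hf hpos (b, z)]
    exact hsol.hessian_eq (b, z) V W
  obtain ⟨k, hk, hk₀, hsplit⟩ := exists_splitting_of_mixed_hessian_eq_zero gB gF hf hpos hh
    (fun b z u v => by rw [hess]; simp) b₀ z₀
  set h₀ : M → ℝ := fun b => h (b, z₀) with hh₀def
  have hh₀ : ContMDiff I 𝓘(ℝ, ℝ) ∞ h₀ := contMDiff_slice_left hh z₀
  have hslice : ∀ z, (fun b => h (b, z)) = fun b => h₀ b + k z * f b := fun z =>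
    funext fun b => hsplit b z
  have hslice' : ∀ b, (fun z => h (b, z)) = fun z => h₀ b + f b * k z := fun b =>
    funext fun z => by rw [hsplit b z, mul_comm (f b)]
  have base : ∀ b z (u v : E), hessianForm gB h₀ b u v + k z * hessianForm gB f b u v =
      lam b z * gB.form b u v := by
    intro b z u v
    rw [← hessianForm_add_const_mul gB hh₀ hf, ← hslice,
      ← hessianForm_warpedProduct_base gB gF hf hpos hh, hess]
    simp
  have base₀ : ∀ b (u v : E), hessianForm gB h₀ b u v = lam b z₀ * gB.form b u v := by
    intro b u v
    rw [← base b z₀, hk₀, zero_mul, add_zero]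
  have fibre : ∀ b z (u v : E'), hessianForm gF k z u v = (f b * lam b z -
      (differential I h₀ b (gradientVec gB f b) + k z * gradientSq gB f b)) * gF.form z u v := by
    intro b z u v
    have h1 := hessianForm_warpedProduct_fibre gB gF hf hpos hh b z u v
    rw [hess, hslice, hslice', hessianForm_add_const_mul gF contMDiff_const hk, hessianForm_const,
      differential_add_const_mul hh₀ hf] at h1
    simp only [map_zero, zero_add, add_apply, smul_apply, smul_eq_mul, ← gradientSq_eq] at h1
    have hb := (hpos b).ne'
    have h2 : f b * hessianForm gF k z u v = f b * ((f b * lam b z -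
      (differential I h₀ b (gradientVec gB f b) + k z * gradientSq gB f b)) * gF.form z u v) := by
      linarith
    exact mul_left_cancel₀ hb h2
  have hkzero : ∀ z, k z = 0 := by
    by_contra! hcon
    obtain ⟨z₁, hz₁⟩ := hcon
    set K := (scalarCurvature gF z₁ - scalarCurvature gF z₀) / k z₁ with hK
    have hψ : ∀ b (u v : E), hessianForm gB f b u v = (f b ^ 2)⁻¹ * K * gB.form b u v := by
      intro b u v
      have h1 := base b z₁ u v
      have h2 : lam b z₁ - lam b z₀ = (f b ^ 2)⁻¹ *
          (scalarCurvature gF z₁ - scalarCurvature gF z₀) := by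
        rw [← scalarCurvature_warpedProduct_sub gB gF hf hpos, hlam]
        ring
      rw [base₀] at h1
      have h3 : k z₁ * hessianForm gB f b u v = k z₁ * ((f b ^ 2)⁻¹ * K * gB.form b u v) := by
        have : k z₁ * hessianForm gB f b u v = (lam b z₁ - lam b z₀) * gB.form b u v := by linarith
        rw [this, h2, hK]
        field_simp
      exact mul_left_cancel₀ hz₁ h3
    have hlamz : ∀ b, lam b z₁ = lam b z₀ + k z₁ * ((f b ^ 2)⁻¹ * K) := by
      intro b
      have h1 := base b z₁ e e
      rw [base₀, hψ] at h1
      refine mul_right_cancel₀ (gB.form_pos b he).ne' ?_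
      linarith
    have hJ : ∀ z b, f b * lam b z - (differential I h₀ b (gradientVec gB f b) +
        k z * gradientSq gB f b) = f b₀ * lam b₀ z -
        (differential I h₀ b₀ (gradientVec gB f b₀) + k z * gradientSq gB f b₀) := by
      intro z b
      refine mul_right_cancel₀ (gF.form_pos z he').ne' ?_
      rw [← fibre, ← fibre]
    have hC : ∀ b, K * (f b)⁻¹ + (-1) * gradientSq gB f b =
        K * (f b₀)⁻¹ + (-1) * gradientSq gB f b₀ := by
      intro b
      have h1 := hJ z₁ b
      have h0 := hJ z₀ b
      rw [hk₀] at h0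
      rw [hlamz, hlamz] at h1
      have hb := (hpos b).ne'
      have hb₀ := (hpos b₀).ne'
      have e1 : f b * (lam b z₀ + k z₁ * ((f b ^ 2)⁻¹ * K)) =
          f b * lam b z₀ + k z₁ * (K * (f b)⁻¹) := by field_simp
      have e2 : f b₀ * (lam b₀ z₀ + k z₁ * ((f b₀ ^ 2)⁻¹ * K)) =
          f b₀ * lam b₀ z₀ + k z₁ * (K * (f b₀)⁻¹) := by field_simp
      rw [e1, e2] at h1
      refine mul_left_cancel₀ hz₁ ?_
      linarith
    have hfi := hf.inv_of_pos hpos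
    have hdiff : ∀ b, K • differential I f b = 0 := by
      intro b
      have hs := contMDiff_gradientSq gB hf
      have h1 : differential I (fun b => K * (f b)⁻¹ + (-1) * gradientSq gB f b) b = 0 := by
        rw [show (fun b => K * (f b)⁻¹ + (-1) * gradientSq gB f b) = fun _ =>
          K * (f b₀)⁻¹ + (-1) * gradientSq gB f b₀ from funext hC, differential_const]
      rw [differential_add_const_mul (hfi.fun_const_mul K) hs, differential_const_mul hfi,
        differential_comp hf hfi (hasDerivAt_inv (hpos b).ne')] at h1
      ext v
      have h2 := congrArg (fun A : E →L[ℝ] ℝ => A v) h1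
      have hb := (hpos b).ne'
      simp only [add_apply, smul_apply, smul_eq_mul, zero_apply,
        differential_gradientSq_of_hessian_eq gB hf b (hψ b) v] at h2 ⊢
      field_simp at h2
      linarith
    have hK0 : K = 0 := by
      by_contra hne
      exact hfnc ⟨f b₀, fun b => eq_of_differential_eq_zero hf
        (fun p => (smul_eq_zero.1 (hdiff p)).resolve_left hne) b b₀⟩
    have hgc : ∀ b, gradientSq gB f b = gradientSq gB f b₀ := by
      intro b
      have := hC b
      rw [hK0] at this
      linarith
    have h0 := gradientSq_eq_zero_of_const gB hcomplete hf hpos hgc b₀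
    exact hfnc ⟨f b₀, fun b => eq_of_differential_eq_zero hf
      (fun p => (gradientSq_eq_zero_iff gB f p).1 ((hgc p).trans h0)) b b₀⟩
  refine ⟨h₀, fun b => lam b z₀, hh₀, fun b z => by rw [hsplit b z, hkzero, zero_mul, add_zero],
    base₀, fun b => ?_⟩
  have h1 := fibre b z₀ e' e'
  have hkc : k = fun _ => 0 := funext hkzero
  rw [hkc, hessianForm_const] at h1
  have h2 := (mul_eq_zero.1 h1.symm).resolve_right (gF.form_pos z₀ he').ne'
  have h3 : differential I f b (gradientVec gB h₀ b) = differential I h₀ b (gradientVec gB f b) := by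
    rw [← form_gradientVec gB, gB.form_symm, form_gradientVec]
  rw [h3]
  linarith

end Reduction

section UnitGradient

variable {E : Type*} [NormedAddCommGroup E] [NormedSpace ℝ E] [FiniteDimensional ℝ E]
  {H : Type*} [TopologicalSpace H] {I : ModelWithCorners ℝ E H} [I.Boundaryless]
  {M : Type*} [TopologicalSpace M] [ChartedSpace H M] [IsManifold I ∞ M]

theorem fderiv_fderiv_comm {X Y F : Type*} [NormedAddCommGroup X] [NormedSpace ℝ X]
    [NormedAddCommGroup Y] [NormedSpace ℝ Y] [FiniteDimensional ℝ X] [FiniteDimensional ℝ Y]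
    [NormedAddCommGroup F] [NormedSpace ℝ F] {K : X × Y → F} {x : X} {y : Y}
    (hK : ContDiffAt ℝ ∞ K (x, y)) (u : X) (v : Y) :
    fderiv ℝ (fun x => fderiv ℝ K (x, y) (0, v)) x u =
      fderiv ℝ (fun y => fderiv ℝ K (x, y) (u, 0)) y v := by
  rw [fderiv_fderiv_left hK, fderiv_fderiv_right hK]
  exact hK.isSymmSndFDerivAt (by simpa using ENat.LEInfty.out) _ _

theorem gradientNorm_sq (g : SmoothMetric I M) (h : M → ℝ) (p : M) :
    gradientNorm g h p ^ 2 = gradientSq g h p := by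
  rw [gradientNorm_eq, Real.sq_sqrt (gradientSq_nonneg g h p)]

theorem gradientNorm_pos (g : SmoothMetric I M) {h : M → ℝ} {p : M}
    (hp : differential I h p ≠ 0) : 0 < gradientNorm g h p := by
  rw [gradientNorm_eq]
  exact Real.sqrt_pos.2 (lt_of_le_of_ne (gradientSq_nonneg g h p)
    (Ne.symm (mt (gradientSq_eq_zero_iff g h p).1 hp)))

theorem contMDiff_gradientNorm (g : SmoothMetric I M) {h : M → ℝ} (hh : ContMDiff I 𝓘(ℝ, ℝ) ∞ h)
    (hne : ∀ p, differential I h p ≠ 0) : ContMDiff I 𝓘(ℝ, ℝ) ∞ (gradientNorm g h) := fun p =>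
  ((Real.contDiffAt_sqrt (mt (gradientSq_eq_zero_iff g h p).1 (hne p))).contMDiffAt).comp p
    (contMDiff_gradientSq g hh p)

/-- The normalized gradient. -/
def unitGradient (g : SmoothMetric I M) (h : M → ℝ) (p : M) : TangentSpace I p :=
  (gradientNorm g h p)⁻¹ • metricGradient g h p

/-- The normalized gradient, as a vector of the model space. -/
def unitGradientVec (g : SmoothMetric I M) (h : M → ℝ) (p : M) : E :=
  (gradientNorm g h p)⁻¹ • gradientVec g h p

theorem contMDiff_unitGradient (g : SmoothMetric I M) {h : M → ℝ} (hh : ContMDiff I 𝓘(ℝ, ℝ) ∞ h)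
    (hne : ∀ p, differential I h p ≠ 0) :
    ContMDiff I I.tangent ∞ (fun x => (⟨x, unitGradient g h x⟩ : TangentBundle I M)) :=
  ((contMDiff_gradientNorm g hh hne).inv_of_pos fun p => gradientNorm_pos g (hne p)).smul_section
    (contMDiff_metricGradient g hh)

theorem differential_unitGradientVec (g : SmoothMetric I M) {h : M → ℝ} {p : M}
    (hp : differential I h p ≠ 0) :
    differential I h p (unitGradientVec g h p) = gradientNorm g h p := by
  have := (gradientNorm_pos g hp).ne'
  rw [unitGradientVec, map_smul, smul_eq_mul, ← gradientSq_eq, ← gradientNorm_sq]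
  field_simp

theorem form_unitGradientVec (g : SmoothMetric I M) (h : M → ℝ) (p : M) (v : E) :
    g.form p (unitGradientVec g h p) v = (gradientNorm g h p)⁻¹ * differential I h p v := by
  rw [unitGradientVec, map_smul, smul_apply, form_gradientVec, smul_eq_mul]

theorem form_unitGradientVec_self (g : SmoothMetric I M) {h : M → ℝ} {p : M}
    (hp : differential I h p ≠ 0) :
    g.form p (unitGradientVec g h p) (unitGradientVec g h p) = 1 := by
  rw [form_unitGradientVec, differential_unitGradientVec g hp,
    inv_mul_cancel₀ (gradientNorm_pos g hp).ne']

theorem gradientNorm_mul_differential (g : SmoothMetric I M) {h : M → ℝ}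
    (hh : ContMDiff I 𝓘(ℝ, ℝ) ∞ h) (hne : ∀ p, differential I h p ≠ 0) {φ : M → ℝ}
    (hess : ∀ (x : M) (u v : E), hessianForm g h x u v = φ x * g.form x u v) (p : M) (v : E) :
    gradientNorm g h p * differential I (gradientNorm g h) p v =
      φ p * differential I h p v := by
  have hw := contMDiff_gradientNorm g hh hne
  have h1 : gradientSq g h = fun x => gradientNorm g h x * gradientNorm g h x :=
    funext fun x => by rw [← gradientNorm_sq, sq]
  have h2 := differential_gradientSq_of_hessian_eq g hh p (hess p) v
  rw [h1, differential_mul hw hw] at h2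
  simp only [add_apply, smul_apply, smul_eq_mul] at h2
  linarith

/-- The differential of a map, as a linear map between model spaces. -/
def mapDeriv (I : ModelWithCorners ℝ E H) (F : M → M) (x : M) : E →L[ℝ] E := mfderiv I I F x

theorem differential_comp_map {k : M → ℝ} (hk : ContMDiff I 𝓘(ℝ, ℝ) ∞ k) {F : M → M}
    (hF : ContMDiff I I ∞ F) (x : M) (ξ : E) :
    differential I (fun x => k (F x)) x ξ = differential I k (F x) (mapDeriv I F x ξ) :=
  congrArg (fun A : E →L[ℝ] ℝ => A ξ) (mfderiv_comp (I' := I) x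
    (hk.mdifferentiable (by simp) _) (hF.mdifferentiable (by simp) _))

variable {θ : ℝ → M → M}

theorem contMDiff_flow_map (hθ : ContMDiff (𝓘(ℝ, ℝ).prod I) I ∞ (fun p : ℝ × M => θ p.1 p.2))
    (t : ℝ) : ContMDiff I I ∞ (θ t) :=
  hθ.comp (contMDiff_const.prodMk contMDiff_id)

theorem contMDiffAt_flow_chart (hθ : ContMDiff (𝓘(ℝ, ℝ).prod I) I ∞ (fun p : ℝ × M => θ p.1 p.2))
    (t : ℝ) {p : M} {y : E} (hy : y ∈ (extChartAt I p).target) :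
    ContMDiffAt 𝓘(ℝ, ℝ × E) I ∞ (fun q : ℝ × E => θ q.1 ((extChartAt I p).symm q.2)) (t, y) := by
  have h1 : ContMDiffAt 𝓘(ℝ, ℝ × E) (𝓘(ℝ, ℝ).prod I) ∞
      (fun q : ℝ × E => (q.1, (extChartAt I p).symm q.2)) (t, y) := by
    refine ContMDiffAt.prodMk contDiffAt_fst.contMDiffAt ?_
    exact ContMDiffAt.comp (t, y) (contMDiffAt_extChartAt_symm hy) contDiffAt_snd.contMDiffAt
  exact (hθ _).comp (t, y) h1

/-- Time derivative and differential commute along a flow. -/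
theorem hasDerivAt_differential_comp_flow
    (hθ : ContMDiff (𝓘(ℝ, ℝ).prod I) I ∞ (fun p : ℝ × M => θ p.1 p.2))
    {k l : M → ℝ} (hk : ContMDiff I 𝓘(ℝ, ℝ) ∞ k) (hl : ContMDiff I 𝓘(ℝ, ℝ) ∞ l)
    (hkl : ∀ t x, HasDerivAt (fun t => k (θ t x)) (l (θ t x)) t) (x : M) (ξ : E) (t : ℝ) :
    HasDerivAt (fun t => differential I (fun x => k (θ t x)) x ξ)
      (differential I (fun x => l (θ t x)) x ξ) t := by
  set Ψ : ℝ × E → ℝ := fun q => k (θ q.1 ((extChartAt I x).symm q.2)) with hΨ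
  set c := extChartAt I x x with hc
  have hΨs : ∀ t, ∀ y ∈ (extChartAt I x).target, ContDiffAt ℝ ∞ Ψ (t, y) := fun t y hy =>
    contMDiffAt_iff_contDiffAt.1 ((hk _).comp _ (contMDiffAt_flow_chart hθ t hy))
  have hct : c ∈ (extChartAt I x).target := mem_extChartAt_target x
  have h1 : (fun t => differential I (fun x => k (θ t x)) x ξ) =
      fun t => fderiv ℝ Ψ (t, c) (0, ξ) := by
    funext t
    have e : ContMDiff I 𝓘(ℝ, ℝ) ∞ (fun x => k (θ t x)) := hk.comp (contMDiff_flow_map hθ t)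
    rw [differential_eq_fderiv e, ← fderiv_comp_prodMk_right ((hΨs t c hct).differentiableAt (by simp))]
    rfl
  have h2 : DifferentiableAt ℝ (fun t => fderiv ℝ Ψ (t, c) (0, ξ)) t := by
    have h3 : ContDiffAt ℝ ∞ (fderiv ℝ Ψ) (t, c) := (hΨs t c hct).fderiv_right (by simp)
    have h4 : ContDiffAt ℝ ∞ (fun t => fderiv ℝ Ψ (t, c) (0, ξ)) t :=
      (h3.comp t (contDiffAt_id.prodMk contDiffAt_const)).clm_apply contDiffAt_const
    exact h4.differentiableAt (by simp)
  rw [h1]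
  have e : ContMDiff I 𝓘(ℝ, ℝ) ∞ (fun x => l (θ t x)) := hl.comp (contMDiff_flow_map hθ t)
  refine h2.hasDerivAt.congr_deriv ?_
  rw [← fderiv_apply_one_eq_deriv, fderiv_fderiv_comm (hΨs t c hct), differential_eq_fderiv e]
  refine congrArg (fun A : E →L[ℝ] ℝ => A ξ) (EventuallyEq.fderiv_eq ?_)
  filter_upwards [extChartAt_target_mem_nhds_of_mem hct] with y hy
  rw [← fderiv_comp_prodMk_left ((hΨs t y hy).differentiableAt (by simp)),
    fderiv_apply_one_eq_deriv]
  exact (hkl t ((extChartAt I x).symm y)).deriv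

/-- The speed of the flow, read in the preferred chart at `x`. -/
theorem hasDerivAt_form_flow (g : SmoothMetric I M)
    (hθ : ContMDiff (𝓘(ℝ, ℝ).prod I) I ∞ (fun p : ℝ × M => θ p.1 p.2)) (h0 : ∀ x, θ 0 x = x)
    {v : ∀ x : M, TangentSpace I x} (hv : ∀ x, IsMIntegralCurve (fun t => θ t x) v)
    (x : M) (η : E) {X : E → E}
    (hX : ∀ᶠ y in 𝓝 (extChartAt I x x), X y =
      chartDeriv I x ((extChartAt I x).symm y) (v ((extChartAt I x).symm y))) :
    HasDerivAt (fun t => g.form (θ t x) (mapDeriv I (θ t) x η) (mapDeriv I (θ t) x η))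
      (fderiv ℝ (chartMetric g x) (extChartAt I x x) (X (extChartAt I x x)) η η +
        2 * chartMetric g x (extChartAt I x x) (fderiv ℝ X (extChartAt I x x) η) η) 0 := by
  set c := extChartAt I x x with hc
  have hct : c ∈ (extChartAt I x).target := mem_extChartAt_target x
  set Θ : ℝ × E → E := fun q => extChartAt I x (θ q.1 ((extChartAt I x).symm q.2)) with hΘ
  have hθ0c : θ 0 ((extChartAt I x).symm c) = x := by rw [h0, hc, extChartAt_to_inv]
  have hev : ∀ᶠ q in 𝓝 ((0 : ℝ), c), θ q.1 ((extChartAt I x).symm q.2) ∈ (extChartAt I x).source ∧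
      q.2 ∈ (extChartAt I x).target := by
    refine Eventually.and ?_ (continuousAt_snd.preimage_mem_nhds
      (extChartAt_target_mem_nhds_of_mem hct))
    refine (contMDiffAt_flow_chart hθ 0 hct).continuousAt.preimage_mem_nhds ?_
    simp only [hθ0c]
    exact extChartAt_source_mem_nhds x
  have hΘs : ∀ t y, y ∈ (extChartAt I x).target →
      θ t ((extChartAt I x).symm y) ∈ (extChartAt I x).source → ContDiffAt ℝ ∞ Θ (t, y) := by
    intro t y hy hty
    refine contMDiffAt_iff_contDiffAt.1 (ContMDiffAt.comp (t, y) ?_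
      (contMDiffAt_flow_chart hθ t hy))
    exact contMDiffAt_extChartAt' (by rwa [extChartAt_source] at hty)
  have hΘ0 : ContDiffAt ℝ ∞ Θ (0, c) := hΘs 0 c hct (by rw [hθ0c]; exact mem_extChartAt_source x)
  have hΘ0c : ∀ y ∈ (extChartAt I x).target, Θ (0, y) = y := by
    intro y hy
    rw [hΘ]
    simp only [h0]
    exact (extChartAt I x).right_inv hy
  -- spatial derivative
  have hspace : ∀ᶠ t in 𝓝 (0 : ℝ), mapDeriv I (θ t) x η =
      chartSymmDeriv I x (Θ (t, c)) (fderiv ℝ Θ (t, c) (0, η)) ∧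
      (extChartAt I x).symm (Θ (t, c)) = θ t x := by
    have h1 : Tendsto (fun t : ℝ => (t, c)) (𝓝 0) (𝓝 (0, c)) :=
      (continuous_id.prodMk continuous_const).tendsto _
    filter_upwards [h1.eventually hev] with t ht
    have hs : θ t x ∈ (extChartAt I x).source := by
      have := ht.1
      simpa only [hc, extChartAt_to_inv] using this
    have e2 : (extChartAt I x).symm (Θ (t, c)) = θ t x := by
      simp only [hΘ, hc, extChartAt_to_inv]
      exact (extChartAt I x).left_inv hs
    refine ⟨?_, e2⟩
    have h2 : fderiv ℝ Θ (t, c) (0, η) = chartDeriv I x (θ t x) (mapDeriv I (θ t) x η) := by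
      rw [← fderiv_comp_prodMk_right ((hΘs t c hct ht.1).differentiableAt (by simp))]
      have a1 : MDifferentiableAt 𝓘(ℝ, E) I (extChartAt I x).symm c :=
        mdifferentiableAt_extChartAt_symm hct
      have a2 : MDifferentiableAt I I (θ t) ((extChartAt I x).symm c) :=
        (contMDiff_flow_map hθ t).mdifferentiable (by simp) _
      have a3 : MDifferentiableAt I 𝓘(ℝ, E) (extChartAt I x) (θ t ((extChartAt I x).symm c)) :=
        mdifferentiableAt_extChartAt (by have := ht.1; rwa [extChartAt_source] at this)
      have h3 : mfderiv 𝓘(ℝ, E) 𝓘(ℝ, E)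
          (extChartAt I x ∘ (θ t ∘ (extChartAt I x).symm)) c =
          (chartDeriv I x (θ t ((extChartAt I x).symm c))).comp
            ((mapDeriv I (θ t) ((extChartAt I x).symm c)).comp (chartSymmDeriv I x c)) := by
        rw [mfderiv_comp (I' := I) c a3 (a2.comp c a1), mfderiv_comp (I' := I) c a2 a1]
        rfl
      have h4 := congrArg (fun A : E →L[ℝ] E => A η) h3
      rw [mfderiv_eq_fderiv] at h4
      refine h4.trans ?_
      simp only [ContinuousLinearMap.comp_apply]
      rw [hc, chartSymmDeriv_self, extChartAt_to_inv]
    have hy := (extChartAt I x).map_source hs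
    have e3 : Θ (t, c) = extChartAt I x (θ t x) := by simp only [hΘ, hc, extChartAt_to_inv]
    have h5 := chartSymmDeriv_comp_chartDeriv hy (mapDeriv I (θ t) x η)
    rw [(extChartAt I x).left_inv hs] at h5
    rw [h2, e3, h5]
  have heq : (fun t => g.form (θ t x) (mapDeriv I (θ t) x η) (mapDeriv I (θ t) x η)) =ᶠ[𝓝 0]
      fun t => chartMetric g x (Θ (t, c)) (fderiv ℝ Θ (t, c) (0, η))
        (fderiv ℝ Θ (t, c) (0, η)) := by
    filter_upwards [hspace] with t ht
    rw [chartMetric_apply, ht.2, ← ht.1]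
  -- time derivative
  have htime : (fun y => fderiv ℝ Θ (0, y) (1, 0)) =ᶠ[𝓝 c] X := by
    filter_upwards [hX, extChartAt_target_mem_nhds_of_mem hct] with y hXy hy
    have hys := (extChartAt I x).map_target hy
    rw [hXy, ← fderiv_comp_prodMk_left ((hΘs 0 y hy (by rwa [h0])).differentiableAt (by simp))]
    have a3 : MDifferentiableAt I 𝓘(ℝ, E) (extChartAt I x) (θ 0 ((extChartAt I x).symm y)) :=
      mdifferentiableAt_extChartAt (by rw [h0]; rwa [extChartAt_source] at hys)
    have h1 : HasFDerivAt (fun t => Θ (t, y))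
        ((chartDeriv I x (θ 0 ((extChartAt I x).symm y))).comp
          (ContinuousLinearMap.smulRight (1 : ℝ →L[ℝ] ℝ)
            (v (θ 0 ((extChartAt I x).symm y)) : E))) 0 :=
      (a3.hasMFDerivAt.comp (0 : ℝ) (hv ((extChartAt I x).symm y) 0)).hasFDerivAt
    rw [h1.fderiv, h0]
    change chartDeriv I x ((extChartAt I x).symm y)
      ((1 : ℝ) • (v ((extChartAt I x).symm y) : E)) = _
    rw [one_smul]
  have hD : ContDiffAt ℝ ∞ (fderiv ℝ Θ) (0, c) := hΘ0.fderiv_right (by simp)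
  have hP : HasDerivAt (fun t => fderiv ℝ Θ (t, c) (0, η)) (fderiv ℝ X c η) 0 := by
    have h4 : ContDiffAt ℝ ∞ (fun t => fderiv ℝ Θ (t, c) (0, η)) 0 :=
      (hD.comp 0 (contDiffAt_id.prodMk contDiffAt_const)).clm_apply contDiffAt_const
    refine (h4.differentiableAt (by simp)).hasDerivAt.congr_deriv ?_
    rw [← fderiv_apply_one_eq_deriv, fderiv_fderiv_comm hΘ0, htime.fderiv_eq]
  have hP0 : fderiv ℝ Θ (0, c) (0, η) = η := by
    rw [← fderiv_comp_prodMk_right (hΘ0.differentiableAt (by simp))]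
    have : (fun y => Θ (0, y)) =ᶠ[𝓝 c] id := by
      filter_upwards [extChartAt_target_mem_nhds_of_mem hct] with y hy using hΘ0c y hy
    rw [this.fderiv_eq, fderiv_id]
    rfl
  have hT : HasDerivAt (fun t => Θ (t, c)) (X c) 0 := by
    have h5 : DifferentiableAt ℝ (fun t => Θ (t, c)) 0 :=
      (hΘ0.comp (0 : ℝ) (contDiffAt_id.prodMk contDiffAt_const)).differentiableAt (by simp)
    refine h5.hasDerivAt.congr_deriv ?_
    rw [← fderiv_apply_one_eq_deriv, fderiv_comp_prodMk_left (hΘ0.differentiableAt (by simp))]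
    exact htime.self_of_nhds
  have hG : HasDerivAt (fun t => chartMetric g x (Θ (t, c)))
      (fderiv ℝ (chartMetric g x) c (X c)) 0 := by
    have h6 : HasFDerivAt (chartMetric g x) (fderiv ℝ (chartMetric g x) c) (Θ (0, c)) := by
      rw [hΘ0c c hct]
      exact ((contDiffAt_chartMetric g x).differentiableAt (by simp)).hasFDerivAt
    exact h6.comp_hasDerivAt 0 hT
  have hfin := (hG.clm_apply hP).clm_apply hP
  refine (hfin.congr_of_eventuallyEq heq).congr_deriv ?_
  simp only [hP0, hΘ0c c hct, add_apply]
  rw [chartMetric_symm g x c η]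
  ring

end UnitGradient

section GradientFlow

variable {E : Type*} [NormedAddCommGroup E] [NormedSpace ℝ E] [FiniteDimensional ℝ E]
  {H : Type*} [TopologicalSpace H] {I : ModelWithCorners ℝ E H} [I.Boundaryless]
  {M : Type*} [TopologicalSpace M] [ChartedSpace H M] [IsManifold I ∞ M]

/-- `h` has no critical point, its Hessian is `φ g`, and `θ` is the flow of its unit gradient. -/
structure IsConformalFlow (g : SmoothMetric I M) (h φ : M → ℝ) (θ : ℝ → M → M) : Prop where
  smooth : ContMDiff I 𝓘(ℝ, ℝ) ∞ h
  ne_zero : ∀ p, differential I h p ≠ 0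
  hess : ∀ (x : M) (u v : E), hessianForm g h x u v = φ x * g.form x u v
  flow_smooth : ContMDiff (𝓘(ℝ, ℝ).prod I) I ∞ (fun p : ℝ × M => θ p.1 p.2)
  flow_zero : ∀ x, θ 0 x = x
  flow_add : ∀ s t x, θ (s + t) x = θ s (θ t x)
  flow_curve : ∀ x, IsMIntegralCurve (fun t => θ t x) (unitGradient g h)

/-- The unit gradient of a function without critical points on a complete manifold has a global
flow. -/
theorem exists_isConformalFlow [T2Space M] (g : SmoothMetric I M) (hg : IsCompleteMetric g)
    {h φ : M → ℝ} (hh : ContMDiff I 𝓘(ℝ, ℝ) ∞ h) (hne : ∀ p, differential I h p ≠ 0)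
    (hess : ∀ (x : M) (u v : E), hessianForm g h x u v = φ x * g.form x u v) :
    ∃ θ, IsConformalFlow g h φ θ := by
  have hv := contMDiff_unitGradient g hh hne
  choose γ hγ0 hγ using exists_isMIntegralCurve_of_isCompleteMetric hv g hg zero_le_one
    (fun x => by
      rw [one_pow]
      exact (form_unitGradientVec_self g (hne x)).le)
  exact ⟨fun t x => γ x t, hh, hne, hess, contMDiff_flow hv hγ0 hγ, hγ0,
    flow_add hv (θ := fun t x => γ x t) hγ0 hγ, hγ⟩

namespace IsConformalFlow

variable {g : SmoothMetric I M} {h φ : M → ℝ} {θ : ℝ → M → M}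

theorem contMDiff_norm (hc : IsConformalFlow g h φ θ) :
    ContMDiff I 𝓘(ℝ, ℝ) ∞ (gradientNorm g h) := contMDiff_gradientNorm g hc.smooth hc.ne_zero

theorem norm_pos (hc : IsConformalFlow g h φ θ) (x : M) : 0 < gradientNorm g h x :=
  gradientNorm_pos g (hc.ne_zero x)

theorem hasDerivAt (hc : IsConformalFlow g h φ θ) (t : ℝ) (x : M) :
    HasDerivAt (fun t => h (θ t x)) (gradientNorm g h (θ t x)) t :=
  ((hc.flow_curve x).hasDerivAt_comp hc.smooth t).congr_deriv
    (differential_unitGradientVec g (hc.ne_zero (θ t x)))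

theorem differential_norm (hc : IsConformalFlow g h φ θ) (x : M) (ξ : E) :
    differential I (gradientNorm g h) x ξ =
      φ x / gradientNorm g h x * differential I h x ξ := by
  have h1 := gradientNorm_mul_differential g hc.smooth hc.ne_zero hc.hess x ξ
  have := (hc.norm_pos x).ne'
  rw [div_mul_eq_mul_div, ← h1]
  field_simp

theorem hasDerivAt_norm (hc : IsConformalFlow g h φ θ) (t : ℝ) (x : M) :
    HasDerivAt (fun t => gradientNorm g h (θ t x)) (φ (θ t x)) t := by
  refine ((hc.flow_curve x).hasDerivAt_comp hc.contMDiff_norm t).congr_deriv ?_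
  have h1 := hc.differential_norm (θ t x) (unitGradientVec g h (θ t x))
  rw [differential_unitGradientVec g (hc.ne_zero _)] at h1
  refine h1.trans ?_
  have := (hc.norm_pos (θ t x)).ne'
  field_simp

/-- The one-form `dh / |∇h|` is invariant under the flow. -/
theorem differential_comp_flow (hc : IsConformalFlow g h φ θ) (t : ℝ) (x : M) (ξ : E) :
    differential I (fun x => h (θ t x)) x ξ =
      gradientNorm g h (θ t x) / gradientNorm g h x * differential I h x ξ := by
  have hd : ∀ t, HasDerivAt (fun t => differential I (fun x => h (θ t x)) x ξ /
      gradientNorm g h (θ t x)) 0 t := by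
    intro t
    have h1 := (hasDerivAt_differential_comp_flow hc.flow_smooth hc.smooth hc.contMDiff_norm
      hc.hasDerivAt x ξ t).div (hc.hasDerivAt_norm t x) (hc.norm_pos _).ne'
    refine h1.congr_deriv ?_
    have h2 := (hc.norm_pos (θ t x)).ne'
    rw [differential_comp_map hc.contMDiff_norm (contMDiff_flow_map hc.flow_smooth t),
      hc.differential_norm, ← differential_comp_map hc.smooth (contMDiff_flow_map hc.flow_smooth t)]
    field_simp
    ring
  have h3 := is_const_of_deriv_eq_zero (fun t => (hd t).differentiableAt) (fun t => (hd t).deriv)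
    t 0
  simp only [hc.flow_zero] at h3
  rw [div_eq_iff (hc.norm_pos _).ne'] at h3
  rw [h3]
  ring

theorem mapDeriv_add (hc : IsConformalFlow g h φ θ) (s t : ℝ) (x : M) (η : E) :
    mapDeriv I (θ (s + t)) x η = mapDeriv I (θ s) (θ t x) (mapDeriv I (θ t) x η) := by
  have h1 : θ (s + t) = θ s ∘ θ t := funext fun x => hc.flow_add s t x
  rw [h1]
  exact congrArg (fun A : E →L[ℝ] E => A η) (mfderiv_comp (I' := I) x
    ((contMDiff_flow_map hc.flow_smooth s).mdifferentiable (by simp) _)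
    ((contMDiff_flow_map hc.flow_smooth t).mdifferentiable (by simp) _))

theorem mapDeriv_zero (hc : IsConformalFlow g h φ θ) (x : M) (η : E) :
    mapDeriv I (θ 0) x η = η := by
  have h1 : θ 0 = id := funext hc.flow_zero
  rw [h1]
  exact congrArg (fun A : E →L[ℝ] E => A η) (mfderiv_id (I := I) (x := x))

theorem hasDerivAt_form_zero (hc : IsConformalFlow g h φ θ) {x : M} {η : E}
    (hη : differential I h x η = 0) :
    HasDerivAt (fun t => g.form (θ t x) (mapDeriv I (θ t) x η) (mapDeriv I (θ t) x η))
      (2 * (φ x / gradientNorm g h x) * g.form x η η) 0 := by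
  set c := extChartAt I x x with hcdef
  have hct : c ∈ (extChartAt I x).target := mem_extChartAt_target x
  have hwi := hc.contMDiff_norm.inv_of_pos hc.norm_pos
  have hm := isMetricAt_chartMetric g x
  have hk := contDiffAt_comp_extChartAt_symm hc.smooth hct
  set X : E → E := fun y => (gradientNorm g h ((extChartAt I x).symm y))⁻¹ •
    coordGradient (chartMetric g x) (h ∘ (extChartAt I x).symm) y with hX
  have h1 := hasDerivAt_form_flow g hc.flow_smooth hc.flow_zero hc.flow_curve x η (X := X) (by
    filter_upwards [extChartAt_target_mem_nhds_of_mem hct] with y hy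
    have h2 : chartDeriv I x ((extChartAt I x).symm y)
        (unitGradientVec g h ((extChartAt I x).symm y)) = X y := by
      rw [unitGradientVec, map_smul, ← chartSymmDeriv_coordGradient g hc.smooth hy,
        chartDeriv_comp_chartSymmDeriv hy]
    exact h2.symm)
  refine h1.congr_deriv ?_
  have hXd : fderiv ℝ X c η = (gradientNorm g h x)⁻¹ •
      fderiv ℝ (coordGradient (chartMetric g x) (h ∘ (extChartAt I x).symm)) c η := by
    have d1 := hasFDerivAt_comp_extChartAt_symm hwi x
    have d2 := ((hm.contDiffAt_coordGradient hk).differentiableAt (by simp)).hasFDerivAt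
    have d3 : HasFDerivAt X _ c := d1.smul d2
    have d4 : differential I (fun x => (gradientNorm g h x)⁻¹) x η = 0 := by
      rw [differential_comp hc.contMDiff_norm hwi (hasDerivAt_inv (hc.norm_pos x).ne'), smul_apply,
        hc.differential_norm, hη, mul_zero, smul_zero]
    rw [d3.fderiv]
    simp only [add_apply, smul_apply, ContinuousLinearMap.smulRight_apply, d4, zero_smul, add_zero,
      Function.comp_apply, hcdef, extChartAt_to_inv]
  have hXc : X c = (gradientNorm g h x)⁻¹ •
      coordGradient (chartMetric g x) (h ∘ (extChartAt I x).symm) c := by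
    simp only [hX, hcdef, extChartAt_to_inv]
  have hH := hm.coordHessian_self_eq hk η
  rw [← hessianForm_eq, hc.hess] at hH
  rw [hXd, hXc]
  simp only [map_smul, smul_apply, smul_eq_mul]
  rw [div_eq_mul_inv]
  linear_combination (-2) * (gradientNorm g h x)⁻¹ * hH

/-- The flow stretches vectors tangent to the level sets by the ratio of the gradient norms. -/
theorem form_flow_eq (hc : IsConformalFlow g h φ θ) (t : ℝ) {x : M} {η : E}
    (hη : differential I h x η = 0) :
    g.form (θ t x) (mapDeriv I (θ t) x η) (mapDeriv I (θ t) x η) =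
      (gradientNorm g h (θ t x) / gradientNorm g h x) ^ 2 * g.form x η η := by
  set a : ℝ → ℝ := fun t => g.form (θ t x) (mapDeriv I (θ t) x η) (mapDeriv I (θ t) x η) with ha
  have hker : ∀ t, differential I h (θ t x) (mapDeriv I (θ t) x η) = 0 := by
    intro t
    rw [← differential_comp_map hc.smooth (contMDiff_flow_map hc.flow_smooth t),
      hc.differential_comp_flow, hη, mul_zero]
  have ha' : ∀ t, HasDerivAt a (2 * (φ (θ t x) / gradientNorm g h (θ t x)) * a t) t := by
    intro t
    have h1 := hc.hasDerivAt_form_zero (hker t)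
    have h2 : HasDerivAt (fun s : ℝ => s - t) 1 t := (hasDerivAt_id t).sub_const t
    have h3 := HasDerivAt.comp t (by rw [sub_self]; exact h1) h2
    rw [mul_one] at h3
    refine h3.congr_of_eventuallyEq (Eventually.of_forall fun s => ?_)
    simp only [Function.comp, ha]
    rw [← hc.mapDeriv_add, ← hc.flow_add, sub_add_cancel]
  have hd : ∀ t, HasDerivAt (fun t => a t / gradientNorm g h (θ t x) ^ 2) 0 t := by
    intro t
    have h2 := (hc.norm_pos (θ t x)).ne'
    refine ((ha' t).div ((hc.hasDerivAt_norm t x).pow 2) (pow_ne_zero 2 h2)).congr_deriv ?_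
    simp only [Pi.pow_apply]
    field_simp
    ring
  have h3 := is_const_of_deriv_eq_zero (fun t => (hd t).differentiableAt) (fun t => (hd t).deriv)
    t 0
  simp only [ha, hc.flow_zero, hc.mapDeriv_zero] at h3
  rw [div_eq_iff (pow_ne_zero 2 (hc.norm_pos _).ne')] at h3
  rw [h3]
  ring

end IsConformalFlow

end GradientFlow

section SliceCoordinates

variable {E : Type*} [NormedAddCommGroup E] [NormedSpace ℝ E] [FiniteDimensional ℝ E]
  {E' : Type*} [NormedAddCommGroup E'] [NormedSpace ℝ E'] [FiniteDimensional ℝ E']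

/-- A nonzero linear form can be completed to a linear coordinate system. -/
theorem exists_equiv_prod_fst_eq (hdim : Module.finrank ℝ E = Module.finrank ℝ E' + 1)
    {ℓ : E →L[ℝ] ℝ} (hℓ : ℓ ≠ 0) : ∃ L : E ≃L[ℝ] ℝ × E', ∀ v, (L v).1 = ℓ v := by
  obtain ⟨e, he⟩ : ∃ e, ℓ e = 1 := by
    obtain ⟨v, hv⟩ : ∃ v, ℓ v ≠ 0 := by
      by_contra! hcon
      exact hℓ (ContinuousLinearMap.ext hcon)
    exact ⟨(ℓ v)⁻¹ • v, by simp [hv]⟩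
  have hk : Module.finrank ℝ (LinearMap.ker (ℓ : E →ₗ[ℝ] ℝ)) = Module.finrank ℝ E' := by
    have h1 := LinearMap.finrank_range_add_finrank_ker (ℓ : E →ₗ[ℝ] ℝ)
    have h2 : LinearMap.range (ℓ : E →ₗ[ℝ] ℝ) = ⊤ := by
      rw [LinearMap.range_eq_top]
      exact fun s => ⟨s • e, by simp [he]⟩
    rw [h2, finrank_top, Module.finrank_self] at h1
    omega
  let K : LinearMap.ker (ℓ : E →ₗ[ℝ] ℝ) ≃ₗ[ℝ] E' := LinearEquiv.ofFinrankEq _ _ hk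
  let T : E →ₗ[ℝ] ℝ × E' := (ℓ : E →ₗ[ℝ] ℝ).prod (K.toLinearMap ∘ₗ
    LinearMap.codRestrict (LinearMap.ker (ℓ : E →ₗ[ℝ] ℝ))
      (LinearMap.id - (ℓ : E →ₗ[ℝ] ℝ).smulRight e) (fun v => by simp [he]))
  have hT : Function.Injective T := by
    rw [← LinearMap.ker_eq_bot, LinearMap.ker_eq_bot']
    intro v hv
    have h1 : ℓ v = 0 := congrArg Prod.fst hv
    have h2 := congrArg Prod.snd hv
    have h3 := K.injective (h2.trans K.map_zero.symm)
    have h4 : v - ℓ v • e = 0 := congrArg Subtype.val h3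
    simpa [h1] using h4
  exact ⟨(LinearEquiv.ofInjectiveOfFinrankEq T hT (by
    rw [hdim, Module.finrank_prod, Module.finrank_self, add_comm])).toContinuousLinearEquiv,
    fun v => rfl⟩

theorem exists_openPartialHomeomorph_fst_eq
    (hdim : Module.finrank ℝ E = Module.finrank ℝ E' + 1) {k : E → ℝ} {U : Set E} (hU : IsOpen U)
    (hk : ContDiffOn ℝ ∞ k U) {c : E} (hc : c ∈ U) (hne : fderiv ℝ k c ≠ 0) :
    ∃ e : OpenPartialHomeomorph E (ℝ × E'), c ∈ e.source ∧ e.source ⊆ U ∧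
      (∀ y, (e y).1 = k y) ∧ ContDiffOn ℝ ∞ e e.source ∧ ContDiffOn ℝ ∞ e.symm e.target := by
  obtain ⟨L, hL⟩ := exists_equiv_prod_fst_eq hdim hne
  set F : E → ℝ × E' := fun y => (k y, (L y).2) with hF
  have hFs : ∀ y ∈ U, ContDiffAt ℝ ∞ F y := fun y hy =>
    (hk.contDiffAt (hU.mem_nhds hy)).prodMk (contDiff_snd.comp L.contDiff).contDiffAt
  have hFc : HasFDerivAt F (L : E →L[ℝ] ℝ × E') c := by
    have h1 := (((hFs c hc).fst).differentiableAt (by simp)).hasFDerivAt.prodMk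
      ((ContinuousLinearMap.snd ℝ ℝ E').hasFDerivAt.comp c L.hasFDerivAt)
    refine h1.congr_fderiv ?_
    ext v
    · exact (hL v).symm
    · rfl
  have hFd : ContinuousOn (fderiv ℝ F) U := fun y hy =>
    (((hFs y hy).fderiv_right (m := ∞) (by simp)).continuousAt).continuousWithinAt
  set V : Set E := U ∩ fderiv ℝ F ⁻¹' range ((↑) : (E ≃L[ℝ] ℝ × E') → E →L[ℝ] ℝ × E') with hV
  have hVo : IsOpen V := hFd.isOpen_inter_preimage hU (ContinuousLinearEquiv.isOpen)
  have hcV : c ∈ V := ⟨hc, L, hFc.fderiv.symm⟩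
  set e₀ := (hFs c hc).toOpenPartialHomeomorph F hFc (by simp) with he₀
  have he : ∀ y, e₀ y = F y := fun y => rfl
  refine ⟨e₀.restrOpen V hVo, ?_, ?_, fun y => rfl, ?_, ?_⟩
  · rw [OpenPartialHomeomorph.restrOpen_source]
    exact ⟨(hFs c hc).mem_toOpenPartialHomeomorph_source hFc (by simp), hcV⟩
  · rw [OpenPartialHomeomorph.restrOpen_source]
    exact fun y hy => hy.2.1
  · rw [OpenPartialHomeomorph.restrOpen_source]
    exact fun y hy => (hFs y hy.2.1).contDiffWithinAt
  · intro a ha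
    have h1 := (e₀.restrOpen V hVo).map_target ha
    rw [OpenPartialHomeomorph.restrOpen_source] at h1
    obtain ⟨L', hL'⟩ := h1.2.2
    refine ((e₀.restrOpen V hVo).contDiffAt_symm (f₀' := L') ha ?_ ?_).contDiffWithinAt
    · rw [hL']
      exact ((hFs _ h1.2.1).differentiableAt (by simp)).hasFDerivAt
    · exact hFs _ h1.2.1

variable {M : Type*} [TopologicalSpace M] [ChartedSpace E M] [IsManifold 𝓘(ℝ, E) ∞ M]

/-- A smooth coordinate system whose first coordinate is `h`. -/
structure IsSliceChart (h : M → ℝ) (e : OpenPartialHomeomorph M (ℝ × E')) : Prop where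
  fst_eq : ∀ x ∈ e.source, (e x).1 = h x
  smooth : ContMDiffOn 𝓘(ℝ, E) 𝓘(ℝ, ℝ × E') ∞ e e.source
  smooth_symm : ContMDiffOn 𝓘(ℝ, ℝ × E') 𝓘(ℝ, E) ∞ e.symm e.target

theorem exists_isSliceChart (hdim : Module.finrank ℝ E = Module.finrank ℝ E' + 1) {h : M → ℝ}
    (hh : ContMDiff 𝓘(ℝ, E) 𝓘(ℝ, ℝ) ∞ h) {p : M} (hp : differential 𝓘(ℝ, E) h p ≠ 0) :
    ∃ e : OpenPartialHomeomorph M (ℝ × E'), p ∈ e.source ∧ IsSliceChart (E := E) h e := by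
  obtain ⟨e, hpe, heU, hfst, hes, hes'⟩ := exists_openPartialHomeomorph_fst_eq (E' := E') hdim
    (k := h ∘ (chartAt E p).symm) (chartAt E p).open_target
    (contMDiffOn_iff_contDiffOn.1 (hh.comp_contMDiffOn (contMDiffOn_chart_symm (x := p))))
    (mem_chart_target E p) (by
      rw [differential_eq_fderiv hh] at hp
      exact hp)
  refine ⟨(chartAt E p).trans e, ?_, ?_, ?_, ?_⟩
  · rw [OpenPartialHomeomorph.trans_source]
    exact ⟨mem_chart_source E p, hpe⟩
  · intro x hx
    rw [OpenPartialHomeomorph.trans_source] at hx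
    change (e (chartAt E p x)).1 = h x
    rw [hfst, Function.comp_apply, (chartAt E p).left_inv hx.1]
  · rw [OpenPartialHomeomorph.trans_source]
    exact (contMDiffOn_iff_contDiffOn.2 hes).comp
      ((contMDiffOn_chart (x := p)).mono inter_subset_left) (fun x hx => hx.2)
  · rw [OpenPartialHomeomorph.trans_target]
    exact (contMDiffOn_chart_symm (x := p)).comp
      ((contMDiffOn_iff_contDiffOn.2 hes').mono inter_subset_left) (fun x hx => hx.2)

/-- A function whose differential is a multiple of `dh` is constant on the level sets of `h`,
locally and with a neighbourhood independent of the function. -/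
theorem IsSliceChart.exists_nhds_eq_of_level_eq {h : M → ℝ} {e : OpenPartialHomeomorph M (ℝ × E')}
    (he : IsSliceChart (E := E) h e) (hh : ContMDiff 𝓘(ℝ, E) 𝓘(ℝ, ℝ) ∞ h) {p : M}
    (hp : p ∈ e.source) : ∃ W ∈ 𝓝 p, ∀ k : M → ℝ, ContMDiff 𝓘(ℝ, E) 𝓘(ℝ, ℝ) ∞ k →
      (∀ x, ∃ κ : ℝ, differential 𝓘(ℝ, E) k x = κ • differential 𝓘(ℝ, E) h x) →
      ∀ q ∈ W, h q = h p → k q = k p := by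
  obtain ⟨δ, hδ, hball⟩ := Metric.isOpen_iff.1 e.open_target _ (e.map_source hp)
  refine ⟨e.source ∩ e ⁻¹' Metric.ball (e p) δ, Filter.inter_mem (e.open_source.mem_nhds hp)
    ((e.continuousAt hp).preimage_mem_nhds (Metric.ball_mem_nhds _ hδ)), ?_⟩
  rintro k hk hκ q ⟨hqs, hqb⟩ hq
  have hmem : ∀ v ∈ Metric.ball (e p).2 δ, (h p, v) ∈ e.target := by
    intro v hv
    apply hball
    rw [← ball_prod_same, ← he.fst_eq p hp]
    exact ⟨Metric.mem_ball_self hδ, hv⟩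
  set σ : E' → M := fun v => e.symm (h p, v) with hσ
  have hσs : ∀ v ∈ Metric.ball (e p).2 δ, MDifferentiableAt 𝓘(ℝ, E') 𝓘(ℝ, E) σ v := by
    intro v hv
    have h1 : ContMDiffAt 𝓘(ℝ, ℝ × E') 𝓘(ℝ, E) ∞ e.symm (h p, v) :=
      he.smooth_symm.contMDiffAt (e.open_target.mem_nhds (hmem v hv))
    have h2 : ContMDiffAt 𝓘(ℝ, E') 𝓘(ℝ, ℝ × E') ∞ (fun v => (h p, v)) v :=
      (contDiffAt_const.prodMk contDiffAt_id).contMDiffAt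
    exact (h1.comp v h2).mdifferentiableAt (by simp)
  have hder : ∀ v ∈ Metric.ball (e p).2 δ, ∃ S : E' →L[ℝ] E,
      ∀ l : M → ℝ, ContMDiff 𝓘(ℝ, E) 𝓘(ℝ, ℝ) ∞ l →
        HasFDerivAt (l ∘ σ) ((differential 𝓘(ℝ, E) l (σ v)).comp S) v := fun v hv =>
    ⟨mfderiv 𝓘(ℝ, E') 𝓘(ℝ, E) σ v, fun l hl =>
      ((hl.mdifferentiable (by simp) _).hasMFDerivAt.comp v (hσs v hv).hasMFDerivAt).hasFDerivAt⟩
  have hzero : ∀ v ∈ Metric.ball (e p).2 δ, HasFDerivAt (k ∘ σ) (0 : E' →L[ℝ] ℝ) v := by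
    intro v hv
    obtain ⟨S, hS⟩ := hder v hv
    have h1 := hS h hh
    have h2 : h ∘ σ =ᶠ[𝓝 v] fun _ => h p := by
      filter_upwards [Metric.isOpen_ball.mem_nhds hv] with v' hv'
      have h3 := he.fst_eq _ (e.map_target (hmem v' hv'))
      rw [e.right_inv (hmem v' hv')] at h3
      exact h3.symm
    have h4 := h1.unique ((hasFDerivAt_const (h p) v).congr_of_eventuallyEq h2)
    obtain ⟨κ, hκv⟩ := hκ (σ v)
    refine (hS k hk).congr_fderiv ?_
    rw [hκv]
    ext ξ
    have h5 := congrArg (fun A : E' →L[ℝ] ℝ => A ξ) h4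
    simp only [ContinuousLinearMap.comp_apply, zero_apply] at h5
    simp only [ContinuousLinearMap.comp_apply, smul_apply, h5, smul_zero, zero_apply]
  have hqb' : (e q).2 ∈ Metric.ball (e p).2 δ := by
    have := hqb
    rw [mem_preimage, ← ball_prod_same] at this
    exact this.2
  have hfin := Metric.isOpen_ball.is_const_of_fderiv_eq_zero
    (convex_ball (e p).2 δ).isPreconnected
    (fun v hv => (hzero v hv).differentiableAt.differentiableWithinAt)
    (fun v hv => (hzero v hv).fderiv) hqb' (Metric.mem_ball_self hδ)
  have e1 : σ (e q).2 = q := by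
    simp only [hσ]
    rw [← hq, ← he.fst_eq q hqs]
    exact e.left_inv hqs
  have e2 : σ (e p).2 = p := by
    simp only [hσ]
    rw [← he.fst_eq p hp]
    exact e.left_inv hp
  rwa [Function.comp_apply, Function.comp_apply, e1, e2] at hfin

end SliceCoordinates

section Height

variable {E : Type*} [NormedAddCommGroup E] [NormedSpace ℝ E] [FiniteDimensional ℝ E]
  {E' : Type*} [NormedAddCommGroup E'] [NormedSpace ℝ E'] [FiniteDimensional ℝ E']
  {M : Type*} [TopologicalSpace M] [ChartedSpace E M] [IsManifold 𝓘(ℝ, E) ∞ M]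
  {g : SmoothMetric 𝓘(ℝ, E) M} {h φ : M → ℝ} {θ : ℝ → M → M}

namespace IsConformalFlow

theorem contMDiff_comp_flow (hc : IsConformalFlow g h φ θ) (t : ℝ) :
    ContMDiff 𝓘(ℝ, E) 𝓘(ℝ, ℝ) ∞ (fun x => h (θ t x)) :=
  hc.smooth.comp (contMDiff_flow_map hc.flow_smooth t)

theorem strictMono (hc : IsConformalFlow g h φ θ) (x : M) : StrictMono (fun t => h (θ t x)) :=
  strictMono_of_deriv_pos fun t => by
    rw [(hc.hasDerivAt t x).deriv]
    exact hc.norm_pos _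

theorem contDiff_profile (hc : IsConformalFlow g h φ θ) (x : M) :
    ContDiff ℝ ∞ (fun t => h (θ t x)) :=
  contMDiff_iff_contDiff.1 (hc.smooth.comp (hc.flow_smooth.comp
    (contMDiff_id.prodMk contMDiff_const)))

/-- Nearby flow lines have the same profile, up to a shift of time. -/
theorem eventually_exists_shift (hc : IsConformalFlow g h φ θ)
    (hdim : Module.finrank ℝ E = Module.finrank ℝ E' + 1) (p : M) :
    ∀ᶠ b in 𝓝 p, ∃ s, ∀ t, h (θ t p) = h (θ (t + s) b) := by
  obtain ⟨e, hpe, he⟩ := exists_isSliceChart (E' := E') hdim hc.smooth (hc.ne_zero p)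
  obtain ⟨W, hW, hlevel⟩ := he.exists_nhds_eq_of_level_eq hc.smooth hpe
  have hcont : ContinuousAt (fun q : ℝ × M => θ q.1 q.2) (0, p) :=
    hc.flow_smooth.continuous.continuousAt
  have h1 : ∀ᶠ q in 𝓝 ((0 : ℝ), p), θ q.1 q.2 ∈ W :=
    hcont.preimage_mem_nhds (by simpa only [hc.flow_zero] using hW)
  rw [nhds_prod_eq, eventually_prod_iff] at h1
  obtain ⟨P, hP, Q, hQ, hPQ⟩ := h1
  obtain ⟨ε, hε, hεP⟩ := Metric.eventually_nhds_iff_ball.1 hP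
  have hcb : ∀ t, Continuous fun b => h (θ t b) := fun t => (hc.contMDiff_comp_flow t).continuous
  have hm := hc.strictMono p
  have hlow : h (θ (-(ε / 2)) p) < h p := by
    have := hm (show -(ε / 2) < 0 by linarith)
    simpa only [hc.flow_zero] using this
  have hup : h p < h (θ (ε / 2) p) := by
    have := hm (show 0 < ε / 2 by linarith)
    simpa only [hc.flow_zero] using this
  filter_upwards [hQ, (hcb (-(ε / 2))).continuousAt.eventually_lt continuousAt_const hlow,
    continuousAt_const.eventually_lt (hcb (ε / 2)).continuousAt hup] with b hb hb1 hb2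
  obtain ⟨s, hs, hsb⟩ := intermediate_value_Icc (by linarith : -(ε / 2) ≤ ε / 2)
    (hc.contDiff_profile b).continuous.continuousOn ⟨hb1.le, hb2.le⟩
  have hsP : P s := hεP s (by
    rw [Metric.mem_ball, Real.dist_eq, sub_zero, abs_lt]
    exact ⟨by linarith [hs.1], by linarith [hs.2]⟩)
  refine ⟨s, fun t => ?_⟩
  rw [hc.flow_add]
  refine (hlevel _ (hc.contMDiff_comp_flow t) (fun x => ?_) _ (hPQ hsP hb) hsb).symm
  exact ⟨_, ContinuousLinearMap.ext fun ξ => hc.differential_comp_flow t x ξ⟩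

theorem exists_shift [PreconnectedSpace M] (hc : IsConformalFlow g h φ θ)
    (hdim : Module.finrank ℝ E = Module.finrank ℝ E' + 1) (p b : M) :
    ∃ s, ∀ t, h (θ t p) = h (θ (t + s) b) := by
  refine PreconnectedSpace.induction₂' (fun p b : M => ∃ s, ∀ t, h (θ t p) = h (θ (t + s) b))
    (fun p => (hc.eventually_exists_shift hdim p).mono fun b hb => ⟨hb, ?_⟩) ⟨?_⟩ p b
  · obtain ⟨s, hs⟩ := hb
    exact ⟨-s, fun t => by rw [hs, neg_add_cancel_right]⟩
  · rintro a b c ⟨s, hs⟩ ⟨s', hs'⟩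
    exact ⟨s + s', fun t => by rw [hs, hs', add_assoc]⟩

/-- The signed distance to a level set of `h`: the length function is a function of it. -/
theorem exists_height [PreconnectedSpace M] [Nonempty M] (hc : IsConformalFlow g h φ θ)
    (hdim : Module.finrank ℝ E = Module.finrank ℝ E' + 1) :
    ∃ (r : M → ℝ) (w : ℝ → ℝ), ContMDiff 𝓘(ℝ, E) 𝓘(ℝ, ℝ) ∞ r ∧ ContDiff ℝ ∞ w ∧
      (∀ x, gradientNorm g h x = w (r x)) ∧ (∀ t x, r (θ t x) = t + r x) ∧
      ∀ x, differential 𝓘(ℝ, E) r x = (gradientNorm g h x)⁻¹ • differential 𝓘(ℝ, E) h x := by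
  obtain ⟨b⟩ := ‹Nonempty M›
  choose r hr using fun p => hc.exists_shift hdim p b
  set η : ℝ → ℝ := fun t => h (θ t b) with hη
  have hηs : ContDiff ℝ ∞ η := hc.contDiff_profile b
  have hinj : Function.Injective η := (hc.strictMono b).injective
  have hηd : ∀ t, HasDerivAt η (gradientNorm g h (θ t b)) t := fun t => hc.hasDerivAt t b
  have hhr : ∀ x, h x = η (r x) := by
    intro x
    have := hr x 0
    rwa [hc.flow_zero, zero_add] at this
  have hnorm : ∀ x, gradientNorm g h x = gradientNorm g h (θ (r x) b) := by
    intro x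
    have h1 := hc.hasDerivAt 0 x
    have h2 : HasDerivAt (fun t => h (θ t x)) (gradientNorm g h (θ (r x) b)) 0 := by
      have h3 : HasDerivAt η (gradientNorm g h (θ (r x) b)) (0 + r x) := by
        rw [zero_add]
        exact hηd _
      exact (h3.comp_add_const 0 (r x)).congr_of_eventuallyEq
        (Eventually.of_forall fun t => hr x t)
    have h4 := h1.unique h2
    rwa [hc.flow_zero] at h4
  have hrs : ContMDiff 𝓘(ℝ, E) 𝓘(ℝ, ℝ) ∞ r := by
    intro x
    have hd := (hηd (r x)).hasFDerivAt_equiv (hc.norm_pos _).ne'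
    have hη1 := hηs.contDiffAt (x := r x)
    have h1 := (hη1.hasStrictFDerivAt' hd (by simp)).eventually_right_inverse
    have h2 := hη1.to_localInverse hd (by simp)
    rw [← hhr] at h1 h2
    refine (h2.contMDiffAt.comp x (hc.smooth x)).congr_of_eventuallyEq ?_
    filter_upwards [hc.smooth.continuous.continuousAt.eventually h1] with y hy
    refine hinj ?_
    rw [← hhr]
    exact hy.symm
  refine ⟨r, fun t => gradientNorm g h (θ t b), hrs, ?_, hnorm, ?_, ?_⟩
  · exact contMDiff_iff_contDiff.1 (hc.contMDiff_norm.comp (hc.flow_smooth.comp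
      (contMDiff_id.prodMk contMDiff_const)))
  · intro t x
    refine hinj ?_
    rw [← hhr, hr x t]
  · intro x
    have h1 : h = fun x => η (r x) := funext hhr
    have h2 : differential 𝓘(ℝ, E) h x = gradientNorm g h (θ (r x) b) •
        differential 𝓘(ℝ, E) r x := by
      have := differential_comp hrs (φ := η) (h1 ▸ hc.smooth) (hηd (r x))
      rwa [← h1] at this
    rw [h2, hnorm, smul_smul, inv_mul_cancel₀ (hc.norm_pos _).ne', one_smul]

end IsConformalFlow

end Height

section LevelSet

variable {E : Type*} [NormedAddCommGroup E] [NormedSpace ℝ E] [FiniteDimensional ℝ E]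
  {E' : Type*} [NormedAddCommGroup E'] [NormedSpace ℝ E'] [FiniteDimensional ℝ E']
  {M : Type*} [TopologicalSpace M] [ChartedSpace E M] [IsManifold 𝓘(ℝ, E) ∞ M]
  {r : M → ℝ} {e : OpenPartialHomeomorph M (ℝ × E')} {c : ℝ}

theorem IsSliceChart.symm_level (he : IsSliceChart (E := E) r e) {v : E'}
    (hv : (c, v) ∈ e.target) : r (e.symm (c, v)) = c := by
  rw [← he.fst_eq _ (e.map_target hv), e.right_inv hv]

theorem IsSliceChart.apply_level (he : IsSliceChart (E := E) r e) {x : M} (hx : x ∈ e.source)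
    (hr : r x = c) : (c, (e x).2) = e x :=
  Prod.ext (by rw [he.fst_eq x hx, hr]) rfl

open Classical in
/-- The chart of a level set given by a slice chart of the ambient manifold. -/
def IsSliceChart.levelChart (he : IsSliceChart (E := E) r e) (p : {x // r x = c}) :
    OpenPartialHomeomorph {x // r x = c} E' where
  toFun y := (e y).2
  invFun v := if hv : (c, v) ∈ e.target then ⟨e.symm (c, v), he.symm_level hv⟩ else p
  source := {y | (y : M) ∈ e.source}
  target := {v | (c, v) ∈ e.target}
  map_source' y hy := by
    change (c, (e y).2) ∈ e.target
    rw [he.apply_level hy y.2]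
    exact e.map_source hy
  map_target' v hv := by
    rw [dif_pos (show (c, v) ∈ e.target from hv)]
    exact e.map_target hv
  left_inv' y hy := by
    have h1 := he.apply_level hy y.2
    have h2 : (c, (e y).2) ∈ e.target := by rw [h1]; exact e.map_source hy
    rw [dif_pos h2]
    refine Subtype.ext ?_
    change e.symm (c, (e y).2) = y
    rw [h1, e.left_inv hy]
  right_inv' v hv := by
    rw [dif_pos (show (c, v) ∈ e.target from hv)]
    change (e (e.symm (c, v))).2 = v
    rw [e.right_inv hv]
  open_source := e.open_source.preimage continuous_subtype_val
  open_target := e.open_target.preimage (by fun_prop)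
  continuousOn_toFun := continuous_snd.comp_continuousOn
    (e.continuousOn.comp continuous_subtype_val.continuousOn fun _ hy => hy)
  continuousOn_invFun := by
    rw [(show Topology.IsInducing (Subtype.val : {x // r x = c} → M) from ⟨rfl⟩).continuousOn_iff]
    have h1 : ContinuousOn (fun v => e.symm (c, v)) {v | (c, v) ∈ e.target} :=
      e.continuousOn_symm.comp (by fun_prop) fun _ hv => hv
    refine h1.congr fun v hv => ?_
    rw [Function.comp_apply, dif_pos (show (c, v) ∈ e.target from hv)]

theorem IsSliceChart.levelChart_apply (he : IsSliceChart (E := E) r e) (p y : {x // r x = c}) :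
    he.levelChart p y = (e y).2 := rfl

theorem IsSliceChart.coe_levelChart_symm (he : IsSliceChart (E := E) r e) (p : {x // r x = c})
    {v : E'} (hv : v ∈ (he.levelChart p).target) :
    ((he.levelChart p).symm v : M) = e.symm (c, v) :=
  congrArg Subtype.val (dif_pos (show (c, v) ∈ e.target from hv))

theorem IsSliceChart.contMDiffOn_symm_level (he : IsSliceChart (E := E) r e) :
    ContMDiffOn 𝓘(ℝ, E') 𝓘(ℝ, E) ∞ (fun v => e.symm (c, v)) {v | (c, v) ∈ e.target} :=
  he.smooth_symm.comp (contDiff_const.prodMk contDiff_id).contMDiff.contMDiffOn fun _ hv => hv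

theorem IsSliceChart.contMDiffOn_snd (he : IsSliceChart (E := E) r e) :
    ContMDiffOn 𝓘(ℝ, E) 𝓘(ℝ, E') ∞ (fun x => (e x).2) e.source :=
  (contDiff_snd.contMDiff (n := ∞)).comp_contMDiffOn he.smooth

/-- A regular level set is a manifold, embedded in the ambient one. -/
theorem exists_levelSet_manifold (hdim : Module.finrank ℝ E = Module.finrank ℝ E' + 1)
    (hr : ContMDiff 𝓘(ℝ, E) 𝓘(ℝ, ℝ) ∞ r) (hne : ∀ p, differential 𝓘(ℝ, E) r p ≠ 0) (c : ℝ) :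
    ∃ (_ : ChartedSpace E' {x // r x = c}) (_ : IsManifold 𝓘(ℝ, E') ∞ {x // r x = c}),
      ContMDiff 𝓘(ℝ, E') 𝓘(ℝ, E) ∞ (Subtype.val : {x // r x = c} → M) ∧
      ∀ F : M → {x // r x = c}, ContMDiff 𝓘(ℝ, E) 𝓘(ℝ, E) ∞ (fun x => (F x : M)) →
        ContMDiff 𝓘(ℝ, E) 𝓘(ℝ, E') ∞ F := by
  choose e hpe he using fun p => exists_isSliceChart (E' := E') hdim hr (hne p)
  let cs : ChartedSpace E' {x // r x = c} :=
    { atlas := range fun p : {x // r x = c} => (he p).levelChart p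
      chartAt := fun p => (he p).levelChart p
      mem_chart_source := fun p => hpe p
      chart_mem_atlas := fun p => mem_range_self p }
  have hchart : ∀ p : {x // r x = c}, chartAt E' p = (he p).levelChart p := fun _ => rfl
  have im : IsManifold 𝓘(ℝ, E') ∞ {x // r x = c} := by
    refine isManifold_of_contDiffOn _ _ _ ?_
    rintro _ _ ⟨p, rfl⟩ ⟨q, rfl⟩
    simp only [modelWithCornersSelf_coe, modelWithCornersSelf_coe_symm, Function.id_comp,
      Function.comp_id, preimage_id, range_id, inter_univ, OpenPartialHomeomorph.coe_trans,
      OpenPartialHomeomorph.trans_source, OpenPartialHomeomorph.symm_source]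
    rw [← contMDiffOn_iff_contDiffOn]
    have h1 : ContMDiffOn 𝓘(ℝ, E') 𝓘(ℝ, E') ∞ (fun v => (e q ((e p).symm (c, v))).2)
        ({v | (c, v) ∈ (e p).target} ∩ (fun v => (e p).symm (c, v)) ⁻¹' (e q).source) :=
      (he q).contMDiffOn_snd.comp ((he p).contMDiffOn_symm_level.mono inter_subset_left)
        fun _ hv => hv.2
    refine (h1.mono ?_).congr ?_
    · rintro v ⟨hv, hvq⟩
      refine ⟨hv, ?_⟩
      rw [mem_preimage, ← (he p).coe_levelChart_symm p hv]
      exact hvq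
    · rintro v ⟨hv, hvq⟩
      rw [Function.comp_apply, IsSliceChart.levelChart_apply, (he p).coe_levelChart_symm p hv]
  refine ⟨cs, im, ?_, ?_⟩
  · intro p
    have h1 : ContMDiffAt 𝓘(ℝ, E') 𝓘(ℝ, E') ∞ ((he p).levelChart p) p :=
      (contMDiffOn_chart (x := p)).contMDiffAt
        ((chartAt E' p).open_source.mem_nhds (mem_chart_source E' p))
    have ht : (he p).levelChart p p ∈ ((he p).levelChart p).target :=
      ((he p).levelChart p).map_source (hpe p)
    have h2 : ContMDiffAt 𝓘(ℝ, E') 𝓘(ℝ, E) ∞ (fun v => (e p).symm (c, v))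
        ((he p).levelChart p p) :=
      (he p).contMDiffOn_symm_level.contMDiffAt
        (((he p).levelChart p).open_target.mem_nhds ht)
    refine (h2.comp p h1).congr_of_eventuallyEq ?_
    filter_upwards [((he p).levelChart p).open_source.mem_nhds (hpe p)] with y hy
    have h3 := (he p).coe_levelChart_symm p (((he p).levelChart p).map_source hy)
    rw [((he p).levelChart p).left_inv hy] at h3
    exact h3
  · intro F hF x
    set p := F x with hp
    have hFc : Continuous F := 
      (show Topology.IsInducing (Subtype.val : {x // r x = c} → M) from ⟨rfl⟩).continuous_iff.2
        hF.continuous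
    have h1 : ContMDiffAt 𝓘(ℝ, E) 𝓘(ℝ, E') ∞ (fun x => (e p (F x)).2) x :=
      ContMDiffAt.comp x (g := fun y => (e p y).2)
        ((he p).contMDiffOn_snd.contMDiffAt ((e p).open_source.mem_nhds (hpe p))) (hF x)
    have h2 : ContMDiffAt 𝓘(ℝ, E') 𝓘(ℝ, E') ∞ ((he p).levelChart p).symm
        ((fun x => (e p (F x)).2) x) :=
      (contMDiffOn_chart_symm (x := p)).contMDiffAt
        ((chartAt E' p).open_target.mem_nhds (mem_chart_target E' p))
    refine (h2.comp x h1).congr_of_eventuallyEq ?_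
    filter_upwards [hFc.continuousAt.preimage_mem_nhds
      (((he p).levelChart p).open_source.mem_nhds (hpe p))] with y hy
    exact (((he p).levelChart p).left_inv hy).symm

end LevelSet

section Pullback

variable {E : Type*} [NormedAddCommGroup E] [NormedSpace ℝ E] [FiniteDimensional ℝ E]
  {H : Type*} [TopologicalSpace H] {I : ModelWithCorners ℝ E H} [I.Boundaryless]
  {M : Type*} [TopologicalSpace M] [ChartedSpace H M] [IsManifold I ∞ M]
  {E' : Type*} [NormedAddCommGroup E'] [NormedSpace ℝ E'] [FiniteDimensional ℝ E']
  {H' : Type*} [TopologicalSpace H'] {I' : ModelWithCorners ℝ E' H'}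
  {N : Type*} [TopologicalSpace N] [ChartedSpace H' N] [IsManifold I' ∞ N]

/-- The derivative of a map, as a linear map between the model spaces. -/
def modelDeriv (I' : ModelWithCorners ℝ E' H') (I : ModelWithCorners ℝ E H) (φ : N → M) (y : N) :
    E' →L[ℝ] E := mfderiv I' I φ y

/-- The multiple `s² φ^* g` of the metric induced by an immersion `φ`. -/
def SmoothMetric.scaledPullback (g : SmoothMetric I M) {φ : N → M} (hφ : ContMDiff I' I ∞ φ)
    (hinj : ∀ y, Function.Injective (modelDeriv I' I φ y)) {s : ℝ} (hs : 0 < s) :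
    SmoothMetric I' N where
  inner y := s ^ 2 • pullbackForm (I := I') g.inner φ y
  symm y v w := by
    simp only [smul_apply, pullbackForm_apply]
    rw [g.symm]
  pos y v hv := by
    have h1 : modelDeriv I' I φ y v ≠ 0 := fun h0 => hv (hinj y (h0.trans (map_zero _).symm))
    have h2 : 0 < g.form (φ y) (modelDeriv I' I φ y v) (modelDeriv I' I φ y v) :=
      g.form_pos _ h1
    exact mul_pos (pow_pos hs 2) h2
  isVonNBounded y := by
    have hB : Bornology.IsBounded {u : E | g.form (φ y) u u < 1} :=
      (NormedSpace.isVonNBounded_iff ℝ).1 (g.isVonNBounded (φ y))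
    set L : E' →L[ℝ] E := s • modelDeriv I' I φ y with hL
    have hLinj : Function.Injective L := fun v w hvw =>
      hinj y (smul_right_injective E hs.ne' hvw)
    obtain ⟨K, -, hK⟩ := (L : E' →ₗ[ℝ] E).exists_antilipschitzWith (LinearMap.ker_eq_bot.2 hLinj)
    refine (NormedSpace.isVonNBounded_iff ℝ (E := E')).2 ((hK.isBounded_preimage hB).subset ?_)
    intro v hv
    have h1 : s ^ 2 * g.form (φ y) (modelDeriv I' I φ y v) (modelDeriv I' I φ y v) < 1 := hv
    change g.form (φ y) (s • modelDeriv I' I φ y v) (s • modelDeriv I' I φ y v) < 1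
    simp only [map_smul, smul_apply, smul_eq_mul]
    linarith
  contMDiff := by
    have h1 := contMDiff_pullbackForm g.contMDiff hφ
    intro p
    have h1' := (contMDiffAt_form_iff _ p).1 (h1 p)
    rw [contMDiffAt_form_iff]
    have h2 : ContMDiffAt I' 𝓘(ℝ, ℝ) ∞ (fun _ : N => s ^ 2) p := contMDiffAt_const
    refine (h2.smul h1').congr_of_eventuallyEq (Eventually.of_forall fun x => ?_)
    ext v w
    rfl

theorem SmoothMetric.scaledPullback_form (g : SmoothMetric I M) {φ : N → M}
    (hφ : ContMDiff I' I ∞ φ) (hinj : ∀ y, Function.Injective (modelDeriv I' I φ y)) {s : ℝ}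
    (hs : 0 < s) (y : N) (v w : E') : (g.scaledPullback hφ hinj hs).form y v w =
      s ^ 2 * g.form (φ y) (modelDeriv I' I φ y v) (modelDeriv I' I φ y w) := rfl

/-- The metric induced on a closed embedded submanifold of a complete manifold is complete. -/
theorem SmoothMetric.isCompleteMetric_scaledPullback (g : SmoothMetric I M)
    (hg : IsCompleteMetric g) {φ : N → M} (hφ : ContMDiff I' I ∞ φ)
    (hinj : ∀ y, Function.Injective (modelDeriv I' I φ y)) {s : ℝ} (hs : 0 < s)
    (hcl : Topology.IsClosedEmbedding φ) : IsCompleteMetric (g.scaledPullback hφ hinj hs) := by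
  rw [isCompleteMetric_iff] at hg ⊢
  intro u hu
  have hle := metricEDist_map_le (g.scaledPullback hφ hinj hs) g hφ (C := s⁻¹) (inv_pos.2 hs)
    (fun x v => by
      change g.form (φ x) (modelDeriv I' I φ x v) (modelDeriv I' I φ x v) ≤
        s⁻¹ ^ 2 * (s ^ 2 * g.form (φ x) (modelDeriv I' I φ x v) (modelDeriv I' I φ x v))
      rw [← mul_assoc, ← mul_pow, inv_mul_cancel₀ hs.ne', one_pow, one_mul])
  obtain ⟨x, hx⟩ := hg (fun i => φ (u i)) (fun ε hε => by
    obtain ⟨K, hK⟩ := hu (ε / ENNReal.ofReal s⁻¹)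
      (ENNReal.div_pos hε.ne' ENNReal.ofReal_ne_top)
    refine ⟨K, fun i hi j hj => (hle _ _).trans_lt ?_⟩
    have h1 := hK i hi j hj
    rw [mul_comm]
    exact ENNReal.mul_lt_of_lt_div h1)
  obtain ⟨y, rfl⟩ : x ∈ range φ := hcl.isClosed_range.mem_of_tendsto hx
    (Eventually.of_forall fun i => mem_range_self _)
  exact ⟨y, hcl.isInducing.tendsto_nhds_iff.2 hx⟩

end Pullback

section Splitting

variable {E : Type*} [NormedAddCommGroup E] [NormedSpace ℝ E] [FiniteDimensional ℝ E]
  {E' : Type*} [NormedAddCommGroup E'] [NormedSpace ℝ E'] [FiniteDimensional ℝ E']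
  {M : Type u} [TopologicalSpace M] [ChartedSpace E M] [IsManifold 𝓘(ℝ, E) ∞ M]
  {g : SmoothMetric 𝓘(ℝ, E) M} {h φ : M → ℝ} {θ : ℝ → M → M}

theorem realLineMetric_form (t a b : ℝ) : (realLineMetric).form t a b = a * b := by
  change inner ℝ a b = a * b
  rw [real_inner_comm]
  simp

/-- The flow of the unit gradient identifies the manifold with a warped product over the line. -/
theorem IsConformalFlow.exists_splitting [T2Space M] [SecondCountableTopology M]
    [ConnectedSpace M] (hc : IsConformalFlow g h φ θ) (hg : IsCompleteMetric g)
    (hdim : Module.finrank ℝ E = Module.finrank ℝ E' + 1) :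
    ∃ (N : Type u) (_ : TopologicalSpace N) (_ : T2Space N) (_ : SecondCountableTopology N)
      (_ : ConnectedSpace N) (_ : ChartedSpace E' N) (_ : IsManifold 𝓘(ℝ, E') ∞ N)
      (gN : SmoothMetric 𝓘(ℝ, E') N) (w : ℝ → ℝ) (hw : ContMDiff 𝓘(ℝ, ℝ) 𝓘(ℝ, ℝ) ∞ w)
      (hwpos : ∀ r, 0 < w r) (Φ : (ℝ × N) ≃ₘ⟮𝓘(ℝ, ℝ).prod 𝓘(ℝ, E'), 𝓘(ℝ, E)⟯ M),
      IsCompleteMetric gN ∧ (∀ r y, gradientNorm g h (Φ (r, y)) = w r) ∧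
      ∀ (q : ℝ × N) (V W : ℝ × E'), g.form (Φ q)
        (modelDeriv (𝓘(ℝ, ℝ).prod 𝓘(ℝ, E')) 𝓘(ℝ, E) Φ q V)
        (modelDeriv (𝓘(ℝ, ℝ).prod 𝓘(ℝ, E')) 𝓘(ℝ, E) Φ q W) =
          (warpedProduct realLineMetric gN w hw hwpos).form q V W := by
  obtain ⟨r, w, hr, hw, hnorm, hrθ, hdr⟩ := hc.exists_height (E' := E') hdim
  have hdr0 : ∀ x (ξ : E), differential 𝓘(ℝ, E) r x ξ = 0 → differential 𝓘(ℝ, E) h x ξ = 0 := by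
    intro x ξ hx
    rw [hdr, smul_apply, smul_eq_mul] at hx
    exact (mul_eq_zero.1 hx).resolve_left (inv_ne_zero (hc.norm_pos x).ne')
  have hrne : ∀ p, differential 𝓘(ℝ, E) r p ≠ 0 := fun p h0 =>
    hc.ne_zero p (ContinuousLinearMap.ext fun ξ => hdr0 p ξ (by rw [h0]; rfl))
  have hwpos : ∀ t, 0 < w t := by
    intro t
    obtain ⟨x⟩ := (inferInstance : Nonempty M)
    have h1 := hc.norm_pos (θ (t - r x) x)
    rwa [hnorm, hrθ, sub_add_cancel] at h1
  obtain ⟨cs, im, hι, huniv⟩ := exists_levelSet_manifold (E' := E') hdim hr hrne 0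
  set ι : {x // r x = 0} → M := Subtype.val with hιdef
  set F : M → {x // r x = 0} := fun x => ⟨θ (-r x) x, by rw [hrθ, neg_add_cancel]⟩ with hF
  have hFs : ContMDiff 𝓘(ℝ, E) 𝓘(ℝ, E') ∞ F :=
    huniv F (hc.flow_smooth.comp (((contDiff_neg (𝕜 := ℝ)).contMDiff.comp hr).prodMk contMDiff_id))
  have hFι : ∀ y, F (ι y) = y := fun y => Subtype.ext (by
    simp only [hF, hιdef, y.2, neg_zero, hc.flow_zero])
  have hconn : ConnectedSpace {x // r x = 0} :=
    Function.Surjective.connectedSpace (fun y => ⟨ι y, hFι y⟩) hFs.continuous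
  have hinj : ∀ y, Function.Injective (modelDeriv 𝓘(ℝ, E') 𝓘(ℝ, E) ι y) := by
    intro y
    have h1 : (modelDeriv 𝓘(ℝ, E) 𝓘(ℝ, E') F (ι y)).comp (modelDeriv 𝓘(ℝ, E') 𝓘(ℝ, E) ι y) =
        ContinuousLinearMap.id ℝ E' := by
      have h2 := mfderiv_comp (I' := 𝓘(ℝ, E)) y (hFs.mdifferentiable (by simp) (ι y))
        (hι.mdifferentiable (by simp) y)
      rw [show F ∘ ι = id from funext hFι, mfderiv_id] at h2
      exact h2.symm
    exact Function.LeftInverse.injective (g := modelDeriv 𝓘(ℝ, E) 𝓘(ℝ, E') F (ι y)) fun v =>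
      congrArg (fun A : E' →L[ℝ] E' => A v) h1
  have hker : ∀ y (ξ : E'), differential 𝓘(ℝ, E) h (ι y) (modelDeriv 𝓘(ℝ, E') 𝓘(ℝ, E) ι y ξ) = 0 := by
    intro y ξ
    apply hdr0
    have h2 := mfderiv_comp (I' := 𝓘(ℝ, E)) y (hr.mdifferentiable (by simp) (ι y))
      (hι.mdifferentiable (by simp) y)
    rw [show r ∘ ι = fun _ => 0 from funext fun y => y.2, mfderiv_const] at h2
    exact (congrArg (fun A : E' →L[ℝ] ℝ => A ξ) h2).symm
  have hcl : Topology.IsClosedEmbedding ι :=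
    (isClosed_eq hr.continuous continuous_const).isClosedEmbedding_subtypeVal
  have hs : 0 < (w 0)⁻¹ := inv_pos.2 (hwpos 0)
  let Φ : (ℝ × {x // r x = 0}) ≃ₘ⟮𝓘(ℝ, ℝ).prod 𝓘(ℝ, E'), 𝓘(ℝ, E)⟯ M :=
    { toFun := fun q => θ q.1 (ι q.2)
      invFun := fun x => (r x, F x)
      left_inv := fun q => by
        have h1 : r (θ q.1 (q.2 : M)) = q.1 := by rw [hrθ, q.2.2, add_zero]
        refine Prod.ext h1 (Subtype.ext ?_)
        simp only [hF, h1, ← hc.flow_add, neg_add_cancel, hc.flow_zero, hιdef]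
      right_inv := fun x => by
        simp only [hF, hιdef, ← hc.flow_add, add_neg_cancel, hc.flow_zero]
      contMDiff_toFun := hc.flow_smooth.comp
        (contMDiff_fst.prodMk (hι.comp contMDiff_snd))
      contMDiff_invFun := hr.prodMk hFs }
  have hΦ : ∀ q, Φ q = θ q.1 (ι q.2) := fun q => rfl
  refine ⟨{x // r x = 0}, inferInstance, inferInstance,
    hcl.isEmbedding.secondCountableTopology, hconn, cs, im,
    g.scaledPullback hι hinj hs, w, contMDiff_iff_contDiff.2 hw, hwpos, Φ,
    g.isCompleteMetric_scaledPullback hg hι hinj hs hcl, ?_, ?_⟩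
  · intro t y
    rw [hΦ, hnorm, hrθ, y.2, add_zero]
  · rintro ⟨t, y⟩ V W
    set D := modelDeriv 𝓘(ℝ, E') 𝓘(ℝ, E) ι y with hD
    set J := mapDeriv 𝓘(ℝ, E) (θ t) (ι y) with hJ
    have hdΦ : ∀ V : ℝ × E', modelDeriv (𝓘(ℝ, ℝ).prod 𝓘(ℝ, E')) 𝓘(ℝ, E) Φ (t, y) V =
        V.1 • unitGradientVec g h (θ t (ι y)) + J (D V.2) := by
      intro V
      have h1 := mfderiv_prod_eq_add_apply (v := V) (Φ.contMDiff.mdifferentiable (by simp) (t, y))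
      have h2 := (hc.flow_curve (ι y) t).mfderiv
      have h3 := mfderiv_comp (I' := 𝓘(ℝ, E)) y
        ((contMDiff_flow_map hc.flow_smooth t).mdifferentiable (by simp) (ι y))
        (hι.mdifferentiable (by simp) y)
      refine h1.trans (congrArg₂ (fun a b : E => a + b) ?_ ?_)
      · exact congrArg (fun A : ℝ →L[ℝ] E => A V.1) h2
      · exact congrArg (fun A : E' →L[ℝ] E => A V.2) h3
    have hν := hc.ne_zero (θ t (ι y))
    have hcross : ∀ ξ : E', g.form (θ t (ι y)) (unitGradientVec g h (θ t (ι y))) (J (D ξ)) = 0 := by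
      intro ξ
      rw [form_unitGradientVec, hJ,
        ← differential_comp_map hc.smooth (contMDiff_flow_map hc.flow_smooth t),
        hc.differential_comp_flow, hker, mul_zero, mul_zero]
    have hdiag : ∀ ξ : E', g.form (θ t (ι y)) (J (D ξ)) (J (D ξ)) =
        (w t / w 0) ^ 2 * g.form (ι y) (D ξ) (D ξ) := by
      intro ξ
      rw [hJ, hc.form_flow_eq t (hker y ξ), hnorm, hnorm, hrθ, y.2, add_zero]
    have hpol : ∀ ξ ξ' : E', g.form (θ t (ι y)) (J (D ξ)) (J (D ξ')) =
        (w t / w 0) ^ 2 * g.form (ι y) (D ξ) (D ξ') := by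
      intro ξ ξ'
      have h1 := hdiag (ξ + ξ')
      simp only [map_add, add_apply, hdiag] at h1
      rw [g.form_symm _ (J (D ξ')) (J (D ξ)), g.form_symm _ (D ξ') (D ξ)] at h1
      linarith
    have hsym : g.form (θ t (ι y)) (J (D V.2)) (unitGradientVec g h (θ t (ι y))) = 0 := by
      rw [g.form_symm, hcross]
    rw [hdΦ, hdΦ, warpedProduct_form, realLineMetric_form, SmoothMetric.scaledPullback_form, hΦ]
    simp only [map_add, map_smul, add_apply, smul_apply, smul_eq_mul, hsym, hcross, hpol,
      form_unitGradientVec_self g hν]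
    have := (hwpos 0).ne'
    field_simp
    ring

end Splitting

section Assembly

variable {E : Type*} [NormedAddCommGroup E] [NormedSpace ℝ E] [FiniteDimensional ℝ E]
  {H : Type*} [TopologicalSpace H] {I : ModelWithCorners ℝ E H} [I.Boundaryless]
  {M : Type*} [TopologicalSpace M] [ChartedSpace H M] [IsManifold I ∞ M]
  {E' : Type*} [NormedAddCommGroup E'] [NormedSpace ℝ E'] [FiniteDimensional ℝ E']
  {H' : Type*} [TopologicalSpace H'] {I' : ModelWithCorners ℝ E' H'} [I'.Boundaryless]
  {M' : Type*} [TopologicalSpace M'] [ChartedSpace H' M'] [IsManifold I' ∞ M']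
  {E₁ : Type*} [NormedAddCommGroup E₁] [NormedSpace ℝ E₁] [FiniteDimensional ℝ E₁]
  {H₁ : Type*} [TopologicalSpace H₁] {I₁ : ModelWithCorners ℝ E₁ H₁}
  {M₁ : Type*} [TopologicalSpace M₁] [ChartedSpace H₁ M₁]

theorem differential_comp_fst {h₀ : M → ℝ} (hh : ContMDiff I 𝓘(ℝ, ℝ) ∞ h₀) (p : M × M')
    (V : E × E') : differential (I.prod I') (fun p : M × M' => h₀ p.1) p V =
      differential I h₀ p.1 V.1 := by
  have h1 := mfderiv_comp (I' := I) p (hh.mdifferentiable (by simp) p.1)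
    (mdifferentiableAt_fst (I := I) (I' := I') (x := p))
  rw [mfderiv_fst] at h1
  exact congrArg (fun A : E × E' →L[ℝ] ℝ => A V) h1

theorem gradientNorm_warpedProduct_comp_fst (gB : SmoothMetric I M) (gF : SmoothMetric I' M')
    {f : M → ℝ} (hf : ContMDiff I 𝓘(ℝ, ℝ) ∞ f) (hpos : ∀ x, 0 < f x) {h₀ : M → ℝ}
    (hh : ContMDiff I 𝓘(ℝ, ℝ) ∞ h₀) (p : M × M') :
    gradientNorm (warpedProduct gB gF f hf hpos) (fun p : M × M' => h₀ p.1) p =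
      gradientNorm gB h₀ p.1 := by
  have h1 : (gradientVec gB h₀ p.1, (0 : E')) =
      gradientVec (warpedProduct gB gF f hf hpos) (fun p : M × M' => h₀ p.1) p := by
    rw [eq_gradientVec_iff]
    intro V
    rw [warpedProduct_form, differential_comp_fst hh, form_gradientVec]
    simp
  rw [gradientNorm_eq, gradientNorm_eq, gradientSq_eq, gradientSq_eq, differential_comp_fst hh,
    ← h1]

theorem modelDeriv_prodMap_id {Φ : M₁ → M} {p : M₁ × M'} (hΦ : MDifferentiableAt I₁ I Φ p.1)
    (V : E₁ × E') : modelDeriv (I₁.prod I') (I.prod I') (Prod.map Φ (id : M' → M')) p V =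
      (modelDeriv I₁ I Φ p.1 V.1, V.2) := by
  have d1 : MDifferentiableAt (I₁.prod I') I₁ (Prod.fst : M₁ × M' → M₁) p := mdifferentiableAt_fst
  have d2 : MDifferentiableAt (I₁.prod I') I' (Prod.snd : M₁ × M' → M') p := mdifferentiableAt_snd
  have h1 := mfderiv_prodMk (MDifferentiableAt.comp p hΦ d1) d2
  have h2 := mfderiv_comp (I' := I₁) p hΦ d1
  rw [mfderiv_fst] at h2
  have h3 := mfderiv_snd (I := I₁) (I' := I') (x := p)
  refine (congrArg (fun A : E₁ × E' →L[ℝ] E × E' => A V) h1).trans ?_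
  exact Prod.ext (congrArg (fun A : E₁ × E' →L[ℝ] E => A V) h2)
    (congrArg (fun A : E₁ × E' →L[ℝ] E' => A V) h3)

end Assembly

end

theorem mainTheorem5 {n m : ℕ} (hn : 1 ≤ n) (hm : 1 ≤ m)
    {B : Type u} [TopologicalSpace B] [T2Space B] [SecondCountableTopology B] [ConnectedSpace B]
    [ChartedSpace (EuclideanSpace ℝ (Fin n)) B] [IsManifold (𝓡 n) ∞ B]
    {F : Type v} [TopologicalSpace F] [T2Space F] [SecondCountableTopology F] [ConnectedSpace F]
    [ChartedSpace (EuclideanSpace ℝ (Fin m)) F] [IsManifold (𝓡 m) ∞ F]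
    (gB : SmoothMetric (𝓡 n) B) (gF : SmoothMetric (𝓡 m) F)
    (f : B → ℝ) (hf : ContMDiff (𝓡 n) 𝓘(ℝ, ℝ) ∞ f) (hpos : ∀ b, 0 < f b)
    (hfnc : ¬ ∃ c : ℝ, ∀ b, f b = c)
    (h : B × F → ℝ) (ρ : ℝ)
    (hsol : IsYamabeGradientSoliton (warpedProduct gB gF f hf hpos) h ρ)
    (hnontriv : ¬ ∃ c : ℝ, ∀ p, h p = c)
    (hcomplete : IsCompleteMetric gB) :
    (∀ p : B × F, ¬ IsCriticalPoint ((𝓡 n).prod (𝓡 m)) h p) ∧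
    ∃ (N : Type u) (_ : TopologicalSpace N) (_ : T2Space N) (_ : SecondCountableTopology N)
      (_ : ConnectedSpace N) (_ : ChartedSpace (EuclideanSpace ℝ (Fin (n - 1))) N)
      (_ : IsManifold (𝓡 (n - 1)) ∞ N) (gN : SmoothMetric (𝓡 (n - 1)) N)
      (w : ℝ → ℝ) (hw : ContMDiff 𝓘(ℝ, ℝ) 𝓘(ℝ, ℝ) ∞ w) (hwpos : ∀ r, 0 < w r)
      (Φ : (ℝ × N) ≃ₘ⟮𝓘(ℝ, ℝ).prod (𝓡 (n - 1)), 𝓡 n⟯ B),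
      IsCompleteMetric gN ∧
      (∀ (r : ℝ) (y : N) (z : F),
        gradientNorm (warpedProduct gB gF f hf hpos) h (Φ (r, y), z) = w r) ∧
      IsRiemannianIsometry
        (warpedProduct (warpedProduct realLineMetric gN w hw hwpos) gF (fun q => f (Φ q))
          (hf.comp Φ.contMDiff) (fun q => hpos (Φ q)))
        (warpedProduct gB gF f hf hpos)
        (Φ.prodCongr (Diffeomorph.refl (𝓡 m) F ∞)) := by
  have : Nontrivial (EuclideanSpace ℝ (Fin n)) := Module.nontrivial_of_finrank_pos (R := ℝ) (by
    rw [finrank_euclideanSpace_fin]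
    omega)
  have : Nontrivial (EuclideanSpace ℝ (Fin m)) := Module.nontrivial_of_finrank_pos (R := ℝ) (by
    rw [finrank_euclideanSpace_fin]
    omega)
  obtain ⟨h₀, φ, hh₀, hsplit, hess, hφ⟩ :=
    exists_base_function_of_soliton gB gF hf hpos hfnc hsol hcomplete
  obtain rfl : h = fun p => h₀ p.1 := funext fun p => hsplit p.1 p.2
  have hne := differential_ne_zero_of_hessian_eq gB hf hpos hh₀
    (fun ⟨c, hc⟩ => hnontriv ⟨c, fun p => hc p.1⟩) hess hφ
  refine ⟨fun p hp => hne p.1 ?_, ?_⟩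
  · ext u
    have h1 := differential_comp_fst (I' := 𝓡 m) hh₀ p
      ((u, 0) : EuclideanSpace ℝ (Fin n) × EuclideanSpace ℝ (Fin m))
    rw [← h1]
    exact congrArg (fun A : EuclideanSpace ℝ (Fin n) × EuclideanSpace ℝ (Fin m) →L[ℝ] ℝ =>
      A (u, 0)) hp
  · obtain ⟨θ, hθ⟩ := exists_isConformalFlow gB hcomplete hh₀ hne hess
    obtain ⟨N, i1, i2, i3, i4, i5, i6, gN, w, hw, hwpos, Φ, hgN, hnorm, hiso⟩ :=
      hθ.exists_splitting (E' := EuclideanSpace ℝ (Fin (n - 1))) hcomplete (by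
        rw [finrank_euclideanSpace_fin, finrank_euclideanSpace_fin]
        omega)
    refine ⟨N, i1, i2, i3, i4, i5, i6, gN, w, hw, hwpos, Φ, hgN, fun r y z => ?_, ?_⟩
    · rw [gradientNorm_warpedProduct_comp_fst gB gF hf hpos hh₀]
      exact hnorm r y
    · rintro ⟨q, z⟩
      have hd := modelDeriv_prodMap_id (I' := 𝓡 m) (p := (q, z))
        (Φ.contMDiff.mdifferentiable (by simp) q)
      have key : ∀ V W : (ℝ × EuclideanSpace ℝ (Fin (n - 1))) × EuclideanSpace ℝ (Fin m),
          (warpedProduct gB gF f hf hpos).form (Φ q, z)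
            (modelDeriv ((𝓘(ℝ, ℝ).prod (𝓡 (n - 1))).prod (𝓡 m)) ((𝓡 n).prod (𝓡 m))
              (Prod.map Φ id) (q, z) V)
            (modelDeriv ((𝓘(ℝ, ℝ).prod (𝓡 (n - 1))).prod (𝓡 m)) ((𝓡 n).prod (𝓡 m))
              (Prod.map Φ id) (q, z) W) =
          (warpedProduct (warpedProduct realLineMetric gN w hw hwpos) gF (fun q => f (Φ q))
            (hf.comp Φ.contMDiff) (fun q => hpos (Φ q))).form (q, z) V W := by
        intro V W
        rw [hd, hd, warpedProduct_form, warpedProduct_form, hiso]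
      exact ContinuousLinearMap.ext fun V => ContinuousLinearMap.ext fun W => key V W
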